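/- **Setting.** Let $r_1,r_2>0$, let $H$ be an entire harmonic function on $\mathbb R^2$ and let $\epsilon_0>0$. For $0<\epsilon\le\epsilon_0$ let $B_1,B_2\subset\mathbb R^2$ be two open disks of radii $r_1,r_2$ at distance $\epsilon$ from each other, placed (after a translation and rotation) with centers $\mathbf c_1=(c_1,0)$, $\mathbf c_2=(c_2,0)$, $c_1<0<c_2$, so that the fixed points of the combined reflections across $\partial B_1$ and $\partial B_2$ are $\mathbf p_1=(-\alpha,0)$, $\mathbf p_2=(\alpha,0)$, that is, $$\alpha=\frac{\sqrt{\epsilon(2r_1+\epsilon)(2r_2+\epsilon)(2r_1+2r_2+\epsilon)}}{2(r_1+r_2+\epsilon)},\qquad c_1=-\frac{(r_1+r_2+\epsilon)^2+r_1^2-r_2^2}{2(r_1+r_2+\epsilon)},\qquad c_2=\frac{(r_1+r_2+\epsilon)^2+r_2^2-r_1^2}{2(r_1+r_2+\epsilon)} .$$ Put $\xi_j=\ln(|c_j|+\alpha)-\ln r_j>0$ and $r_*=\sqrt{2r_1r_2/(r_1+r_2)}$. For $k_1,k_2\in(0,\infty)$ put $$\sigma=k_1\chi_{B_1}+k_2\chi_{B_2}+\chi_{\mathbb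 R^2\setminus(B_1\cup B_2)},\quad \tau_j=\frac{k_j-1}{k_j+1},\quad \tau=\tau_1\tau_2,\quad \beta=\frac{r_*(-\ln\tau)}{4\sqrt\epsilon}\ \ (\text{for }0<\tau<1),$$ and $C_x=\partial_xH(\mathbf 0)$, $C_y=\partial_yH(\mathbf 0)$, $\mathbf e_2=(0,1)$. Let $u$ be the (continuous) weak solution, with weak gradient in $L^2_{\rm loc}$, of $$\nabla\cdot\sigma\nabla u=0\ \text{ in }\mathbb R^2,\qquad u(\mathbf x)-H(\mathbf x)=O(|\mathbf x|^{-1})\ \text{ as }|\mathbf x|\to\infty .$$ All constants $C$ below depend only on $r_1,r_2,H,\epsilon_0$ (and $\delta$ in the first claim); they do not depend on $\epsilon,k_1,k_2$ or $\mathbf x$. **Theorem.** *Blow-up only for $\tau\approx1$.* For every $\delta>0$ there is $C$ such that, whenever $0<\epsilon\le\epsilon_0$, $0<k_1,k_2\ne1$ and $\tau\le1-\delta$, we have $|\nabla(u-H)|\le C$ in $\mathbb R^2\setminus(\partial B_1\cup\partial B_2)$. Moreover $\tau$ is close to $1$ exactly when $k_1,k_2$ are both large or both small: for every $M>0$ there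 is $\delta>0$ such that $\tau>1-\delta$ implies $k_1,k_2>M$ or $k_1,k_2<1/M$, and for every $\delta>0$ there is $M>0$ such that $k_1,k_2>M$ or $k_1,k_2<1/M$ implies $\tau>1-\delta$. (a) There is $C$ such that for all $0<\epsilon\le\epsilon_0$ and $1<k_1,k_2<\infty$, in $\mathbb R^2\setminus(B_1\cup B_2)$, $$u(\mathbf x)=H(\mathbf x)+\frac{C_xr_*^2}{2}\Big[\int_{[\mathbf c_1,\mathbf p_1]}\ln|\mathbf x-\mathbf s|\,\varphi_1(\mathbf s)\,d\sigma(\mathbf s)-\int_{[\mathbf p_2,\mathbf c_2]}\ln|\mathbf x-\mathbf s|\,\varphi_2(\mathbf s)\,d\sigma(\mathbf s)\Big]+r(\mathbf x),$$ with the integrable densities (written as functions of $s$, $\mathbf s=(s,0)$; $d\sigma$ is arc length) $$\varphi_1(s)=(\tau+\tau_1)\,2\alpha\beta e^{2\beta\xi_1}\frac{|s+\alpha|^{\beta-1}}{|s-\alpha|^{\beta+1}}\ (c_1\le s\le-\alpha),\qquad \varphi_2(s)=(\tau+\tau_2)\,2\alpha\beta e^{2\beta\xi_2}\frac{(s-\alpha)^{\beta-1}}{(s+\alpha)^{\beta+1}}\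 (\alpha\le s\le c_2),$$ and $|\nabla r|\le C$ in $\mathbb R^2\setminus\overline{B_1\cup B_2}$. (b) There is $C$ such that for all $0<\epsilon\le\epsilon_0$ and $0<k_1,k_2<1$, in $\mathbb R^2\setminus(B_1\cup B_2)$, $$u(\mathbf x)=H(\mathbf x)+\frac{C_yr_*^2}{2}\Big[\int_{[\mathbf c_1,\mathbf p_1]}\frac{\langle\mathbf x-\mathbf s,\mathbf e_2\rangle}{|\mathbf x-\mathbf s|^2}\psi_1(\mathbf s)\,d\sigma(\mathbf s)+\int_{[\mathbf p_2,\mathbf c_2]}\frac{\langle\mathbf x-\mathbf s,\mathbf e_2\rangle}{|\mathbf x-\mathbf s|^2}\psi_2(\mathbf s)\,d\sigma(\mathbf s)\Big]+r(\mathbf x),$$ with the integrable densities $$\psi_1(s)=(\tau-\tau_1)\,e^{2\beta\xi_1}\Big(\frac{s+\alpha}{s-\alpha}\Big)^{\beta}\ (c_1\le s\le-\alpha),\qquad \psi_2(s)=(\tau-\tau_2)\,e^{2\beta\xi_2}\Big(\frac{s-\alpha}{s+\alpha}\Big)^{\beta}\ (\alpha\le s\le c_2),$$ and $|\nabla r|\le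 C$ in $\mathbb R^2\setminus\overline{B_1\cup B_2}$. -/

import Mathlib

open MeasureTheory Set Filter Asymptotics
open scoped ContDiff

noncomputable section

namespace TwoDisks

/-! The plane `ℝ²` is identified with `ℂ` (`z = x + i y`), with its Euclidean norm, its real inner
product and Lebesgue measure. -/

/-! ### Geometry: two disks at distance `ε`, with the limit points of the pencil at `(±α, 0)` -/

/-- `α`, so that the fixed points of the combined reflections are `p₁ = (-α, 0)`, `p₂ = (α, 0)`. -/
def alpha (r₁ r₂ ε : ℝ) : ℝ :=
  Real.sqrt (ε * (2 * r₁ + ε) * (2 * r₂ + ε) * (2 * r₁ + 2 * r₂ + ε)) / (2 * (r₁ + r₂ + ε))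

/-- Abscissa `c₁ < 0` of the center of the left disk. -/
def center₁ (r₁ r₂ ε : ℝ) : ℝ :=
  -(((r₁ + r₂ + ε) ^ 2 + r₁ ^ 2 - r₂ ^ 2) / (2 * (r₁ + r₂ + ε)))

/-- Abscissa `c₂ > 0` of the center of the right disk. -/
def center₂ (r₁ r₂ ε : ℝ) : ℝ :=
  ((r₁ + r₂ + ε) ^ 2 + r₂ ^ 2 - r₁ ^ 2) / (2 * (r₁ + r₂ + ε))

/-- The open disk `B₁`. -/
def disk₁ (r₁ r₂ ε : ℝ) : Set ℂ := Metric.ball ((center₁ r₁ r₂ ε : ℝ) : ℂ) r₁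

/-- The open disk `B₂`. -/
def disk₂ (r₁ r₂ ε : ℝ) : Set ℂ := Metric.ball ((center₂ r₁ r₂ ε : ℝ) : ℂ) r₂

/-- `ξ₁ > 0`: the circle `∂B₁` is the level curve `ξ = -ξ₁` of the bipolar coordinate `ξ`. -/
def xi₁ (r₁ r₂ ε : ℝ) : ℝ := Real.log (|center₁ r₁ r₂ ε| + alpha r₁ r₂ ε) - Real.log r₁

/-- `ξ₂ > 0`: the circle `∂B₂` is the level curve `ξ = ξ₂` of the bipolar coordinate `ξ`. -/
def xi₂ (r₁ r₂ ε : ℝ) : ℝ := Real.log (|center₂ r₁ r₂ ε| + alpha r₁ r₂ ε) - Real.log r₂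

/-- `r_*`. -/
def rStar (r₁ r₂ : ℝ) : ℝ := Real.sqrt (2 * r₁ * r₂ / (r₁ + r₂))

/-- The two boundary circles are at distance `ε` along the line of centers. -/
theorem center_sub_center {r₁ r₂ ε : ℝ} (h₁ : 0 < r₁) (h₂ : 0 < r₂) (hε : 0 < ε) :
    center₂ r₁ r₂ ε - center₁ r₁ r₂ ε = r₁ + r₂ + ε := by
  have : r₁ + r₂ + ε ≠ 0 := by positivity
  unfold center₁ center₂
  field_simp
  ring

theorem alpha_sq {r₁ r₂ ε : ℝ} (h₁ : 0 < r₁) (h₂ : 0 < r₂) (hε : 0 < ε) :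
    alpha r₁ r₂ ε ^ 2 = center₁ r₁ r₂ ε ^ 2 - r₁ ^ 2 ∧
      alpha r₁ r₂ ε ^ 2 = center₂ r₁ r₂ ε ^ 2 - r₂ ^ 2 := by
  have : r₁ + r₂ + ε ≠ 0 := by positivity
  unfold alpha center₁ center₂
  rw [div_pow, Real.sq_sqrt (by positivity)]
  constructor <;> field_simp <;> ring

/-- The reflection across each of the two circles exchanges `p₁` and `p₂`; hence `p₁` and `p₂` are
fixed by both combined reflections. -/
theorem inversion_poles {r₁ r₂ ε : ℝ} (h₁ : 0 < r₁) (h₂ : 0 < r₂) (hε : 0 < ε) :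
    EuclideanGeometry.inversion (center₁ r₁ r₂ ε) r₁ (alpha r₁ r₂ ε) = -alpha r₁ r₂ ε ∧
      EuclideanGeometry.inversion (center₂ r₁ r₂ ε) r₂ (alpha r₁ r₂ ε) = -alpha r₁ r₂ ε := by
  obtain ⟨e₁, e₂⟩ := alpha_sq h₁ h₂ hε
  have key : ∀ c r a : ℝ, 0 < r → a ^ 2 = c ^ 2 - r ^ 2 →
      EuclideanGeometry.inversion c r a = -a := by
    intro c r a hr e
    have hne : a - c ≠ 0 := by
      intro h
      have : a = c := by linarith
      rw [this] at e
      nlinarith [pow_pos hr 2]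
    rw [EuclideanGeometry.inversion, Real.dist_eq, div_pow, sq_abs]
    simp only [vsub_eq_sub, smul_eq_mul, vadd_eq_add]
    field_simp
    linear_combination e
  exact ⟨key _ _ _ h₁ e₁, key _ _ _ h₂ e₂⟩

/-! ### Material parameters -/

/-- The contrast `τ_j = (k_j - 1) / (k_j + 1)` of a disk of conductivity `k_j`. -/
def contrast (k : ℝ) : ℝ := (k - 1) / (k + 1)

/-- `τ = τ₁ τ₂`. -/
def tau (k₁ k₂ : ℝ) : ℝ := contrast k₁ * contrast k₂

/-- `β = r_* (-ln τ) / (4 √ε)`. -/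
def beta (r₁ r₂ ε k₁ k₂ : ℝ) : ℝ :=
  rStar r₁ r₂ * (-Real.log (tau k₁ k₂)) / (4 * Real.sqrt ε)

open Classical in
/-- The conductivity `σ = k₁ χ(B₁) + k₂ χ(B₂) + χ(ℝ² ∖ (B₁ ∪ B₂))`. -/
def conductivity (r₁ r₂ ε k₁ k₂ : ℝ) (x : ℂ) : ℝ :=
  if x ∈ disk₁ r₁ r₂ ε then k₁ else if x ∈ disk₂ r₁ r₂ ε then k₂ else 1

/-! ### The conductivity problem -/

/-- `G` is the weak (distributional) gradient of `u` on the whole plane. -/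
def HasWeakGradient (u : ℂ → ℝ) (G : ℂ → ℂ) : Prop :=
  ∀ φ : ℂ → ℝ, ContDiff ℝ ∞ φ → HasCompactSupport φ → ∀ v : ℂ,
    ∫ x, u x * fderiv ℝ φ x v = -∫ x, inner ℝ (G x) v * φ x

/-- `u` is the (continuous representative of the) weak solution of `∇ · (σ ∇u) = 0` in `ℝ²` with
`u - H = O(|x|⁻¹)` at infinity: `u` has a weak gradient `G` in `L²_loc`, and
`∫ σ G · ∇φ = 0` for all test functions `φ` (here `fderiv ℝ φ x (G x)` is `G · ∇φ` at `x`). -/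
structure IsSolution (σ H u : ℂ → ℝ) : Prop where
  continuous : Continuous u
  weak : ∃ G : ℂ → ℂ,
    (∀ K : Set ℂ, IsCompact K → MemLp G 2 (volume.restrict K)) ∧
    HasWeakGradient u G ∧
    ∀ φ : ℂ → ℝ, ContDiff ℝ ∞ φ → HasCompactSupport φ →
      ∫ x, σ x * fderiv ℝ φ x (G x) = 0
  decay : (fun x => u x - H x) =O[cocompact ℂ] fun x => ‖x‖⁻¹

/-! ### Image line charges on the `x`-axis -/

/-- `∫_{[a,b]} ln |x - s| f(s) ds` over the segment from `(a,0)` to `(b,0)`. -/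
def logCharge (a b : ℝ) (f : ℝ → ℝ) (x : ℂ) : ℝ :=
  ∫ s in Icc a b, Real.log ‖x - (s : ℂ)‖ * f s

/-- `∫_{[a,b]} ⟨x - s, e₂⟩ / |x - s|² f(s) ds` over the segment from `(a,0)` to `(b,0)`. -/
def dipoleCharge (a b : ℝ) (f : ℝ → ℝ) (x : ℂ) : ℝ :=
  ∫ s in Icc a b, (x - (s : ℂ)).im / ‖x - (s : ℂ)‖ ^ 2 * f s

/-- `φ₁`, used on `[c₁, -α]`. There both `s + α` and `s - α` are nonpositive, and the quotient
`(s+α)^(β-1) / (s-α)^(β+1)` is understood as the positive quantity with absolute values. -/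
def phi₁ (r₁ r₂ ε k₁ k₂ s : ℝ) : ℝ :=
  let α := alpha r₁ r₂ ε
  let β := beta r₁ r₂ ε k₁ k₂
  (tau k₁ k₂ + contrast k₁) * (2 * α * β) * Real.exp (2 * β * xi₁ r₁ r₂ ε) *
    (|s + α| ^ (β - 1) / |s - α| ^ (β + 1))

/-- `φ₂`, used on `[α, c₂]`. -/
def phi₂ (r₁ r₂ ε k₁ k₂ s : ℝ) : ℝ :=
  let α := alpha r₁ r₂ ε
  let β := beta r₁ r₂ ε k₁ k₂
  (tau k₁ k₂ + contrast k₂) * (2 * α * β) * Real.exp (2 * β * xi₂ r₁ r₂ ε) *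
    ((s - α) ^ (β - 1) / (s + α) ^ (β + 1))

/-- `ψ₁`, used on `[c₁, -α]`, where `(s + α) / (s - α)` is nonnegative. -/
def psi₁ (r₁ r₂ ε k₁ k₂ s : ℝ) : ℝ :=
  let α := alpha r₁ r₂ ε
  let β := beta r₁ r₂ ε k₁ k₂
  (tau k₁ k₂ - contrast k₁) * Real.exp (2 * β * xi₁ r₁ r₂ ε) * ((s + α) / (s - α)) ^ β

/-- `ψ₂`, used on `[α, c₂]`. -/
def psi₂ (r₁ r₂ ε k₁ k₂ s : ℝ) : ℝ :=
  let α := alpha r₁ r₂ ε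
  let β := beta r₁ r₂ ε k₁ k₂
  (tau k₁ k₂ - contrast k₂) * Real.exp (2 * β * xi₂ r₁ r₂ ε) * ((s - α) / (s + α)) ^ β

/-- `f` is differentiable at every point of `S`, with gradient of norm at most `C`. -/
def GradientBoundedOn (f : ℂ → ℝ) (S : Set ℂ) (C : ℝ) : Prop :=
  ∀ x ∈ S, DifferentiableAt ℝ f x ∧ ‖fderiv ℝ f x‖ ≤ C

end TwoDisks

end

open TwoDisks

open TwoDisks
open scoped Topology Convolution ComplexConjugate

/-! The proof is the method of images in complex form. Write `H = Re F` with `F` entire and put `a =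
α`. Both circles belong to the pencil with limit points `±a`. In the coordinate `(z - a)/(z + a)`,
reflecting across one circle and then across the imaginary axis and taking conjugates into account
is multiplication by a positive number below `1` (`pencilMod`). Repeated reflection of `F`, weighted
by the contrasts, therefore gives for each disk a series in powers of `τ = τ₁τ₂`, whose terms are
`F`, or its Schwarz reflection, composed with Möbius maps having their poles on the axis between
center and limit point (`imageField`). The two series satisfy the matching relation
`PencilData.imageField_eq`. Hence they give a weak solution (`isSolution_of_potentials`), and by
uniqueness (`IsSolution.unique`) every solution `u` is this one.

The derivative of a series is `∑ τⁿ f(sₙ)` with `f(s) = E(Pₛ z) (s² - a²)/(z + s)²`, where `Pₛ` is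
the Möbius map with pole `-s`. Outside the disk `‖z + s‖ ≥ κ (s + ‖z‖)` with `κ` independent of the
gap (`PencilData.norm_add_ge`). So `f` is bounded and of bounded variation in `s`, uniformly in `ε`
and `z` (`norm_imageKernel_sub_le`, `kernelMajorant_sub_le`). For `τ ≤ 1 - δ` this bounds the
gradient: by a geometric series if `τ ≥ 0`, by Abel summation if `τ < 0`.

For `τ` near `1` the series is compared with an integral. The normalized bipolar coordinate `y =
axisRatio` of the positions `sₙ` is a geometric progression, so `τⁿ = y(sₙ)^b` with `b` a quotient
of logarithms. Bounded variation then makes the difference between the series and an integral with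
density `(2a/L) y^b` bounded independently of `τ` (`norm_tsum_sub_integral_le`). Next, `E(Pₛ z)` is
frozen at `E(0)`. The exact `b` and `2a/L` are replaced by `β` and `r_*²/2` at relative cost `O(a)`,
which is affordable because the integral of `s⁻²` over `[a, c]` is at most `1/a`. The remaining
charge is `τ F'(0) + τⱼ conj F'(0)`. When both contrasts have the same sign, one of its real and
imaginary parts is `O(1 - τ)`, and the line integral is only `O(1/(1 - τ))`, so that part is
dropped; this leaves `∂ₓH` in (a) and `∂ᵧH` in (b).

Finally, integration by parts (`integral_log_mul`) shows that the logarithmic line charge in (a) is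
the line of dipoles just found plus a point charge at the center of the disk, whose field outside
the disk is at most `1/r`. In (b) the dipoles appear directly. -/

/-! ### Uniqueness of weak solutions: mollification, Caccioppoli, Liouville. -/

/-- Translation is continuous in `L²`, and the integral is an `L²` inner product. -/
theorem continuous_integral_inner_translate {F Ψ : ℂ → ℂ} (hF : MemLp F 2 volume)
    (hΨ : MemLp Ψ 2 volume) :
    Continuous fun y : ℂ => ∫ x, inner ℝ (Ψ (x - y)) (F x) := by
  let g : ℂ → C(ℂ, ℂ) := fun y => ⟨fun x => x - y, by fun_prop⟩
  have hg : Continuous g := by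
    have : Continuous (fun p : ℂ × ℂ => p.2 - p.1) := by fun_prop
    exact (ContinuousMap.curry ⟨_, this⟩).continuous
  have hgm : ∀ y, MeasurePreserving (g y) volume volume := fun y =>
    measurePreserving_sub_right volume y
  have h := (continuous_const (y := hΨ.toLp Ψ)).compMeasurePreservingLp (p := 2) hg hgm (by simp)
  have h2 : Continuous fun y => inner ℝ
      (Lp.compMeasurePreserving (g y) (hgm y) (hΨ.toLp Ψ)) (hF.toLp F) := h.inner continuous_const
  convert h2 using 2 with y
  rw [L2.inner_def]
  refine integral_congr_ae ?_
  have e1 := Lp.coeFn_compMeasurePreserving (hΨ.toLp Ψ) (hgm y)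
  have e2 := (hgm y).quasiMeasurePreserving.ae_eq_comp hΨ.coeFn_toLp
  filter_upwards [e1, e2, hF.coeFn_toLp] with x h1 h2 h3
  rw [h1, h3, h2]
  rfl

/-- The derivative of a convolution falls on the smooth factor, and `t ↦ ρ (x - t)` is itself a test
function for the weak gradient. -/
theorem fderiv_convolution_apply_of_hasWeakGradient {u : ℂ → ℝ} {G : ℂ → ℂ}
    (hu : Continuous u) (hG : HasWeakGradient u G) {ρ : ℂ → ℝ} (hρ : ContDiff ℝ ∞ ρ)
    (hρc : HasCompactSupport ρ) (x v : ℂ) :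
    fderiv ℝ (u ⋆[ContinuousLinearMap.mul ℝ ℝ, volume] ρ) x v
      = ∫ t, inner ℝ (G t) v * ρ (x - t) := by
  have hl : LocallyIntegrable u volume := hu.locallyIntegrable
  rw [(hρc.hasFDerivAt_convolution_right (ContinuousLinearMap.mul ℝ ℝ) hl
    (hρ.of_le (by simp)) x).fderiv]
  rw [convolution_precompR_apply _ hl (hρc.fderiv ℝ) (hρ.continuous_fderiv (by simp))]
  have hφ : ContDiff ℝ ∞ fun t => ρ (x - t) := hρ.comp (by fun_prop)
  have hφc : HasCompactSupport fun t => ρ (x - t) :=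
    hρc.comp_homeomorph (Homeomorph.subLeft x)
  have key := hG _ hφ hφc v
  have hd : ∀ t, fderiv ℝ (fun t => ρ (x - t)) t v = - fderiv ℝ ρ (x - t) v := by
    intro t
    have h1 : HasFDerivAt ρ (fderiv ℝ ρ (x - t)) (x - t) :=
      (hρ.differentiable (by simp) _).hasFDerivAt
    have h2 : HasFDerivAt (fun t : ℂ => x - t) (-ContinuousLinearMap.id ℝ ℂ) t :=
      (hasFDerivAt_id t).const_sub x
    have h3 : HasFDerivAt (fun t => ρ (x - t)) _ t := h1.comp t h2
    rw [h3.fderiv]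
    simp
  simp only [hd, mul_neg, integral_neg, neg_inj] at key
  rw [convolution_def]
  simpa using key

/-- The gradient vector of a real function at a point of the plane. -/
noncomputable def planeGradient (f : ℂ → ℝ) (x : ℂ) : ℂ := ⟨fderiv ℝ f x 1, fderiv ℝ f x Complex.I⟩

theorem inner_planeGradient (f : ℂ → ℝ) (x v : ℂ) :
    inner ℝ (planeGradient f x) v = fderiv ℝ f x v := by
  have hv : v = v.re • (1 : ℂ) + v.im • Complex.I := by
    simp [Complex.re_add_im]
  conv_rhs => rw [hv]
  rw [map_add, map_smul, map_smul, Complex.inner]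
  simp [planeGradient]

theorem continuous_planeGradient {f : ℂ → ℝ} (hf : ContDiff ℝ ∞ f) :
    Continuous (planeGradient f) := by
  have h := hf.continuous_fderiv (by simp)
  have : planeGradient f = fun x => ((fderiv ℝ f x 1 : ℝ) : ℂ)
      + ((fderiv ℝ f x Complex.I : ℝ) : ℂ) * Complex.I := by
    ext x; apply Complex.ext <;> simp [planeGradient]
  rw [this]
  fun_prop

theorem HasWeakGradient.smooth_mul {w : ℂ → ℝ} {G : ℂ → ℂ} (hw : Continuous w)
    (hGi : LocallyIntegrable G) (hG : HasWeakGradient w G) {η : ℂ → ℝ} (hη : ContDiff ℝ ∞ η) :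
    HasWeakGradient (fun x => η x * w x) (fun x => η x • G x + w x • planeGradient η x) := by
  intro φ hφ hφc v
  have key := hG (fun x => η x * φ x) (hη.mul hφ) hφc.mul_left v
  have hd : ∀ x, fderiv ℝ (fun x => η x * φ x) x v
      = η x * fderiv ℝ φ x v + φ x * fderiv ℝ η x v := by
    intro x
    have h1 := (hη.differentiable (by simp) x).hasFDerivAt
    have h2 := (hφ.differentiable (by simp) x).hasFDerivAt
    have h3 : HasFDerivAt (fun x => η x * φ x) _ x := h1.mul h2
    rw [h3.fderiv]
    simp
  simp only [hd] at key
  have c1 : Continuous fun x => fderiv ℝ φ x v :=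
    (hφ.continuous_fderiv (by simp)).clm_apply continuous_const
  have c2 : Continuous fun x => fderiv ℝ η x v :=
    (hη.continuous_fderiv (by simp)).clm_apply continuous_const
  have s1 : HasCompactSupport fun x => fderiv ℝ φ x v :=
    hφc.fderiv_apply ℝ v
  have hηc := hη.continuous
  have hφ' := hφ.continuous
  have i1 : Integrable fun x => η x * w x * fderiv ℝ φ x v :=
    Continuous.integrable_of_hasCompactSupport (by fun_prop) s1.mul_left
  have i2 : Integrable fun x => w x * fderiv ℝ η x v * φ x :=
    Continuous.integrable_of_hasCompactSupport (by fun_prop) hφc.mul_left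
  have hin : LocallyIntegrable fun x => inner ℝ (G x) v := by
    intro x
    obtain ⟨s, hs, hi⟩ := hGi x
    exact ⟨s, hs, hi.inner_const (𝕜 := ℝ) v⟩
  have i3 : Integrable fun x => inner ℝ (G x) v * (η x * φ x) := by
    have := hin.integrable_smul_right_of_hasCompactSupport (g := fun x => η x * φ x)
      (by fun_prop) hφc.mul_left
    simpa [smul_eq_mul] using this
  have e1 : ∫ x, w x * (η x * fderiv ℝ φ x v + φ x * fderiv ℝ η x v)
      = (∫ x, η x * w x * fderiv ℝ φ x v) + ∫ x, w x * fderiv ℝ η x v * φ x := by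
    rw [← integral_add i1 i2]; congr 1; ext x; ring
  have e2 : ∫ x, inner ℝ (η x • G x + w x • planeGradient η x) v * φ x
      = (∫ x, inner ℝ (G x) v * (η x * φ x)) + ∫ x, w x * fderiv ℝ η x v * φ x := by
    rw [← integral_add i3 i2]; congr 1; ext x
    rw [inner_add_left, real_inner_smul_left, real_inner_smul_left, inner_planeGradient]; ring
  rw [e2]
  rw [e1] at key
  linarith

theorem memLp_locallyIntegrable {G : ℂ → ℂ}
    (h : ∀ K : Set ℂ, IsCompact K → MemLp G 2 (volume.restrict K)) : LocallyIntegrable G := by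
  rw [locallyIntegrable_iff]
  intro K hK
  have : IsFiniteMeasure (volume.restrict K) := ⟨by simpa using hK.measure_lt_top⟩
  exact (h K hK).integrable (by norm_num)

/-- A weak equation tested with smooth functions may be tested with compactly supported continuous
functions whose weak gradient is square integrable. -/
theorem integral_inner_eq_zero_of_weak {σ : ℂ → ℝ} {G : ℂ → ℂ} {C : ℝ}
    (hσm : Measurable σ) (hσ : ∀ x, |σ x| ≤ C)
    (hG : ∀ K : Set ℂ, IsCompact K → MemLp G 2 (volume.restrict K))
    (hweak : ∀ φ : ℂ → ℝ, ContDiff ℝ ∞ φ → HasCompactSupport φ →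
      ∫ x, σ x * fderiv ℝ φ x (G x) = 0)
    {ψ : ℂ → ℝ} {Ψ : ℂ → ℂ} (hψ : Continuous ψ) (hψc : HasCompactSupport ψ)
    (hw : HasWeakGradient ψ Ψ) (hΨ : MemLp Ψ 2 volume) {R : ℝ} 
    (hΨR : ∀ x, R < ‖x‖ → Ψ x = 0) :
    ∫ x, σ x * inner ℝ (Ψ x) (G x) = 0 := by
  -- The margin `1` allows all translates of `Ψ` by `‖y‖ ≤ 1`: their supports stay in `K`, so `σ G`
  -- may be cut off there and becomes globally `L²`.
  set K : Set ℂ := Metric.closedBall 0 (R + 1) with hK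
  have hKm : MeasurableSet K := Metric.isClosed_closedBall.measurableSet
  set F : ℂ → ℂ := K.indicator (fun x => σ x • G x) with hFdef
  have hF : MemLp F 2 volume := by
    rw [hFdef, memLp_indicator_iff_restrict hKm]
    refine MemLp.of_le_mul (c := C) (hG K (isCompact_closedBall _ _)) ?_ ?_
    · exact hσm.aestronglyMeasurable.smul (hG K (isCompact_closedBall _ _)).1
    · refine Eventually.of_forall fun x => ?_
      rw [norm_smul]
      exact mul_le_mul_of_nonneg_right (hσ x) (norm_nonneg _)
  set A : ℂ → ℝ := fun y => ∫ x, inner ℝ (Ψ (x - y)) (F x) with hA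
  have hAc : Continuous A := continuous_integral_inner_translate hF hΨ
  -- vanishing of the averages of `A`
  have key : ∀ ρ : ℂ → ℝ, ContDiff ℝ ∞ ρ → HasCompactSupport ρ →
      (∀ y, 1 < ‖y‖ → ρ y = 0) → ∫ y, ρ y * A y = 0 := by
    intro ρ hρ hρc hρ1
    obtain ⟨φ, hφdef⟩ : ∃ φ : ℂ → ℝ, φ = ψ ⋆[ContinuousLinearMap.mul ℝ ℝ, volume] ρ := ⟨_, rfl⟩
    have hφ : ContDiff ℝ ∞ φ := by
      rw [hφdef]; exact hρc.contDiff_convolution_right _ hψ.locallyIntegrable hρ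
    have hφc : HasCompactSupport φ := by
      rw [hφdef]; exact HasCompactSupport.convolution _ hψc hρc
    have h0 := hweak φ hφ hφc
    have e1 : ∀ x, σ x * fderiv ℝ φ x (G x) = ∫ y, ρ y * inner ℝ (Ψ (x - y)) (F x) := by
      intro x
      rw [hφdef, fderiv_convolution_apply_of_hasWeakGradient hψ hw hρ hρc, ← integral_const_mul,
        ← integral_sub_left_eq_self _ _ x]
      congr 1; ext y
      rw [sub_sub_cancel]
      by_cases hx : x ∈ K
      · rw [hFdef, indicator_of_mem hx, real_inner_smul_right]; ring
      · rw [hFdef, indicator_of_notMem hx, inner_zero_right]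
        by_cases hy : 1 < ‖y‖
        · rw [hρ1 y hy]; ring
        · have : R < ‖x - y‖ := by
            have h1 : R + 1 < ‖x‖ := by simpa [hK] using hx
            have := norm_sub_norm_le x y
            linarith
          rw [hΨR _ this]; simp
    simp_rw [e1] at h0
    rw [integral_integral_swap] at h0
    · rw [← h0]
      congr 1; ext y
      rw [hA, integral_const_mul]
    -- Fubini is justified by `‖Ψ‖‖F‖ ≤ ‖Ψ‖² + ‖F‖²`; each square is integrable against `ρ` on the
    -- product.
    · have hρi : Integrable ρ := hρ.continuous.integrable_of_hasCompactSupport hρc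
      have i1 : Integrable (fun p : ℂ × ℂ => ‖F p.1‖ ^ 2 * ‖ρ p.2‖) (volume.prod volume) :=
        (hF.integrable_norm_pow (by norm_num)).mul_prod hρi.norm
      have i2 : Integrable (fun p : ℂ × ℂ => ‖ρ p.2‖ * ‖Ψ (p.1 - p.2)‖ ^ 2)
          (volume.prod volume) := by
        have := hρi.norm.convolution_integrand (ContinuousLinearMap.mul ℝ ℝ)
          (hΨ.integrable_norm_pow (by norm_num)) (μ := volume) (ν := volume)
        simpa using this
      refine (i1.add i2).mono ?_ ?_
      · have m1 : AEStronglyMeasurable (fun p : ℂ × ℂ => Ψ (p.1 - p.2)) (volume.prod volume) :=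
          hΨ.1.comp_quasiMeasurePreserving
            (quasiMeasurePreserving_sub_of_right_invariant volume volume)
        have m2 : AEStronglyMeasurable (fun p : ℂ × ℂ => F p.1) (volume.prod volume) :=
          hF.1.comp_fst
        have m3 : AEStronglyMeasurable (fun p : ℂ × ℂ => ρ p.2) (volume.prod volume) :=
          hρi.1.comp_snd
        exact m3.mul (m1.inner m2)
      · refine Eventually.of_forall fun p => ?_
        simp only [Function.uncurry, Pi.add_apply]
        refine le_trans ?_ (Real.le_norm_self _)
        rw [norm_mul]
        have h1 : ‖inner ℝ (Ψ (p.1 - p.2)) (F p.1)‖ ≤ ‖Ψ (p.1 - p.2)‖ * ‖F p.1‖ :=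
          norm_inner_le_norm _ _
        nlinarith [norm_nonneg (ρ p.2), sq_nonneg (‖Ψ (p.1 - p.2)‖ - ‖F p.1‖),
          sq_nonneg (‖Ψ (p.1 - p.2)‖), sq_nonneg ‖F p.1‖,
          mul_le_mul_of_nonneg_left h1 (norm_nonneg (ρ p.2)),
          mul_nonneg (norm_nonneg (ρ p.2)) (sq_nonneg (‖Ψ (p.1 - p.2)‖ - ‖F p.1‖)),
          mul_nonneg (norm_nonneg (ρ p.2)) (sq_nonneg ‖Ψ (p.1 - p.2)‖),
          mul_nonneg (norm_nonneg (ρ p.2)) (sq_nonneg ‖F p.1‖)]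
  -- All averages of the continuous function `A` against mollifiers supported in the unit ball
  -- vanish, so its value at `0` does.
  have hA0 : A 0 = 0 := by
    let f : ℕ → ContDiffBump (0 : ℂ) := fun n =>
      ⟨1 / (2 * (n + 1)), 1 / (n + 1), by positivity, by
        rw [div_lt_div_iff₀ (by positivity) (by positivity)]; 
        have : (0 : ℝ) ≤ n := by positivity
        linarith⟩
    have hf : Tendsto (fun n => (f n).rOut) atTop (𝓝 0) := tendsto_one_div_add_atTop_nhds_zero_nat
    have hB : Continuous fun y => A (-y) := hAc.comp continuous_neg
    have ht := ContDiffBump.convolution_tendsto_right_of_continuous (μ := volume) hf hB 0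
    have hz : ∀ n, ((f n).normed volume ⋆[ContinuousLinearMap.lsmul ℝ ℝ, volume]
        fun y => A (-y)) 0 = 0 := by
      intro n
      rw [convolution_def]
      simp only [zero_sub, neg_neg, ContinuousLinearMap.lsmul_apply, smul_eq_mul]
      refine key _ (f n).contDiff_normed (f n).hasCompactSupport_normed fun y hy => ?_
      have : y ∉ Function.support ((f n).normed volume) := by
        rw [(f n).support_normed_eq]
        have h1 : (f n).rOut ≤ 1 := by
          change 1 / ((n : ℝ) + 1) ≤ 1
          rw [div_le_one (by positivity)]
          have : (0 : ℝ) ≤ n := by positivity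
          linarith
        simp only [Metric.mem_ball, dist_zero_right]; linarith
      simpa using this
    simp_rw [hz] at ht
    have := tendsto_nhds_unique ht tendsto_const_nhds
    simpa using this
  rw [← hA0, hA]
  simp only [sub_zero]
  congr 1; ext x
  by_cases hx : x ∈ K
  · rw [hFdef, indicator_of_mem hx, real_inner_smul_right]
  · have : R < ‖x‖ := by
      have h1 : R + 1 < ‖x‖ := by simpa [hK] using hx
      linarith
    rw [hΨR _ this]; simp

/-- Mollifications of `w` have zero gradient, hence are constant, and converge pointwise to `w`. -/
theorem eq_const_of_hasWeakGradient_zero {w : ℂ → ℝ} {G : ℂ → ℂ} (hw : Continuous w)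
    (hG : HasWeakGradient w G) (h0 : G =ᵐ[volume] 0) (x : ℂ) : w x = w 0 := by
  let f : ℕ → ContDiffBump (0 : ℂ) := fun n =>
    ⟨1 / (2 * (n + 1)), 1 / (n + 1), by positivity, by
      rw [div_lt_div_iff₀ (by positivity) (by positivity)]
      have : (0 : ℝ) ≤ n := by positivity
      linarith⟩
  have hf : Tendsto (fun n => (f n).rOut) atTop (𝓝 0) := tendsto_one_div_add_atTop_nhds_zero_nat
  let W : ℕ → ℂ → ℝ := fun n =>
    w ⋆[ContinuousLinearMap.mul ℝ ℝ, volume] ((f n).normed volume)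
  have hW : ∀ y, Tendsto (fun n => W n y) atTop (𝓝 (w y)) := by
    intro y
    have ht := ContDiffBump.convolution_tendsto_right_of_continuous (μ := volume) hf hw y
    refine ht.congr fun n => ?_
    change _ = (w ⋆[ContinuousLinearMap.mul ℝ ℝ, volume] ((f n).normed volume)) y
    rw [convolution_eq_swap, convolution_def]
    simp [mul_comm]
  have hc : ∀ n, W n x = W n 0 := by
    intro n
    have hd : Differentiable ℝ (W n) :=
      ((f n).hasCompactSupport_normed.contDiff_convolution_right _ hw.locallyIntegrable
        (f n).contDiff_normed (n := 1)).differentiable (by simp)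
    refine is_const_of_fderiv_eq_zero (𝕜 := ℝ) hd (fun y => ?_) x 0
    ext v
    rw [fderiv_convolution_apply_of_hasWeakGradient hw hG (f n).contDiff_normed
      (f n).hasCompactSupport_normed]
    rw [zero_apply]
    refine integral_eq_zero_of_ae ?_
    filter_upwards [h0] with t ht
    simp [ht]
  exact tendsto_nhds_unique (hW x) ((hW 0).congr fun n => (hc n).symm)

/-- Caccioppoli inequality with a smooth cutoff. -/
theorem caccioppoli {σ w : ℂ → ℝ} {G : ℂ → ℂ} {m M : ℝ} (hm : 0 < m)
    (hσm : Measurable σ) (hσ : ∀ x, m ≤ σ x ∧ σ x ≤ M) (hw : Continuous w)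
    (hG : ∀ K : Set ℂ, IsCompact K → MemLp G 2 (volume.restrict K))
    (hgrad : HasWeakGradient w G)
    (hweak : ∀ φ : ℂ → ℝ, ContDiff ℝ ∞ φ → HasCompactSupport φ →
      ∫ x, σ x * fderiv ℝ φ x (G x) = 0)
    {η : ℂ → ℝ} (hη : ContDiff ℝ ∞ η) (hηc : HasCompactSupport η) :
    m * ∫ x, (η x) ^ 2 * ‖G x‖ ^ 2 ≤ 4 * M * ∫ x, (w x) ^ 2 * ‖fderiv ℝ η x‖ ^ 2 := by
  obtain ⟨R, hR⟩ := hηc.isCompact.isBounded.subset_closedBall 0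
  have hχ : ContDiff ℝ ∞ fun x => η x * η x := hη.mul hη
  have hχc : HasCompactSupport fun x => η x * η x := hηc.mul_left
  -- The equation is tested with `η² w`, which is admissible by `integral_inner_eq_zero_of_weak`
  -- although it need not be smooth.
  have hwg := HasWeakGradient.smooth_mul hw (memLp_locallyIntegrable hG) hgrad hχ
  set Ψ : ℂ → ℂ := fun x => (η x * η x) • G x + w x • planeGradient (fun x => η x * η x) x
    with hΨdef
  have hηd : ∀ x v, fderiv ℝ (fun x => η x * η x) x v = 2 * η x * fderiv ℝ η x v := by
    intro x v
    have h1 := (hη.differentiable (by simp) x).hasFDerivAt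
    have h3 : HasFDerivAt (fun x => η x * η x) _ x := h1.mul h1
    rw [h3.fderiv]; simp; ring
  have hη0 : ∀ x, R < ‖x‖ → η x = 0 := by
    intro x hx
    refine image_eq_zero_of_notMem_tsupport fun h => ?_
    have := hR h
    simp at this; linarith
  have hΨ0 : ∀ x, R < ‖x‖ → Ψ x = 0 := by
    intro x hx
    have : planeGradient (fun x => η x * η x) x = 0 := by
      apply Complex.ext <;> simp [planeGradient, hηd, hη0 x hx]
    simp [hΨdef, this, hη0 x hx]
  have hK : IsCompact (Metric.closedBall (0 : ℂ) R) := isCompact_closedBall _ _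
  have hηb : ∃ C, ∀ x, ‖η x * η x‖ ≤ C := hχ.continuous.bounded_above_of_compact_support hχc
  obtain ⟨C, hC⟩ := hηb
  have mχ : MemLp (fun x => (η x * η x) • G x) 2 volume := by
    have : (fun x => (η x * η x) • G x)
        = (Metric.closedBall (0 : ℂ) R).indicator (fun x => (η x * η x) • G x) := by
      ext x
      by_cases hx : x ∈ Metric.closedBall (0 : ℂ) R
      · rw [indicator_of_mem hx]
      · rw [indicator_of_notMem hx, hη0 x (by simpa using hx)]; simp
    rw [this, memLp_indicator_iff_restrict hK.measurableSet]
    refine MemLp.of_le_mul (c := C) (hG _ hK) ?_ ?_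
    · exact hχ.continuous.aestronglyMeasurable.smul (hG _ hK).1
    · refine Eventually.of_forall fun x => ?_
      rw [norm_smul]
      exact mul_le_mul_of_nonneg_right (hC x) (norm_nonneg _)
  have cη := hη.continuous
  have mη : MemLp (fun x => η x • G x) 2 volume := by
    obtain ⟨D, hD⟩ := hη.continuous.bounded_above_of_compact_support hηc
    have : (fun x => η x • G x)
        = (Metric.closedBall (0 : ℂ) R).indicator (fun x => η x • G x) := by
      ext x
      by_cases hx : x ∈ Metric.closedBall (0 : ℂ) R
      · rw [indicator_of_mem hx]
      · rw [indicator_of_notMem hx, hη0 x (by simpa using hx)]; simp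
    rw [this, memLp_indicator_iff_restrict hK.measurableSet]
    refine MemLp.of_le_mul (c := D) (hG _ hK) ?_ ?_
    · exact cη.aestronglyMeasurable.smul (hG _ hK).1
    · refine Eventually.of_forall fun x => ?_
      rw [norm_smul]
      exact mul_le_mul_of_nonneg_right (hD x) (norm_nonneg _)
  have hpg0 : HasCompactSupport fun x => w x • planeGradient (fun x => η x * η x) x := by
    refine HasCompactSupport.of_support_subset_isCompact hK fun x hx => ?_
    by_contra h
    apply hx
    have : planeGradient (fun x => η x * η x) x = 0 := by
      apply Complex.ext <;> simp [planeGradient, hηd, hη0 x (by simpa using h)]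
    simp [this]
  have hΨ : MemLp Ψ 2 volume := by
    refine mχ.add ?_
    exact (hw.smul (continuous_planeGradient hχ)).memLp_of_hasCompactSupport hpg0
  have h0 := integral_inner_eq_zero_of_weak (C := M) hσm
    (fun x => by rw [abs_of_pos (hm.trans_le (hσ x).1)]; exact (hσ x).2)
    hG hweak (hχ.continuous.mul hw) hχc.mul_right hwg hΨ hΨ0
  have hin : ∀ x, inner ℝ (Ψ x) (G x)
      = (η x) ^ 2 * ‖G x‖ ^ 2 + 2 * w x * η x * fderiv ℝ η x (G x) := by
    intro x
    rw [hΨdef]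
    simp only [inner_add_left, real_inner_smul_left, inner_planeGradient, hηd,
      real_inner_self_eq_norm_sq]
    ring
  have i1 : Integrable fun x => (η x) ^ 2 * ‖G x‖ ^ 2 := by
    have := mη.integrable_norm_pow (p := 2) (by norm_num)
    refine this.congr (Eventually.of_forall fun x => ?_)
    simp [mul_pow]
  have cd : Continuous fun x => fderiv ℝ η x := hη.continuous_fderiv (by simp)
  have i2 : Integrable fun x => (w x) ^ 2 * ‖fderiv ℝ η x‖ ^ 2 := by
    refine Continuous.integrable_of_hasCompactSupport (by fun_prop) ?_
    refine HasCompactSupport.mul_left ?_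
    have := (hηc.fderiv ℝ).norm
    refine this.comp_left (g := fun t : ℝ => t ^ 2) (by simp)
  have im : AEStronglyMeasurable σ volume := hσm.aestronglyMeasurable
  -- Young's inequality on the cross term absorbs half of `η² ‖G‖²`. Since the integral on the right
  -- vanishes, the constants `m/2` and `2M` give the stated `4M`.
  have hpt : ∀ x, m / 2 * ((η x) ^ 2 * ‖G x‖ ^ 2)
      - 2 * M * ((w x) ^ 2 * ‖fderiv ℝ η x‖ ^ 2) ≤ σ x * inner ℝ (Ψ x) (G x) := by
    intro x
    rw [hin]
    have hop : |fderiv ℝ η x (G x)| ≤ ‖fderiv ℝ η x‖ * ‖G x‖ := (fderiv ℝ η x).le_opNorm _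
    set d := fderiv ℝ η x (G x)
    set D := ‖fderiv ℝ η x‖
    set g := ‖G x‖
    have h1 : -(1 / 2 * (η x ^ 2 * g ^ 2)) - 2 * ((w x) ^ 2 * D ^ 2) ≤ 2 * w x * η x * d := by
      have h2 : |2 * w x * η x * d| ≤ 2 * |w x| * |η x| * (D * g) := by
        rw [abs_mul, abs_mul, abs_mul, abs_two]
        exact mul_le_mul_of_nonneg_left hop (by positivity)
      have h3 := neg_abs_le (2 * w x * η x * d)
      nlinarith [sq_nonneg (|η x| * g - 2 * (|w x| * D)), sq_abs (η x), sq_abs (w x)]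
    have h4 := hσ x
    have h5 : 0 ≤ η x ^ 2 * g ^ 2 := by positivity
    have h6 : 0 ≤ w x ^ 2 * D ^ 2 := by positivity
    have h7 : σ x * (-(1 / 2 * (η x ^ 2 * g ^ 2)) - 2 * ((w x) ^ 2 * D ^ 2))
        ≤ σ x * (2 * w x * η x * d) :=
      mul_le_mul_of_nonneg_left h1 (hm.le.trans h4.1)
    nlinarith [mul_le_mul_of_nonneg_right h4.1 h5, mul_le_mul_of_nonneg_right h4.2 h6]
  have i3 : Integrable fun x => σ x * inner ℝ (Ψ x) (G x) := by
    have hi : Integrable fun x => inner ℝ (Ψ x) (G x) := by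
      have hgl : AEStronglyMeasurable G volume :=
        (memLp_locallyIntegrable hG).aestronglyMeasurable
      refine ((i1.const_mul 2).add (i2.const_mul 2)).mono' (hΨ.1.inner hgl) ?_
      refine Eventually.of_forall fun x => ?_
      simp only [Pi.add_apply]
      rw [hin, Real.norm_eq_abs]
      have hop : |fderiv ℝ η x (G x)| ≤ ‖fderiv ℝ η x‖ * ‖G x‖ := (fderiv ℝ η x).le_opNorm _
      refine (abs_add_le _ _).trans ?_
      have h2 : |2 * w x * η x * fderiv ℝ η x (G x)|
          ≤ 2 * |w x| * |η x| * (‖fderiv ℝ η x‖ * ‖G x‖) := by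
        rw [abs_mul, abs_mul, abs_mul, abs_two]
        exact mul_le_mul_of_nonneg_left hop (by positivity)
      rw [abs_of_nonneg (by positivity)]
      nlinarith [sq_nonneg (|η x| * ‖G x‖ - (|w x| * ‖fderiv ℝ η x‖)), sq_abs (η x), sq_abs (w x)]
    exact hi.bdd_mul (c := M) im (Eventually.of_forall fun x => by
      rw [Real.norm_of_nonneg (hm.le.trans (hσ x).1)]; exact (hσ x).2)
  have := integral_mono ((i1.const_mul (m / 2)).sub (i2.const_mul (2 * M))) i3 hpt
  simp only [Pi.sub_apply] at this
  rw [integral_sub (i1.const_mul (m / 2)) (i2.const_mul (2 * M)), integral_const_mul,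
    integral_const_mul, h0] at this
  linarith

/-- For a cutoff at scale `R`, both `w` and the gradient of the cutoff are `O(1/R)` on a region of
area `O(R²)`. The Caccioppoli inequality bounds the energy in any fixed ball by `O(R⁻²)`. -/
theorem ae_zero_of_decaying_weak_solution {σ w : ℂ → ℝ} {G : ℂ → ℂ} {m M : ℝ} (hm : 0 < m)
    (hσm : Measurable σ) (hσ : ∀ x, m ≤ σ x ∧ σ x ≤ M) (hw : Continuous w)
    (hG : ∀ K : Set ℂ, IsCompact K → MemLp G 2 (volume.restrict K))
    (hgrad : HasWeakGradient w G)
    (hweak : ∀ φ : ℂ → ℝ, ContDiff ℝ ∞ φ → HasCompactSupport φ →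
      ∫ x, σ x * fderiv ℝ φ x (G x) = 0)
    (hdec : w =O[cocompact ℂ] fun x => ‖x‖⁻¹) : G =ᵐ[volume] 0 := by
  have hM : 0 < M := hm.trans_le ((hσ 0).1.trans (hσ 0).2)
  obtain ⟨C, hC0, hC⟩ := hdec.exists_pos
  rw [isBigOWith_iff] at hC
  obtain ⟨R₁, hR₁⟩ : ∃ R₁ : ℝ, ∀ x : ℂ, R₁ < ‖x‖ → |w x| ≤ C * ‖x‖⁻¹ := by
    rw [Filter.Eventually, Metric.mem_cocompact_iff_closedBall_compl_subset 0] at hC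
    obtain ⟨r, hr⟩ := hC
    refine ⟨r, fun x hx => ?_⟩
    have := hr (show x ∈ (Metric.closedBall 0 r)ᶜ by simpa using hx)
    simpa using this
  let f : ContDiffBump (0 : ℂ) := ⟨1, 2, one_pos, one_lt_two⟩
  obtain ⟨D, hD⟩ : ∃ D, ∀ x, ‖fderiv ℝ f x‖ ≤ D :=
    (f.contDiff.continuous_fderiv (n := 1) (by simp)).bounded_above_of_compact_support
      (f.hasCompactSupport.fderiv ℝ)
  have hD0 : 0 ≤ D := (norm_nonneg _).trans (hD 0)
  -- the energy in a fixed ball is bounded by a multiple of `R⁻²`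
  have main : ∀ R₀ R : ℝ, 1 ≤ R → R₀ ≤ R → R₁ < R →
      m * ∫ x in Metric.closedBall (0 : ℂ) R₀, ‖G x‖ ^ 2
        ≤ (4 * M * (C ^ 2 * D ^ 2) * (4 * Real.pi)) / R ^ 2 := by
    intro R₀ R hR1 hR0 hRR
    have hRpos : 0 < R := by linarith
    set η : ℂ → ℝ := fun x => f (R⁻¹ • x) with hηdef
    have hη : ContDiff ℝ ∞ η := f.contDiff.comp (contDiff_const_smul _)
    have hηc : HasCompactSupport η :=
      f.hasCompactSupport.comp_homeomorph (Homeomorph.smulOfNeZero R⁻¹ (by positivity))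
    have hfd : ∀ x, ‖fderiv ℝ η x‖ ≤ D * R⁻¹ := by
      intro x
      have h1 : HasFDerivAt f (fderiv ℝ f (R⁻¹ • x)) (R⁻¹ • x) :=
        ((f.contDiff (n := 1)).differentiable (by simp) _).hasFDerivAt
      have h2 : HasFDerivAt (fun x : ℂ => R⁻¹ • x) (R⁻¹ • ContinuousLinearMap.id ℝ ℂ) x :=
        (R⁻¹ • ContinuousLinearMap.id ℝ ℂ).hasFDerivAt
      have h3 : HasFDerivAt η _ x := h1.comp x h2
      rw [h3.fderiv]
      refine (ContinuousLinearMap.opNorm_comp_le _ _).trans ?_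
      refine mul_le_mul (hD _) ?_ (norm_nonneg _) hD0
      rw [norm_smul, Real.norm_of_nonneg (by positivity)]
      exact mul_le_of_le_one_right (by positivity) ContinuousLinearMap.norm_id_le
    have hin : ∀ x, ‖x‖ < R → fderiv ℝ η x = 0 := by
      intro x hx
      have : η =ᶠ[𝓝 x] fun _ => 1 := by
        filter_upwards [(isOpen_lt continuous_norm continuous_const).mem_nhds hx] with y hy
        refine f.one_of_mem_closedBall ?_
        simp only [mem_closedBall_zero_iff, norm_smul, norm_inv, Real.norm_of_nonneg hRpos.le]
        change R⁻¹ * ‖y‖ ≤ 1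
        rw [inv_mul_le_iff₀ hRpos]; simpa using (le_of_lt hy)
      rw [this.fderiv_eq]; simp
    have hout : ∀ x, 2 * R < ‖x‖ → fderiv ℝ η x = 0 := by
      intro x hx
      have : η =ᶠ[𝓝 x] fun _ => 0 := by
        filter_upwards [(isOpen_lt continuous_const continuous_norm).mem_nhds hx] with y hy
        refine f.zero_of_le_dist ?_
        simp only [dist_zero_right, norm_smul, norm_inv, Real.norm_of_nonneg hRpos.le]
        change 2 ≤ R⁻¹ * ‖y‖
        rw [le_inv_mul_iff₀ hRpos, mul_comm]; exact le_of_lt hy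
      rw [this.fderiv_eq]; simp
    have hB : ∀ x, (w x) ^ 2 * ‖fderiv ℝ η x‖ ^ 2
        ≤ (Metric.closedBall (0 : ℂ) (2 * R)).indicator
          (fun _ => C ^ 2 * D ^ 2 / R ^ 4) x := by
      intro x
      by_cases hx : x ∈ Metric.closedBall (0 : ℂ) (2 * R)
      · rw [indicator_of_mem hx]
        rcases lt_or_ge ‖x‖ R with h | h
        · rw [hin x h]; simp; positivity
        · have h1 := hR₁ x (by linarith)
          have h2 : |w x| ≤ C * R⁻¹ := h1.trans (by gcongr)
          have h3 : (w x) ^ 2 ≤ (C * R⁻¹) ^ 2 := sq_le_sq' (by linarith [neg_abs_le (w x)])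
            ((le_abs_self _).trans h2)
          have h4 : ‖fderiv ℝ η x‖ ^ 2 ≤ (D * R⁻¹) ^ 2 := by
            gcongr; exact hfd x
          calc _ ≤ (C * R⁻¹) ^ 2 * (D * R⁻¹) ^ 2 := by gcongr
            _ = _ := by field_simp
      · rw [indicator_of_notMem hx, hout x (by simpa using hx)]; simp
    have hcac := caccioppoli hm hσm hσ hw hG hgrad hweak hη hηc
    have hK2 := (isCompact_closedBall (0 : ℂ) (2 * R))
    have hup : ∫ x, (w x) ^ 2 * ‖fderiv ℝ η x‖ ^ 2 ≤ C ^ 2 * D ^ 2 * (4 * Real.pi) / R ^ 2 := by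
      have hi : Integrable ((Metric.closedBall (0 : ℂ) (2 * R)).indicator
          (fun _ => C ^ 2 * D ^ 2 / R ^ 4)) := by
        rw [integrable_indicator_iff hK2.measurableSet]
        exact integrableOn_const hK2.measure_lt_top.ne
      refine (integral_mono_of_nonneg (Eventually.of_forall fun x => by positivity) hi
        (Eventually.of_forall hB)).trans (le_of_eq ?_)
      rw [integral_indicator hK2.measurableSet, setIntegral_const, measureReal_def,
        Complex.volume_closedBall]
      simp only [ENNReal.toReal_mul, ENNReal.toReal_pow, smul_eq_mul,
        ENNReal.toReal_ofReal (show 0 ≤ 2 * R by positivity)]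
      simp
      field_simp
      ring
    have hlow : ∫ x in Metric.closedBall (0 : ℂ) R₀, ‖G x‖ ^ 2
        ≤ ∫ x, (η x) ^ 2 * ‖G x‖ ^ 2 := by
      rw [← integral_indicator (isCompact_closedBall _ _).measurableSet]
      refine integral_mono_of_nonneg (Eventually.of_forall fun x => ?_) ?_
        (Eventually.of_forall fun x => ?_)
      · exact indicator_nonneg (fun _ _ => by positivity) x
      · have i0 : LocallyIntegrable fun x => ‖G x‖ ^ 2 := by
          rw [locallyIntegrable_iff]
          exact fun K hK => (hG K hK).integrable_norm_pow (by norm_num)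
        refine (i0.integrable_smul_left_of_hasCompactSupport (g := fun x => η x ^ 2)
          (hη.continuous.pow 2) (hηc.comp_left (g := fun t : ℝ => t ^ 2) (by simp))).congr ?_
        exact Eventually.of_forall fun x => by simp
      · by_cases hx : x ∈ Metric.closedBall (0 : ℂ) R₀
        · rw [indicator_of_mem hx]
          have : η x = 1 := by
            refine f.one_of_mem_closedBall ?_
            simp only [mem_closedBall_zero_iff, norm_smul, norm_inv,
              Real.norm_of_nonneg hRpos.le] at hx ⊢
            change R⁻¹ * ‖x‖ ≤ 1
            rw [inv_mul_le_iff₀ hRpos]; linarith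
          simp [this]
        · rw [indicator_of_notMem hx]; positivity
    calc _ ≤ m * ∫ x, (η x) ^ 2 * ‖G x‖ ^ 2 := by gcongr
      _ ≤ _ := hcac
      _ ≤ 4 * M * (C ^ 2 * D ^ 2 * (4 * Real.pi) / R ^ 2) := by gcongr
      _ = _ := by ring
  have hball : ∀ n : ℕ, ∀ᵐ x, x ∈ Metric.closedBall (0 : ℂ) n → G x = 0 := by
    intro n
    have h1 : m * ∫ x in Metric.closedBall (0 : ℂ) n, ‖G x‖ ^ 2 ≤ 0 := by
      have ht : Tendsto (fun R : ℝ => (4 * M * (C ^ 2 * D ^ 2) * (4 * Real.pi)) / R ^ 2)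
          atTop (𝓝 0) := (tendsto_pow_atTop two_ne_zero).const_div_atTop _
      refine ge_of_tendsto ht ?_
      filter_upwards [eventually_ge_atTop 1, eventually_ge_atTop (n : ℝ),
        eventually_gt_atTop R₁] with R h1 h2 h3
      exact main n R h1 h2 h3
    have h2 : ∫ x in Metric.closedBall (0 : ℂ) n, ‖G x‖ ^ 2 = 0 :=
      le_antisymm (by nlinarith) (integral_nonneg fun x => by positivity)
    rw [integral_eq_zero_iff_of_nonneg (fun x => by positivity)
      ((hG _ (isCompact_closedBall _ _)).integrable_norm_pow (by norm_num))] at h2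
    have := (ae_restrict_iff' (isCompact_closedBall (0 : ℂ) n).measurableSet).1 h2
    filter_upwards [this] with x hx h
    simpa using hx h
  rw [← ae_all_iff] at hball
  filter_upwards [hball] with x hx
  obtain ⟨n, hn⟩ := exists_nat_ge ‖x‖
  exact hx n (by simpa using hn)

/-- The difference of two solutions is a decaying weak solution, so its gradient vanishes; it is a
constant which tends to `0` at infinity. -/
theorem IsSolution.unique {σ H u v : ℂ → ℝ} {m M : ℝ} (hm : 0 < m)
    (hσm : Measurable σ) (hσ : ∀ x, m ≤ σ x ∧ σ x ≤ M)
    (hu : IsSolution σ H u) (hv : IsSolution σ H v) : u = v := by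
  obtain ⟨G₁, hG₁, hg₁, hw₁⟩ := hu.weak
  obtain ⟨G₂, hG₂, hg₂, hw₂⟩ := hv.weak
  have hcu := hu.continuous
  have hcv := hv.continuous
  have l₁ := memLp_locallyIntegrable hG₁
  have l₂ := memLp_locallyIntegrable hG₂
  have hw : Continuous fun x => u x - v x := hcu.sub hcv
  have hG : ∀ K : Set ℂ, IsCompact K → MemLp (fun x => G₁ x - G₂ x) 2 (volume.restrict K) :=
    fun K hK => (hG₁ K hK).sub (hG₂ K hK)
  have hin : ∀ {G : ℂ → ℂ}, LocallyIntegrable G → ∀ {φ : ℂ → ℝ}, Continuous φ →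
      HasCompactSupport φ → ∀ v, Integrable fun x => inner ℝ (G x) v * φ x := by
    intro G hl φ hφ hφc v
    have hl' : LocallyIntegrable fun x => inner ℝ (G x) v := by
      intro x
      obtain ⟨s, hs, hi⟩ := hl x
      exact ⟨s, hs, hi.inner_const (𝕜 := ℝ) v⟩
    simpa [smul_eq_mul] using hl'.integrable_smul_right_of_hasCompactSupport hφ hφc
  have hgrad : HasWeakGradient (fun x => u x - v x) (fun x => G₁ x - G₂ x) := by
    intro φ hφ hφc e
    have c1 : Continuous fun x => fderiv ℝ φ x e :=
      (hφ.continuous_fderiv (by simp)).clm_apply continuous_const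
    have s1 : HasCompactSupport fun x => fderiv ℝ φ x e := hφc.fderiv_apply ℝ e
    have := hφ.continuous
    simp only [sub_mul, inner_sub_left]
    rw [integral_sub, integral_sub, hg₁ φ hφ hφc e, hg₂ φ hφ hφc e]
    · ring
    · exact hin l₁ hφ.continuous hφc e
    · exact hin l₂ hφ.continuous hφc e
    · exact Continuous.integrable_of_hasCompactSupport (by fun_prop) s1.mul_left
    · exact Continuous.integrable_of_hasCompactSupport (by fun_prop) s1.mul_left
  have hint : ∀ {G : ℂ → ℂ}, LocallyIntegrable G → ∀ {φ : ℂ → ℝ}, ContDiff ℝ ∞ φ →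
      HasCompactSupport φ → Integrable fun x => σ x * fderiv ℝ φ x (G x) := by
    intro G hl φ hφ hφc
    have cd : Continuous fun x => fderiv ℝ φ x := hφ.continuous_fderiv (by simp)
    have i0 : Integrable fun x => fderiv ℝ φ x (G x) := by
      have e : (fun x => fderiv ℝ φ x (G x)) = fun x =>
          inner ℝ (G x) 1 * fderiv ℝ φ x 1 + inner ℝ (G x) Complex.I * fderiv ℝ φ x Complex.I := by
        ext x
        rw [← inner_planeGradient φ x (G x)]
        simp [Complex.inner, planeGradient]
      rw [e]
      exact (hin hl (cd.clm_apply continuous_const) (hφc.fderiv_apply ℝ _) _).add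
        (hin hl (cd.clm_apply continuous_const) (hφc.fderiv_apply ℝ _) _)
    exact i0.bdd_mul (c := M) hσm.aestronglyMeasurable (Eventually.of_forall fun x => by
      rw [Real.norm_of_nonneg (hm.le.trans (hσ x).1)]; exact (hσ x).2)
  have hweak : ∀ φ : ℂ → ℝ, ContDiff ℝ ∞ φ → HasCompactSupport φ →
      ∫ x, σ x * fderiv ℝ φ x (G₁ x - G₂ x) = 0 := by
    intro φ hφ hφc
    simp only [map_sub, mul_sub]
    rw [integral_sub (hint l₁ hφ hφc) (hint l₂ hφ hφc), hw₁ φ hφ hφc, hw₂ φ hφ hφc, sub_zero]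
  have hdec : (fun x => u x - v x) =O[cocompact ℂ] fun x => ‖x‖⁻¹ := by
    refine (hu.decay.sub hv.decay).congr_left fun x => ?_
    ring
  have h0 := ae_zero_of_decaying_weak_solution hm hσm hσ hw hG hgrad hweak hdec
  have hconst := eq_const_of_hasWeakGradient_zero hw hgrad h0
  have ht : Tendsto (fun x => u x - v x) (cocompact ℂ) (𝓝 0) :=
    hdec.trans_tendsto (tendsto_norm_cocompact_atTop.inv_tendsto_atTop)
  have hc : u 0 - v 0 = 0 :=
    tendsto_nhds_unique (tendsto_const_nhds.congr fun x => (hconst x).symm) ht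
  ext x
  have := hconst x
  linarith

/-! ### Möbius maps of the pencil and the image series. -/

/-- The Möbius map `z ↦ (s z + a²) / (z + s)`, which fixes `a` and `-a`. -/
noncomputable def pencilMap (a s : ℝ) (z : ℂ) : ℂ := (s * z + a ^ 2) / (z + s)

/-- The parameter of the Möbius map with fixed points `±a` and multiplier `x`. -/
noncomputable def pencilCenter (a x : ℝ) : ℝ := a * (1 + x) / (1 - x)

/-- The multiplier of the Möbius map with parameter `c`. -/
noncomputable def pencilMod (a c : ℝ) : ℝ := (c - a) / (c + a)

/-- The Schwarz reflection `z ↦ conj (F (conj z))` of a function. -/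
noncomputable def conjFun (F : ℂ → ℂ) (z : ℂ) : ℂ := conj (F (conj z))

theorem pencilMap_eq {a s : ℝ} {z : ℂ} (h : z + s ≠ 0) :
    pencilMap a s z = s - (s ^ 2 - a ^ 2) / (z + s) := by
  unfold pencilMap
  field_simp
  ring

theorem pencilMap_conj (a s : ℝ) (z : ℂ) : pencilMap a s (conj z) = conj (pencilMap a s z) := by
  simp [pencilMap]

theorem hasDerivAt_pencilMap {a s : ℝ} {z : ℂ} (h : z + s ≠ 0) :
    HasDerivAt (pencilMap a s) ((s ^ 2 - a ^ 2) / (z + s) ^ 2) z := by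
  have h1 : HasDerivAt (fun z : ℂ => (s : ℂ) * z + (a : ℂ) ^ 2) s z := by
    simpa using ((hasDerivAt_id z).const_mul (s : ℂ)).add_const ((a : ℂ) ^ 2)
  have h2 : HasDerivAt (fun z : ℂ => z + (s : ℂ)) 1 z := (hasDerivAt_id z).add_const _
  have h3 : HasDerivAt (pencilMap a s) _ z := h1.div h2 h
  convert h3 using 1
  field_simp
  ring

theorem norm_pencilMap_le {a s η : ℝ} {z : ℂ} (ha : 0 < a) (hs : a ≤ s) (hη : 0 < η)
    (h : η ≤ ‖z + s‖) : ‖pencilMap a s z‖ ≤ s + (s ^ 2 - a ^ 2) / η := by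
  have hne : z + s ≠ 0 := norm_pos_iff.1 (hη.trans_le h)
  have h0 : 0 ≤ s ^ 2 - a ^ 2 := by nlinarith
  rw [pencilMap_eq hne]
  refine (norm_sub_le _ _).trans ?_
  rw [norm_div, Complex.norm_real, Real.norm_of_nonneg (by linarith)]
  have : ‖(s : ℂ) ^ 2 - (a : ℂ) ^ 2‖ = s ^ 2 - a ^ 2 := by
    rw [← Complex.ofReal_pow, ← Complex.ofReal_pow, ← Complex.ofReal_sub, Complex.norm_real,
      Real.norm_of_nonneg h0]
  rw [this]
  gcongr

/-- This is the addition law of a hyperbolic cotangent: `pencilCenter` inverts `s ↦ (s - a)/(s +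
a)`, so multiplying multipliers composes parameters. -/
theorem pencilCenter_mul {a x y : ℝ} (hx : 0 < x) (hx1 : x < 1) (hy1 : y < 1) :
    pencilCenter a (x * y) * (pencilCenter a x + pencilCenter a y)
      = pencilCenter a x * pencilCenter a y + a ^ 2 := by
  have h1 : 1 - x ≠ 0 := by linarith
  have h2 : 1 - y ≠ 0 := by linarith
  have h3 : 1 - x * y ≠ 0 := by nlinarith
  unfold pencilCenter
  field_simp
  ring

theorem le_pencilCenter {a x : ℝ} (ha : 0 < a) (hx : 0 ≤ x) (hx1 : x < 1) :
    a ≤ pencilCenter a x := by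
  unfold pencilCenter
  rw [le_div_iff₀ (by linarith)]
  nlinarith

theorem pencilCenter_mono {a x y : ℝ} (ha : 0 < a) (hxy : x ≤ y) (hy1 : y < 1) :
    pencilCenter a x ≤ pencilCenter a y := by
  unfold pencilCenter
  rw [div_le_div_iff₀ (by linarith) (by linarith)]
  nlinarith [mul_le_mul_of_nonneg_left hxy ha.le]

theorem pencilMod_pos {a c : ℝ} (ha : 0 < a) (hc : a < c) : 0 < pencilMod a c :=
  div_pos (by linarith) (by linarith)

theorem pencilMod_lt_one {a c : ℝ} (ha : 0 < a) (hc : a < c) : pencilMod a c < 1 := by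
  unfold pencilMod
  rw [div_lt_one (by linarith)]
  linarith

theorem pencilCenter_pencilMod {a c : ℝ} (ha : 0 < a) (hc : a < c) :
    pencilCenter a (pencilMod a c) = c := by
  unfold pencilCenter pencilMod
  have h1 : c + a ≠ 0 := by linarith
  have h2 : 1 + (c - a) / (c + a) = 2 * c / (c + a) := by field_simp; ring
  have h3 : 1 - (c - a) / (c + a) = 2 * a / (c + a) := by field_simp; ring
  rw [h2, h3]
  have h4 := ha.ne'
  field_simp

/-- In the coordinate `(z - a)/(z + a)` the map with parameter `pencilCenter a x` is multiplication
by `x`. The two nonvanishing hypotheses keep `z` off the poles. -/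
theorem pencilMap_pencilMap {a x y : ℝ} {z : ℂ} (ha : 0 < a) (hx : 0 < x) (hx1 : x < 1)
    (hy : 0 < y) (hy1 : y < 1) (h1 : z + pencilCenter a y ≠ 0)
    (h2 : z + pencilCenter a (x * y) ≠ 0) :
    pencilMap a (pencilCenter a x) (pencilMap a (pencilCenter a y) z)
      = pencilMap a (pencilCenter a (x * y)) z := by
  have hs := pencilCenter_mul (a := a) hx hx1 hy1
  have p1 := le_pencilCenter ha hx.le hx1
  have p2 := le_pencilCenter ha hy.le hy1
  set s := pencilCenter a x
  set s' := pencilCenter a y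
  set p := pencilCenter a (x * y)
  have hsum : (s : ℂ) + s' ≠ 0 := by
    rw [← Complex.ofReal_add, Complex.ofReal_ne_zero]; linarith
  have hs' : (p : ℂ) * (s + s') = s * s' + a ^ 2 := by exact_mod_cast hs
  have hden : pencilMap a s' z + s = (s + s') * (z + p) / (z + s') := by
    unfold pencilMap
    field_simp
    linear_combination -hs'
  have hden0 : pencilMap a s' z + s ≠ 0 := by
    rw [hden]; exact div_ne_zero (mul_ne_zero hsum h2) h1
  rw [pencilMap, div_eq_iff hden0, hden]
  unfold pencilMap
  field_simp
  linear_combination -z * hs'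

theorem pencilMap_pencilCenter {a x y : ℝ} (ha : 0 < a) (hx : 0 < x) (hx1 : x < 1)
    (hy : 0 < y) (hy1 : y < 1) :
    pencilMap a (pencilCenter a x) (pencilCenter a y) = pencilCenter a (x * y) := by
  have hs := pencilCenter_mul (a := a) hx hx1 hy1
  have p1 := le_pencilCenter ha hx.le hx1
  have p2 := le_pencilCenter ha hy.le hy1
  have hsum : (pencilCenter a y : ℂ) + pencilCenter a x ≠ 0 := by
    rw [← Complex.ofReal_add, Complex.ofReal_ne_zero]; linarith
  rw [pencilMap, div_eq_iff hsum]
  have hs' : (pencilCenter a (x * y) : ℂ) * (pencilCenter a x + pencilCenter a y)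
    = pencilCenter a x * pencilCenter a y + a ^ 2 := by exact_mod_cast hs
  linear_combination -hs'

/-- Two circles of radii `r₁`, `r₂` around `-c₁` and `c₂` in the pencil with limit points `±a`. -/
structure PencilData (a r₁ r₂ c₁ c₂ : ℝ) : Prop where
  a_pos : 0 < a
  r₁_pos : 0 < r₁
  r₂_pos : 0 < r₂
  c₁_pos : 0 < c₁
  c₂_pos : 0 < c₂
  eq₁ : c₁ ^ 2 = a ^ 2 + r₁ ^ 2
  eq₂ : c₂ ^ 2 = a ^ 2 + r₂ ^ 2

namespace PencilData
variable {a r₁ r₂ c₁ c₂ : ℝ}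

theorem symm (h : PencilData a r₁ r₂ c₁ c₂) : PencilData a r₂ r₁ c₂ c₁ :=
  ⟨h.a_pos, h.r₂_pos, h.r₁_pos, h.c₂_pos, h.c₁_pos, h.eq₂, h.eq₁⟩

theorem a_lt (h : PencilData a r₁ r₂ c₁ c₂) : a < c₁ := by
  nlinarith [h.a_pos, h.r₁_pos, h.c₁_pos, h.eq₁, mul_pos h.r₁_pos h.r₁_pos]

theorem r_lt (h : PencilData a r₁ r₂ c₁ c₂) : r₁ < c₁ := by
  nlinarith [h.a_pos, h.r₁_pos, h.c₁_pos, h.eq₁, mul_pos h.a_pos h.a_pos]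

theorem c_lt (h : PencilData a r₁ r₂ c₁ c₂) : c₁ < a + r₁ := by
  nlinarith [h.a_pos, h.r₁_pos, h.c₁_pos, h.eq₁, mul_pos h.a_pos h.r₁_pos]

theorem mod_pos (h : PencilData a r₁ r₂ c₁ c₂) : 0 < pencilMod a c₁ :=
  pencilMod_pos h.a_pos h.a_lt

theorem mod_lt_one (h : PencilData a r₁ r₂ c₁ c₂) : pencilMod a c₁ < 1 :=
  pencilMod_lt_one h.a_pos h.a_lt

end PencilData

/-- An open neighbourhood of the exterior of the disk of radius `r` around `-c`, away from the
segment `[-c, -a]`. -/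
def extNhd (a r c : ℝ) : Set ℂ := {z | (c - a + r) / 2 < ‖z + c‖}

theorem isOpen_extNhd (a r c : ℝ) : IsOpen (extNhd a r c) :=
  isOpen_lt continuous_const (by fun_prop)

theorem PencilData.mem_extNhd {a r₁ r₂ c₁ c₂ : ℝ} (h : PencilData a r₁ r₂ c₁ c₂) {z : ℂ}
    (hz : r₁ ≤ ‖z + c₁‖) : z ∈ extNhd a r₁ c₁ := by
  have := h.c_lt
  simp only [extNhd, mem_ofPred_eq]
  linarith

/-- The threshold in `extNhd` is the midpoint of `c - a` and `r`, so half of the gap `r - (c - a)`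
remains between `z` and every possible pole `-s`. -/
theorem norm_add_ge_of_mem_extNhd {a r c s : ℝ} {z : ℂ} (hz : z ∈ extNhd a r c) (hs : a ≤ s)
    (hsc : s ≤ c) : (r + a - c) / 2 ≤ ‖z + s‖ := by
  simp only [extNhd, mem_ofPred_eq] at hz
  have h1 : ‖z + c‖ ≤ ‖z + s‖ + (c - s) := by
    have h2 : z + c = (z + s) + ((c - s : ℝ) : ℂ) := by push_cast; ring
    rw [h2]
    refine (norm_add_le _ _).trans ?_
    rw [Complex.norm_real, Real.norm_of_nonneg (by linarith)]
  linarith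

theorem hasDerivAt_conjFun {F : ℂ → ℂ} (hF : Differentiable ℂ F) (z : ℂ) :
    HasDerivAt (conjFun F) (conjFun (deriv F) z) z := by
  have h := (hF (conj z)).hasDerivAt.conj_conj
  rw [Complex.conj_conj] at h
  exact h

theorem differentiable_conjFun {F : ℂ → ℂ} (hF : Differentiable ℂ F) :
    Differentiable ℂ (conjFun F) := fun z => (hasDerivAt_conjFun hF z).differentiableAt

/-- The product of the multipliers of the two reflections. -/
noncomputable def pencilRatio (a c₁ c₂ : ℝ) : ℝ := pencilMod a c₁ * pencilMod a c₂

/-- Position of the image source after an even number of reflections. -/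
noncomputable def evenCenter (a c₁ c₂ : ℝ) (n : ℕ) : ℝ :=
  pencilCenter a (pencilRatio a c₁ c₂ ^ (n + 1))

/-- Position of the image source after an odd number of reflections. -/
noncomputable def oddCenter (a c₁ c₂ : ℝ) (n : ℕ) : ℝ :=
  pencilCenter a (pencilRatio a c₁ c₂ ^ n * pencilMod a c₁)

/-- Even reflections give `F` after a Möbius map, odd ones the Schwarz reflection of `F`. The
subtracted constants are the values at `z = ∞`, where `pencilMap a s` tends to `s`; so every term
vanishes at infinity. -/
noncomputable def imageTerm (a c₁ c₂ t₁ t₂ : ℝ) (F : ℂ → ℂ) (n : ℕ) (z : ℂ) : ℂ :=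
  (t₁ * t₂) ^ n * (t₁ * t₂ * (F (pencilMap a (evenCenter a c₁ c₂ n) z) - F (evenCenter a c₁ c₂ n))
    - t₁ * (conjFun F (-pencilMap a (oddCenter a c₁ c₂ n) z) - conjFun F (-oddCenter a c₁ c₂ n)))

/-- The part of the complex potential with sources in the disk around `-c₁`. -/
noncomputable def imageField (a c₁ c₂ t₁ t₂ : ℝ) (F : ℂ → ℂ) (z : ℂ) : ℂ :=
  ∑' n, imageTerm a c₁ c₂ t₁ t₂ F n z

namespace PencilData
variable {a r₁ r₂ c₁ c₂ : ℝ}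

theorem ratio_pos (h : PencilData a r₁ r₂ c₁ c₂) : 0 < pencilRatio a c₁ c₂ :=
  mul_pos h.mod_pos h.symm.mod_pos

theorem ratio_lt_one (h : PencilData a r₁ r₂ c₁ c₂) : pencilRatio a c₁ c₂ < 1 :=
  mul_lt_one_of_nonneg_of_lt_one_left h.mod_pos.le h.mod_lt_one h.symm.mod_lt_one.le

theorem even_arg (h : PencilData a r₁ r₂ c₁ c₂) (n : ℕ) :
    0 < pencilRatio a c₁ c₂ ^ (n + 1) ∧ pencilRatio a c₁ c₂ ^ (n + 1) ≤ pencilMod a c₁ := by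
  refine ⟨pow_pos h.ratio_pos _, ?_⟩
  rw [pow_succ]
  refine (mul_le_of_le_one_left h.ratio_pos.le (pow_le_one₀ h.ratio_pos.le h.ratio_lt_one.le)).trans
    ?_
  exact mul_le_of_le_one_right h.mod_pos.le h.symm.mod_lt_one.le

theorem odd_arg (h : PencilData a r₁ r₂ c₁ c₂) (n : ℕ) :
    0 < pencilRatio a c₁ c₂ ^ n * pencilMod a c₁ ∧
      pencilRatio a c₁ c₂ ^ n * pencilMod a c₁ ≤ pencilMod a c₁ :=
  ⟨mul_pos (pow_pos h.ratio_pos _) h.mod_pos,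
    mul_le_of_le_one_left h.mod_pos.le (pow_le_one₀ h.ratio_pos.le h.ratio_lt_one.le)⟩

theorem center_mem (h : PencilData a r₁ r₂ c₁ c₂) {x : ℝ} (hx : 0 < x ∧ x ≤ pencilMod a c₁) :
    a ≤ pencilCenter a x ∧ pencilCenter a x ≤ c₁ := by
  refine ⟨le_pencilCenter h.a_pos hx.1.le (hx.2.trans_lt h.mod_lt_one), ?_⟩
  conv_rhs => rw [← pencilCenter_pencilMod h.a_pos h.a_lt]
  exact pencilCenter_mono h.a_pos hx.2 h.mod_lt_one

theorem even_mem (h : PencilData a r₁ r₂ c₁ c₂) (n : ℕ) :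
    a ≤ evenCenter a c₁ c₂ n ∧ evenCenter a c₁ c₂ n ≤ c₁ := h.center_mem (h.even_arg n)

theorem odd_mem (h : PencilData a r₁ r₂ c₁ c₂) (n : ℕ) :
    a ≤ oddCenter a c₁ c₂ n ∧ oddCenter a c₁ c₂ n ≤ c₁ := h.center_mem (h.odd_arg n)

theorem add_ne_zero (h : PencilData a r₁ r₂ c₁ c₂) {z : ℂ} (hz : z ∈ extNhd a r₁ c₁) {s : ℝ}
    (hs : a ≤ s ∧ s ≤ c₁) : z + s ≠ 0 := by
  have h1 := norm_add_ge_of_mem_extNhd hz hs.1 hs.2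
  have h2 := h.c_lt
  exact norm_pos_iff.1 (by linarith)

/-- All the reflected points stay in a fixed ball. -/
theorem norm_pencilMap_le_of_mem (h : PencilData a r₁ r₂ c₁ c₂) {z : ℂ}
    (hz : z ∈ extNhd a r₁ c₁) {s : ℝ} (hs : a ≤ s ∧ s ≤ c₁) :
    ‖pencilMap a s z‖ ≤ c₁ + r₁ ^ 2 / ((r₁ + a - c₁) / 2) := by
  have h2 := h.c_lt
  have ha := h.a_pos
  have hη : 0 < (r₁ + a - c₁) / 2 := by linarith
  refine (norm_pencilMap_le h.a_pos hs.1 hη (norm_add_ge_of_mem_extNhd hz hs.1 hs.2)).trans ?_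
  have h3 : s ^ 2 ≤ c₁ ^ 2 := by nlinarith [hs.1, hs.2]
  have h4 := h.eq₁
  gcongr
  · exact hs.2
  · linarith

/-- The image points lie in one compact ball for all admissible `s` and `z`. This provides the
geometric majorant of the image series, hence uniform convergence and termwise differentiation. -/
theorem exists_norm_image_le (h : PencilData a r₁ r₂ c₁ c₂) {F : ℂ → ℂ} (hF : Continuous F) :
    ∃ A : ℝ, ∀ s : ℝ, a ≤ s ∧ s ≤ c₁ → ∀ z ∈ extNhd a r₁ c₁,
      ‖F (pencilMap a s z) - F s‖ ≤ A ∧ ‖F (-pencilMap a s z) - F (-s)‖ ≤ A := by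
  set B := c₁ + r₁ ^ 2 / ((r₁ + a - c₁) / 2) with hB
  have h2 := h.c_lt
  have hη : 0 < (r₁ + a - c₁) / 2 := by linarith
  have hcB : c₁ ≤ B := by
    rw [hB]
    have : 0 ≤ r₁ ^ 2 / ((r₁ + a - c₁) / 2) := by positivity
    linarith
  obtain ⟨A, hA⟩ := (isCompact_closedBall (0 : ℂ) B).exists_bound_of_continuousOn hF.continuousOn
  refine ⟨A + A, fun s hs z hz => ?_⟩
  have m1 : pencilMap a s z ∈ Metric.closedBall (0 : ℂ) B := by
    simpa using h.norm_pencilMap_le_of_mem hz hs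
  have m2 : (s : ℂ) ∈ Metric.closedBall (0 : ℂ) B := by
    have := h.a_pos
    simp only [mem_closedBall_zero_iff, Complex.norm_real]
    rw [Real.norm_of_nonneg (by linarith)]
    linarith
  have m3 : ∀ w : ℂ, w ∈ Metric.closedBall (0 : ℂ) B → -w ∈ Metric.closedBall (0 : ℂ) B :=
    fun w hw => by simpa using hw
  exact ⟨(norm_sub_le _ _).trans (add_le_add (hA _ m1) (hA _ m2)),
    (norm_sub_le _ _).trans (add_le_add (hA _ (m3 _ m1)) (hA _ (m3 _ m2)))⟩

theorem exists_norm_imageTerm_le (h : PencilData a r₁ r₂ c₁ c₂) {t₁ t₂ : ℝ} {F : ℂ → ℂ}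
    (hF : Differentiable ℂ F) :
    ∃ A : ℝ, ∀ n : ℕ, ∀ z ∈ extNhd a r₁ c₁,
      ‖imageTerm a c₁ c₂ t₁ t₂ F n z‖ ≤ A * |t₁ * t₂| ^ n := by
  obtain ⟨A₁, hA₁⟩ := h.exists_norm_image_le hF.continuous
  obtain ⟨A₂, hA₂⟩ := h.exists_norm_image_le (differentiable_conjFun hF).continuous
  refine ⟨|t₁ * t₂| * A₁ + |t₁| * A₂, fun n z hz => ?_⟩
  rw [imageTerm, norm_mul, norm_pow, ← Complex.ofReal_mul, Complex.norm_real, Real.norm_eq_abs,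
    mul_comm]
  gcongr
  refine (norm_sub_le _ _).trans ?_
  rw [norm_mul, norm_mul, Complex.norm_real, Complex.norm_real, Real.norm_eq_abs, Real.norm_eq_abs]
  gcongr
  · exact (hA₁ _ (h.even_mem n) z hz).1
  · exact (hA₂ _ (h.odd_mem n) z hz).2

theorem summable_imageTerm (h : PencilData a r₁ r₂ c₁ c₂) {t₁ t₂ : ℝ} (ht : |t₁ * t₂| < 1)
    {F : ℂ → ℂ} (hF : Differentiable ℂ F) {z : ℂ} (hz : z ∈ extNhd a r₁ c₁) :
    Summable fun n => imageTerm a c₁ c₂ t₁ t₂ F n z := by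
  obtain ⟨A, hA⟩ := h.exists_norm_imageTerm_le (t₁ := t₁) (t₂ := t₂) hF
  exact Summable.of_norm_bounded ((summable_geometric_of_lt_one (abs_nonneg _) ht).mul_left A)
    fun n => hA n z hz

theorem hasDerivAt_imageTerm (h : PencilData a r₁ r₂ c₁ c₂) (t₁ t₂ : ℝ)
    {F : ℂ → ℂ} (hF : Differentiable ℂ F) {z : ℂ} (hz : z ∈ extNhd a r₁ c₁) (n : ℕ) :
    HasDerivAt (imageTerm a c₁ c₂ t₁ t₂ F n)
      ((t₁ * t₂) ^ n * (t₁ * t₂ * (deriv F (pencilMap a (evenCenter a c₁ c₂ n) z)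
          * ((evenCenter a c₁ c₂ n ^ 2 - a ^ 2) / (z + evenCenter a c₁ c₂ n) ^ 2))
        + t₁ * (conjFun (deriv F) (-pencilMap a (oddCenter a c₁ c₂ n) z)
          * ((oddCenter a c₁ c₂ n ^ 2 - a ^ 2) / (z + oddCenter a c₁ c₂ n) ^ 2)))) z := by
  have d1 := hasDerivAt_pencilMap (a := a) (h.add_ne_zero hz (h.even_mem n))
  have d2 := hasDerivAt_pencilMap (a := a) (h.add_ne_zero hz (h.odd_mem n))
  have e1 := ((hF (pencilMap a (evenCenter a c₁ c₂ n) z)).hasDerivAt.comp z d1).sub_const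
    (F (evenCenter a c₁ c₂ n))
  have e2 := ((hasDerivAt_conjFun hF (-pencilMap a (oddCenter a c₁ c₂ n) z)).comp z
    d2.neg).sub_const (conjFun F (-oddCenter a c₁ c₂ n))
  have e3 := ((e1.const_mul (t₁ * t₂ : ℂ)).sub (e2.const_mul (t₁ : ℂ))).const_mul
    ((t₁ * t₂ : ℂ) ^ n)
  convert! e3 using 1
  ring

theorem differentiableOn_imageField (h : PencilData a r₁ r₂ c₁ c₂) {t₁ t₂ : ℝ}
    (ht : |t₁ * t₂| < 1) {F : ℂ → ℂ} (hF : Differentiable ℂ F) :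
    DifferentiableOn ℂ (imageField a c₁ c₂ t₁ t₂ F) (extNhd a r₁ c₁) := by
  obtain ⟨A, hA⟩ := h.exists_norm_imageTerm_le (t₁ := t₁) (t₂ := t₂) hF
  exact Complex.differentiableOn_tsum_of_summable_norm
    ((summable_geometric_of_lt_one (abs_nonneg _) ht).mul_left A)
    (fun n z hz => (h.hasDerivAt_imageTerm t₁ t₂ hF hz n).differentiableAt.differentiableWithinAt)
    (isOpen_extNhd _ _ _) hA

theorem hasSum_deriv_imageField (h : PencilData a r₁ r₂ c₁ c₂) {t₁ t₂ : ℝ}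
    (ht : |t₁ * t₂| < 1) {F : ℂ → ℂ} (hF : Differentiable ℂ F) {z : ℂ} (hz : z ∈ extNhd a r₁ c₁) :
    HasSum (fun n : ℕ =>
      ((t₁ * t₂ : ℂ) ^ n * (t₁ * t₂ * (deriv F (pencilMap a (evenCenter a c₁ c₂ n) z)
          * ((evenCenter a c₁ c₂ n ^ 2 - a ^ 2) / (z + evenCenter a c₁ c₂ n) ^ 2))
        + t₁ * (conjFun (deriv F) (-pencilMap a (oddCenter a c₁ c₂ n) z)
          * ((oddCenter a c₁ c₂ n ^ 2 - a ^ 2) / (z + oddCenter a c₁ c₂ n) ^ 2)))))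
      (deriv (imageField a c₁ c₂ t₁ t₂ F) z) := by
  obtain ⟨A, hA⟩ := h.exists_norm_imageTerm_le (t₁ := t₁) (t₂ := t₂) hF
  have := Complex.hasSum_deriv_of_summable_norm
    ((summable_geometric_of_lt_one (abs_nonneg _) ht).mul_left A)
    (fun n z hz => (h.hasDerivAt_imageTerm t₁ t₂ hF hz n).differentiableAt.differentiableWithinAt)
    (isOpen_extNhd _ _ _) hA hz
  refine this.congr_fun fun n => ?_
  exact (h.hasDerivAt_imageTerm t₁ t₂ hF hz n).deriv.symm

/-- The inner potential of the disk around `-c₁`. -/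
theorem imageField_eq (h : PencilData a r₁ r₂ c₁ c₂) {t₁ t₂ : ℝ} (ht : |t₁ * t₂| < 1)
    {F : ℂ → ℂ} (hF : Differentiable ℂ F) {z : ℂ} (hz : r₁ ≤ ‖z + c₁‖) :
    imageField a c₁ c₂ t₁ t₂ F z = -t₁ *
      (conj (F (-conj (pencilMap a c₁ z))
          + imageField a c₂ c₁ t₂ t₁ (fun w => F (-w)) (conj (pencilMap a c₁ z)))
        - conj (F (-c₁) + imageField a c₂ c₁ t₂ t₁ (fun w => F (-w)) c₁)) := by
  have hzn : z ∈ extNhd a r₁ c₁ := h.mem_extNhd hz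
  have hF' : Differentiable ℂ fun w => F (-w) := hF.comp differentiable_neg
  have ht' : |t₂ * t₁| < 1 := by rwa [mul_comm]
  have hrat : pencilRatio a c₂ c₁ = pencilRatio a c₁ c₂ := mul_comm _ _
  set y := pencilMap a c₁ z with hy
  have hzc : z + (c₁ : ℂ) ≠ 0 := norm_pos_iff.1 (h.r₁_pos.trans_le hz)
  -- The reflection of `z` is `-conj y`; it lies in the left disk, hence outside the right one,
  -- where the series of the right disk converges.
  have hyr : r₂ ≤ ‖conj y + c₂‖ := by
    have e : conj y + c₂ = conj (y + c₂) := by simp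
    rw [e, RCLike.norm_conj, hy, pencilMap_eq hzc]
    have e2 : (c₁ : ℂ) - (c₁ ^ 2 - a ^ 2) / (z + c₁) + c₂
        = ((c₁ + c₂ : ℝ) : ℂ) - (c₁ ^ 2 - a ^ 2) / (z + c₁) := by push_cast; ring
    rw [e2]
    have e3 : ‖((c₁ : ℂ) ^ 2 - a ^ 2) / (z + c₁)‖ ≤ r₁ := by
      have : (c₁ : ℂ) ^ 2 - a ^ 2 = ((r₁ ^ 2 : ℝ) : ℂ) := by
        have := h.eq₁
        rw [← Complex.ofReal_pow, ← Complex.ofReal_pow, ← Complex.ofReal_sub, this]; simp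
      rw [this, norm_div, Complex.norm_real, Real.norm_of_nonneg (by positivity),
        div_le_iff₀ (h.r₁_pos.trans_le hz)]
      nlinarith [h.r₁_pos]
    have e4 := norm_sub_norm_le ((c₁ + c₂ : ℝ) : ℂ) (((c₁ : ℂ) ^ 2 - a ^ 2) / (z + c₁))
    rw [Complex.norm_real, Real.norm_of_nonneg (by linarith [h.c₁_pos, h.c₂_pos])] at e4
    linarith [h.r_lt, h.symm.r_lt]
  have hcr : r₂ ≤ ‖(c₁ : ℂ) + c₂‖ := by
    rw [← Complex.ofReal_add, Complex.norm_real,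
      Real.norm_of_nonneg (by linarith [h.c₁_pos, h.c₂_pos])]
    linarith [h.c₁_pos, h.symm.r_lt]
  have s1 := h.symm.summable_imageTerm ht' hF' (h.symm.mem_extNhd hyr)
  have s2 := h.symm.summable_imageTerm ht' hF' (h.symm.mem_extNhd hcr)
  -- composition of the Möbius maps
  have hm := pencilCenter_pencilMod h.a_pos h.a_lt
  have comp : ∀ x, 0 < x → x < 1 → pencilMap a (pencilCenter a x) y
      = pencilMap a (pencilCenter a (x * pencilMod a c₁)) z := by
    intro x hx0 hx1
    have := pencilMap_pencilMap (z := z) h.a_pos hx0 hx1 h.mod_pos h.mod_lt_one (by rwa [hm])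
      (h.add_ne_zero hzn (h.center_mem ⟨mul_pos hx0 h.mod_pos,
        mul_le_of_le_one_left h.mod_pos.le hx1.le⟩))
    rwa [hm] at this
  have compc : ∀ x, 0 < x → x < 1 → pencilMap a (pencilCenter a x) c₁
      = pencilCenter a (x * pencilMod a c₁) := by
    intro x hx0 hx1
    have := pencilMap_pencilCenter h.a_pos hx0 hx1 h.mod_pos h.mod_lt_one
    rwa [hm] at this
  set P : ℕ → ℂ := fun n => conjFun F (-pencilMap a (oddCenter a c₁ c₂ n) z)
    - conjFun F (-oddCenter a c₁ c₂ n) with hP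
  set E : ℕ → ℂ := fun n => F (pencilMap a (evenCenter a c₁ c₂ n) z)
    - F (evenCenter a c₁ c₂ n) with hE
  set T : ℂ := t₁ * t₂ with hT
  -- One more reflection multiplies the multiplier by `pencilMod a c₁`: even images of the other
  -- disk become odd images with index `n + 1`, odd ones become even images with the same index.
  have hterm : ∀ n, conj (imageTerm a c₂ c₁ t₂ t₁ (fun w => F (-w)) n (conj y)
      - imageTerm a c₂ c₁ t₂ t₁ (fun w => F (-w)) n c₁)
      = T ^ n * (T * P (n + 1) - t₂ * E n) := by
    intro n
    have k1 : pencilMap a (evenCenter a c₂ c₁ n) y = pencilMap a (oddCenter a c₁ c₂ (n + 1)) z := by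
      rw [evenCenter, comp _ (h.symm.even_arg n).1
        ((h.symm.even_arg n).2.trans_lt h.symm.mod_lt_one), oddCenter, hrat]
    have k2 : pencilMap a (oddCenter a c₂ c₁ n) y = pencilMap a (evenCenter a c₁ c₂ n) z := by
      rw [oddCenter, comp _ (h.symm.odd_arg n).1
        ((h.symm.odd_arg n).2.trans_lt h.symm.mod_lt_one), evenCenter, hrat, pow_succ,
        mul_assoc, mul_comm (pencilMod a c₂)]
      rfl
    have k3 : pencilMap a (evenCenter a c₂ c₁ n) c₁ = oddCenter a c₁ c₂ (n + 1) := by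
      rw [evenCenter, compc _ (h.symm.even_arg n).1
        ((h.symm.even_arg n).2.trans_lt h.symm.mod_lt_one), oddCenter, hrat]
    have k4 : pencilMap a (oddCenter a c₂ c₁ n) c₁ = evenCenter a c₁ c₂ n := by
      rw [oddCenter, compc _ (h.symm.odd_arg n).1
        ((h.symm.odd_arg n).2.trans_lt h.symm.mod_lt_one), evenCenter, hrat, pow_succ,
        mul_assoc, mul_comm (pencilMod a c₂)]
      rfl
    simp only [imageTerm, pencilMap_conj, conjFun, map_neg, neg_neg, Complex.conj_conj, k1, k2, k3,
      k4, Complex.conj_ofReal, map_sub, map_mul, map_pow, hP, hE, hT]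
    ring
  have hdiff : conj (imageField a c₂ c₁ t₂ t₁ (fun w => F (-w)) (conj y)
      - imageField a c₂ c₁ t₂ t₁ (fun w => F (-w)) c₁)
      = ∑' n, T ^ n * (T * P (n + 1) - t₂ * E n) := by
    unfold imageField
    rw [← s1.tsum_sub s2, Complex.conj_tsum]
    exact tsum_congr hterm
  -- The odd image of index `0`, lost in the shift, is the direct reflection of `F`: its position is
  -- the center `c₁`.
  have hP0 : conj (F (-conj y) - F (-c₁)) = P 0 := by
    have : oddCenter a c₁ c₂ 0 = c₁ := by simp [oddCenter, hm]
    simp [hP, this, conjFun, hy]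
  have hgeo : ∀ (A : ℝ) (X : ℕ → ℂ), (∀ n, ‖X n‖ ≤ A) → Summable fun n => T ^ n * X n := by
    intro A X hX
    refine Summable.of_norm_bounded
      ((summable_geometric_of_lt_one (abs_nonneg _) ht).mul_right A) fun n => ?_
    rw [hT, norm_mul, norm_pow, ← Complex.ofReal_mul, Complex.norm_real, Real.norm_eq_abs]
    gcongr
    exact hX n
  obtain ⟨A₁, hA₁⟩ := h.exists_norm_image_le hF.continuous
  obtain ⟨A₂, hA₂⟩ := h.exists_norm_image_le (differentiable_conjFun hF).continuous
  have hPb : Summable fun n => T ^ n * P n := hgeo A₂ P fun n => (hA₂ _ (h.odd_mem n) z hzn).2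
  have hEb : Summable fun n => T ^ n * E n := hgeo A₁ E fun n => (hA₁ _ (h.even_mem n) z hzn).1
  have lhs : imageField a c₁ c₂ t₁ t₂ F z = T * (∑' n, T ^ n * E n) - t₁ * ∑' n, T ^ n * P n := by
    rw [← tsum_mul_left, ← tsum_mul_left, ← (hEb.mul_left _).tsum_sub (hPb.mul_left _)]
    refine tsum_congr fun n => ?_
    simp only [imageTerm, hP, hE, hT]
    ring
  have rhs : ∑' n, T ^ n * (T * P (n + 1) - t₂ * E n)
      = ((∑' n, T ^ n * P n) - P 0) - t₂ * ∑' n, T ^ n * E n := by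
    rw [hPb.tsum_eq_zero_add]
    have : Summable fun n => T ^ (n + 1) * P (n + 1) := (summable_nat_add_iff 1).2 hPb
    rw [← tsum_mul_left, pow_zero, one_mul, add_sub_cancel_left,
      ← this.tsum_sub (hEb.mul_left _)]
    refine tsum_congr fun n => ?_
    ring
  have fin : conj (F (-conj y) + imageField a c₂ c₁ t₂ t₁ (fun w => F (-w)) (conj y))
      - conj (F (-c₁) + imageField a c₂ c₁ t₂ t₁ (fun w => F (-w)) c₁)
      = P 0 + ∑' n, T ^ n * (T * P (n + 1) - t₂ * E n) := by
    rw [← hP0, ← hdiff, ← map_sub, ← map_add]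
    congr 1; ring
  rw [fin, rhs, lhs, hT]
  ring

end PencilData

/-! ### From matched complex potentials to weak solutions. -/

open EuclideanGeometry in
/-- The retraction of the plane onto a closed disk by reflecting the exterior across the circle. -/
noncomputable def diskRetract (γ : ℂ) (r : ℝ) (z : ℂ) : ℂ :=
  if dist z γ ≤ r then z else inversion γ r z

theorem inversion_eq_conj (γ : ℂ) (r : ℝ) {z : ℂ} (hz : z ≠ γ) :
    EuclideanGeometry.inversion γ r z = γ + r ^ 2 / conj (z - γ) := by
  have h1 : z - γ ≠ 0 := sub_ne_zero.2 hz
  have h2 : conj (z - γ) ≠ 0 := (map_ne_zero _).2 h1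
  have h3 : (z - γ) * conj (z - γ) = ((dist z γ) ^ 2 : ℝ) := by
    rw [Complex.mul_conj, Complex.normSq_eq_norm_sq, dist_eq_norm]
  have h4 : ((dist z γ : ℝ) : ℂ) ≠ 0 := by
    simpa using hz
  rw [EuclideanGeometry.inversion, vsub_eq_sub, vadd_eq_add, add_comm, Complex.real_smul]
  congr 1
  push_cast at h3 ⊢
  rw [div_pow, div_mul_eq_mul_div, div_eq_div_iff (pow_ne_zero _ h4) h2]
  linear_combination (r : ℂ) ^ 2 * h3

theorem diskRetract_of_le {γ : ℂ} {r : ℝ} {z : ℂ} (h : dist z γ ≤ r) : diskRetract γ r z = z :=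
  if_pos h

theorem diskRetract_of_ge {γ : ℂ} {r : ℝ} {z : ℂ} (h : r ≤ dist z γ) :
    diskRetract γ r z = EuclideanGeometry.inversion γ r z := by
  rcases h.lt_or_eq with h | h
  · exact if_neg (not_le.2 h)
  · rw [diskRetract_of_le h.ge]
    exact (EuclideanGeometry.inversion_of_mem_sphere (Metric.mem_sphere.2 h.symm)).symm

theorem dist_inversion_le {γ : ℂ} {r : ℝ} (hr : 0 < r) {z : ℂ} (h : r ≤ dist z γ) :
    dist (EuclideanGeometry.inversion γ r z) γ ≤ r := by
  rw [EuclideanGeometry.dist_inversion_center, div_le_iff₀ (hr.trans_le h)]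
  nlinarith

theorem diskRetract_mem {γ : ℂ} {r : ℝ} (hr : 0 < r) (z : ℂ) :
    diskRetract γ r z ∈ Metric.closedBall γ r := by
  rw [Metric.mem_closedBall]
  rcases le_total (dist z γ) r with h | h
  · rwa [diskRetract_of_le h]
  · rw [diskRetract_of_ge h]; exact dist_inversion_le hr h

/-- Outside the disk the inversion contracts by `r² / (dist x γ * dist y γ) ≤ 1`. For one point
inside and one outside, the segment between them meets the circle, which is fixed, and the two parts
add up. -/
theorem lipschitzWith_diskRetract (γ : ℂ) {r : ℝ} (hr : 0 < r) :
    LipschitzWith 1 (diskRetract γ r) := by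
  have hout : ∀ x y, r ≤ dist x γ → r ≤ dist y γ →
      dist (diskRetract γ r x) (diskRetract γ r y) ≤ dist x y := by
    intro x y hx hy
    rw [diskRetract_of_ge hx, diskRetract_of_ge hy, EuclideanGeometry.dist_inversion_inversion
      (dist_pos.1 (hr.trans_le hx)) (dist_pos.1 (hr.trans_le hy))]
    refine mul_le_of_le_one_left dist_nonneg ?_
    rw [div_le_one (mul_pos (hr.trans_le hx) (hr.trans_le hy))]
    nlinarith
  have hmix : ∀ x y, dist x γ ≤ r → r ≤ dist y γ →
      dist (diskRetract γ r x) (diskRetract γ r y) ≤ dist x y := by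
    intro x y hx hy
    have hc : ContinuousOn (fun t : ℝ => dist (AffineMap.lineMap x y t) γ) (Icc 0 1) := by
      fun_prop
    obtain ⟨t, ht, hm⟩ := intermediate_value_Icc (zero_le_one' ℝ) hc
      (show r ∈ Icc _ _ by simpa using ⟨hx, hy⟩)
    set m := AffineMap.lineMap x y t
    have hm : dist m γ = r := hm
    calc dist (diskRetract γ r x) (diskRetract γ r y)
        ≤ dist (diskRetract γ r x) (diskRetract γ r m)
          + dist (diskRetract γ r m) (diskRetract γ r y) := dist_triangle _ _ _
      _ ≤ dist x m + dist m y := by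
          gcongr
          · rw [diskRetract_of_le hx, diskRetract_of_le hm.le]
          · exact hout _ _ hm.ge hy
      _ = dist x y := by
          rw [dist_left_lineMap, dist_lineMap_right, Real.norm_of_nonneg ht.1,
            Real.norm_of_nonneg (sub_nonneg.2 ht.2)]
          ring
  refine LipschitzWith.of_dist_le_mul fun x y => ?_
  rw [NNReal.coe_one, one_mul]
  rcases le_total (dist x γ) r with hx | hx <;> rcases le_total (dist y γ) r with hy | hy
  · rw [diskRetract_of_le hx, diskRetract_of_le hy]
  · exact hmix x y hx hy
  · rw [dist_comm, dist_comm x]; exact hmix y x hy hx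
  · exact hout x y hx hy

/-- By Rademacher's theorem the pointwise gradient exists almost everywhere, and a Lipschitz
function can be integrated by parts against a test function. The smooth summand is separate because
the entire background potential need not be globally Lipschitz. -/
theorem hasWeakGradient_add_lipschitz {f₀ f₁ : ℂ → ℝ} (h₀ : ContDiff ℝ 1 f₀) {C : NNReal}
    (h₁ : LipschitzWith C f₁) :
    HasWeakGradient (fun x => f₀ x + f₁ x) (planeGradient fun x => f₀ x + f₁ x) := by
  intro φ hφ hφc v
  have hfd : ∀ᵐ x, inner ℝ (planeGradient (fun x => f₀ x + f₁ x) x) v * φ x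
      = fderiv ℝ f₀ x v * φ x + lineDeriv ℝ f₁ x v * φ x := by
    filter_upwards [h₁.ae_differentiableAt (μ := volume)] with x hx
    rw [inner_planeGradient]
    have h3 : HasFDerivAt (fun x => f₀ x + f₁ x) _ x :=
      (h₀.differentiable (by simp) x).hasFDerivAt.add hx.hasFDerivAt
    rw [h3.fderiv, hx.lineDeriv_eq_fderiv]
    simp [add_mul]
  have c0 := h₀.continuous
  have c1 := h₁.continuous
  have cφ := hφ.continuous
  have cd : Continuous fun x => fderiv ℝ φ x v :=
    (hφ.continuous_fderiv (by simp)).clm_apply continuous_const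
  have cd0 : Continuous fun x => fderiv ℝ f₀ x v :=
    (h₀.continuous_fderiv (by simp)).clm_apply continuous_const
  have sd : HasCompactSupport fun x => fderiv ℝ φ x v := hφc.fderiv_apply ℝ v
  have i0 : Integrable fun x => f₀ x * fderiv ℝ φ x v :=
    Continuous.integrable_of_hasCompactSupport (by fun_prop) sd.mul_left
  have i1 : Integrable fun x => f₁ x * fderiv ℝ φ x v :=
    Continuous.integrable_of_hasCompactSupport (by fun_prop) sd.mul_left
  have i2 : Integrable fun x => fderiv ℝ f₀ x v * φ x :=
    Continuous.integrable_of_hasCompactSupport (by fun_prop) hφc.mul_left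
  have i3 : Integrable fun x => lineDeriv ℝ f₁ x v * φ x := by
    refine (cφ.integrable_of_hasCompactSupport hφc).bdd_mul (c := C * ‖v‖)
      (measurable_lineDeriv c1).aestronglyMeasurable
      (Eventually.of_forall fun x => ?_)
    exact norm_lineDeriv_le_of_lipschitz ℝ h₁
  have i4 : Integrable fun x => f₀ x * φ x :=
    Continuous.integrable_of_hasCompactSupport (by fun_prop) hφc.mul_left
  rw [integral_congr_ae hfd, integral_add i2 i3]
  simp only [add_mul]
  rw [integral_add i0 i1]
  have e0 := integral_mul_fderiv_eq_neg_fderiv_mul_of_integrable i2 i0 i4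
    (fun x _ => h₀.differentiable (by simp) x) (fun x _ => hφ.differentiable (by simp) x)
  obtain ⟨D, hD⟩ := ContDiff.lipschitzWith_of_hasCompactSupport hφc hφ (by simp)
  have e1 := h₁.integral_lineDeriv_mul_eq (μ := volume) hD hφc v
  have e2 : ∀ x, lineDeriv ℝ φ x (-v) * f₁ x = -(f₁ x * fderiv ℝ φ x v) := by
    intro x
    rw [(hφ.differentiable (by simp) x).lineDeriv_eq_fderiv]
    simp [mul_comm]
  simp only [e2, integral_neg] at e1
  rw [e0, e1]
  ring

theorem memLp_planeGradient {f₀ f₁ : ℂ → ℝ} (h₀ : ContDiff ℝ 1 f₀) {C : NNReal}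
    (h₁ : LipschitzWith C f₁) {K : Set ℂ} (hK : IsCompact K) :
    MemLp (planeGradient fun x => f₀ x + f₁ x) 2 (volume.restrict K) := by
  have : IsFiniteMeasure (volume.restrict K) := ⟨by simpa using hK.measure_lt_top⟩
  obtain ⟨B, hB⟩ := hK.exists_bound_of_continuousOn (h₀.continuous_fderiv (by simp)).continuousOn
  have hm : Measurable (planeGradient fun x => f₀ x + f₁ x) := by
    have e : (planeGradient fun x => f₀ x + f₁ x) = fun x =>
        ((fderiv ℝ (fun x => f₀ x + f₁ x) x 1 : ℝ) : ℂ)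
      + ((fderiv ℝ (fun x => f₀ x + f₁ x) x Complex.I : ℝ) : ℂ) * Complex.I := by
      ext x; apply Complex.ext <;> simp [planeGradient]
    rw [e]
    have m1 := measurable_fderiv_apply_const ℝ (fun x => f₀ x + f₁ x) (1 : ℂ)
    have m2 := measurable_fderiv_apply_const ℝ (fun x => f₀ x + f₁ x) Complex.I
    fun_prop
  refine MemLp.of_bound hm.aestronglyMeasurable (2 * (B + C)) ?_
  rw [ae_restrict_iff' hK.measurableSet]
  filter_upwards [h₁.ae_differentiableAt (μ := volume)] with x hx hxK
  have h3 : HasFDerivAt (fun x => f₀ x + f₁ x) _ x :=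
    (h₀.differentiable (by simp) x).hasFDerivAt.add hx.hasFDerivAt
  have h4 : ‖fderiv ℝ (fun x => f₀ x + f₁ x) x‖ ≤ B + C := by
    rw [h3.fderiv]
    exact (norm_add_le _ _).trans (add_le_add (hB x hxK) (norm_fderiv_le_of_lipschitz ℝ h₁))
  refine (Complex.norm_le_abs_re_add_abs_im _).trans ?_
  have h5 := (fderiv ℝ (fun x => f₀ x + f₁ x) x).le_opNorm 1
  have h6 := (fderiv ℝ (fun x => f₀ x + f₁ x) x).le_opNorm Complex.I
  simp only [norm_one, mul_one, Complex.norm_I, Real.norm_eq_abs] at h5 h6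
  simp only [planeGradient]
  linarith

theorem HasDerivAt.hasFDerivAt_re {f : ℂ → ℂ} {d x : ℂ} (h : HasDerivAt f d x) :
    HasFDerivAt (fun z => (f z).re)
      (Complex.reCLM.comp (d • (1 : ℂ →L[ℝ] ℂ))) x :=
  Complex.reCLM.hasFDerivAt.comp x h.complexToReal_fderiv

theorem HasDerivAt.hasFDerivAt_im {f : ℂ → ℂ} {d x : ℂ} (h : HasDerivAt f d x) :
    HasFDerivAt (fun z => (f z).im)
      (Complex.imCLM.comp (d • (1 : ℂ →L[ℝ] ℂ))) x :=
  Complex.imCLM.hasFDerivAt.comp x h.complexToReal_fderiv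

/-- The reflected potential `conj (h ∘ inversion)` is holomorphic. -/
theorem differentiableAt_conj_comp_inversion {h : ℂ → ℂ} {γ : ℂ} {r : ℝ} {z : ℂ} (hz : z ≠ γ)
    (hh : DifferentiableAt ℂ h (EuclideanGeometry.inversion γ r z)) :
    DifferentiableAt ℂ (fun w => conj (h (EuclideanGeometry.inversion γ r w))) z := by
  have h1 := hh.conj_conj
  have e : ∀ w, w ≠ γ → conj (EuclideanGeometry.inversion γ r w)
      = conj γ + r ^ 2 / (w - γ) := by
    intro w hw
    rw [inversion_eq_conj γ r hw]
    simp
  rw [e z hz] at h1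
  have h2 : DifferentiableAt ℂ (fun w => conj γ + r ^ 2 / (w - γ)) z :=
    (differentiableAt_const _).add
      ((differentiableAt_const _).div (differentiableAt_id.sub_const γ) (sub_ne_zero.2 hz))
  have h3 := DifferentiableAt.comp z h1 h2
  refine h3.congr_of_eventuallyEq ?_
  filter_upwards [isOpen_ne.mem_nhds hz] with w hw
  simp only [Function.comp_apply]
  rw [← e w hw, Complex.conj_conj]

theorem exists_lipschitzOnWith_closedBall {h : ℂ → ℂ} {U : Set ℂ} (hU : IsOpen U)
    (hh : DifferentiableOn ℂ h U) {γ : ℂ} {r : ℝ} (hsub : Metric.closedBall γ r ⊆ U) :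
    ∃ K : NNReal, LipschitzOnWith K h (Metric.closedBall γ r) := by
  have hd : ContinuousOn (deriv h) (Metric.closedBall γ r) :=
    (hh.deriv hU).continuousOn.mono hsub
  obtain ⟨B, hB⟩ := (isCompact_closedBall γ r).exists_bound_of_continuousOn hd
  refine ⟨B.toNNReal, (convex_closedBall γ r).lipschitzOnWith_of_nnnorm_deriv_le
    (fun x hx => hh.differentiableAt (hU.mem_nhds (hsub hx))) fun x hx => ?_⟩
  rw [← NNReal.coe_le_coe, coe_nnnorm]
  exact (hB x hx).trans (Real.le_coe_toNNReal B)

/-- The perturbation of the potential caused by a disk with inner potential `h`. -/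
noncomputable def diskPotential (t : ℝ) (h : ℂ → ℂ) (γ : ℂ) (r : ℝ) (z : ℂ) : ℂ :=
  -t * (conj (h (diskRetract γ r z)) - conj (h γ))

theorem exists_lipschitzWith_diskPotential (t : ℝ) {h : ℂ → ℂ} {U : Set ℂ} (hU : IsOpen U)
    (hh : DifferentiableOn ℂ h U) {γ : ℂ} {r : ℝ} (hr : 0 < r)
    (hsub : Metric.closedBall γ r ⊆ U) :
    ∃ K : NNReal, LipschitzWith K (diskPotential t h γ r) := by
  obtain ⟨K, hK⟩ := exists_lipschitzOnWith_closedBall hU hh hsub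
  refine ⟨‖t‖₊ * K, LipschitzWith.of_dist_le_mul fun x y => ?_⟩
  have h1 := hK.dist_le_mul _ (diskRetract_mem hr x) _ (diskRetract_mem hr y)
  have h2 := (lipschitzWith_diskRetract γ hr).dist_le_mul x y
  rw [NNReal.coe_one, one_mul] at h2
  rw [dist_eq_norm, diskPotential, diskPotential, ← mul_sub, sub_sub_sub_cancel_right, ← map_sub,
    norm_mul, norm_neg, Complex.norm_real, RCLike.norm_conj, ← dist_eq_norm, NNReal.coe_mul,
    coe_nnnorm, mul_assoc]
  gcongr
  exact h1.trans (by gcongr)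

/-- Inversion sends a far point `x` to within `O(1/‖x‖)` of the center, where `h` is Lipschitz and
its central value has been subtracted. -/
theorem diskPotential_isBigO (t : ℝ) {h : ℂ → ℂ} {U : Set ℂ} (hU : IsOpen U)
    (hh : DifferentiableOn ℂ h U) {γ : ℂ} {r : ℝ} (hr : 0 < r)
    (hsub : Metric.closedBall γ r ⊆ U) :
    diskPotential t h γ r =O[cocompact ℂ] fun x => ‖x‖⁻¹ := by
  obtain ⟨K, hK⟩ := exists_lipschitzOnWith_closedBall hU hh hsub
  refine IsBigO.of_bound (|t| * (K * (2 * r ^ 2))) ?_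
  have hev : ∀ᶠ x : ℂ in cocompact ℂ, 2 * ‖γ‖ + 2 * r < ‖x‖ :=
    tendsto_norm_cocompact_atTop.eventually_gt_atTop _
  filter_upwards [hev] with x hx
  have hx0 : 0 < ‖x‖ := by linarith [norm_nonneg γ]
  have h1 := hK.dist_le_mul _ (diskRetract_mem hr x) _ (Metric.mem_closedBall_self hr.le)
  have h2 : ‖x‖ / 2 ≤ dist x γ := by
    rw [dist_eq_norm]
    linarith [norm_sub_norm_le x γ]
  have h3 : dist (diskRetract γ r x) γ ≤ 2 * r ^ 2 * ‖x‖⁻¹ := by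
    rw [diskRetract_of_ge (by linarith [norm_nonneg γ]), EuclideanGeometry.dist_inversion_center]
    calc r ^ 2 / dist x γ ≤ r ^ 2 / (‖x‖ / 2) := by gcongr
      _ = _ := by field_simp
  rw [diskPotential, norm_mul, norm_neg, Complex.norm_real, ← map_sub, RCLike.norm_conj,
    ← dist_eq_norm, norm_inv, norm_norm, Real.norm_eq_abs, mul_assoc, mul_assoc]
  gcongr
  exact h1.trans (by gcongr)

/-- A rotated gradient is divergence free: the weak gradient is tested with the first derivatives of
`φ`, whose mixed second derivatives agree. -/
theorem integral_stream_eq_zero {q : ℂ → ℝ} {G : ℂ → ℂ}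
    (hw : HasWeakGradient q G) (hG : LocallyIntegrable G) {φ : ℂ → ℝ} (hφ : ContDiff ℝ ∞ φ)
    (hφc : HasCompactSupport φ) :
    ∫ x, ((G x).im * fderiv ℝ φ x 1 - (G x).re * fderiv ℝ φ x Complex.I) = 0 := by
  have hd : ∀ v, ContDiff ℝ ∞ fun x => fderiv ℝ φ x v := fun v =>
    (hφ.fderiv_right (m := ∞) (by simp)).clm_apply contDiff_const
  have hs : ∀ v, HasCompactSupport fun x => fderiv ℝ φ x v := fun v => hφc.fderiv_apply ℝ v
  have e1 := hw _ (hd 1) (hs 1) Complex.I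
  have e2 := hw _ (hd Complex.I) (hs Complex.I) 1
  have hin : ∀ v, LocallyIntegrable fun x => inner ℝ (G x) v := by
    intro v x
    obtain ⟨s, hs, hi⟩ := hG x
    exact ⟨s, hs, hi.inner_const (𝕜 := ℝ) v⟩
  have i1 : ∀ v e, Integrable fun x => inner ℝ (G x) v * fderiv ℝ φ x e := by
    intro v e
    simpa [smul_eq_mul] using
      (hin v).integrable_smul_right_of_hasCompactSupport (hd e).continuous (hs e)
  have hsymm : ∀ x, fderiv ℝ (fun x => fderiv ℝ φ x 1) x Complex.I
      = fderiv ℝ (fun x => fderiv ℝ φ x Complex.I) x 1 := by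
    intro x
    have hdd : DifferentiableAt ℝ (fderiv ℝ φ) x :=
      (hφ.fderiv_right (m := ∞) (by simp)).differentiable (by simp) x
    have hx : ∀ v w, fderiv ℝ (fun x => fderiv ℝ φ x v) x w = fderiv ℝ (fderiv ℝ φ) x w v := by
      intro v w
      rw [fderiv_clm_apply hdd (differentiableAt_const v)]
      simp
    rw [hx, hx]
    exact (hφ.contDiffAt.isSymmSndFDerivAt (by rw [minSmoothness_of_isRCLikeNormedField]; exact WithTop.coe_le_coe.2 le_top)).eq _ _
  have e3 : ∀ x, (G x).im = inner ℝ (G x) Complex.I := fun x => by simp [Complex.inner]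
  have e4 : ∀ x, (G x).re = inner ℝ (G x) 1 := fun x => by simp [Complex.inner]
  simp only [e3, e4]
  rw [integral_sub (i1 _ _) (i1 _ _)]
  simp only [hsymm] at e1
  linarith

/-- Subtracting `t` times the conjugate scales the real part of `h` by `1 - t` and the imaginary
part by `1 + t`, and `k (1 - t) = 1 + t`. This is how the flux condition enters. -/
theorem exists_conjugate_deriv_inside {k t : ℝ} (hk : 0 < k) (ht : t = contrast k) {v q : ℂ → ℝ}
    {h : ℂ → ℂ} {x C : ℂ} (hh : DifferentiableAt ℂ h x)
    (hv : v =ᶠ[𝓝 x] fun z => (h z + -t * (conj (h z) - C)).re)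
    (hq : q =ᶠ[𝓝 x] fun z => (h z + -t * (conj (h z) - C)).im) :
    ∃ d : ℂ, (∀ w, fderiv ℝ v x w = (d * w).re) ∧ ∀ w, fderiv ℝ q x w = k * (d * w).im := by
  have hd := hh.hasDerivAt
  have d1 : HasFDerivAt (fun z => (h z + -t * (conj (h z) - C)).re) _ x :=
    ((hd.hasFDerivAt_re.const_mul (1 - t)).add_const (t * C.re)).congr_of_eventuallyEq
      (Eventually.of_forall fun z => by simp; ring)
  have d2 : HasFDerivAt (fun z => (h z + -t * (conj (h z) - C)).im) _ x :=
    ((hd.hasFDerivAt_im.const_mul (1 + t)).add_const (t * C.im)).congr_of_eventuallyEq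
      (Eventually.of_forall fun z => by simp; ring)
  refine ⟨((1 - t : ℝ) : ℂ) * deriv h x, fun w => ?_, fun w => ?_⟩
  · rw [hv.fderiv_eq, d1.fderiv, mul_assoc, Complex.re_ofReal_mul]
    simp
  · have hkt : k * (1 - t) = 1 + t := by
      rw [ht, contrast]
      have : k + 1 ≠ 0 := by positivity
      field_simp
      ring
    rw [hq.fderiv_eq, d2.fderiv, mul_assoc, Complex.im_ofReal_mul, ← mul_assoc, hkt]
    simp

/-- Complex potentials of the outer field and of the two disks which match on the circles give a
solution of the transmission problem. -/
theorem isSolution_of_potentials {γ₁ γ₂ : ℂ} {r₁ r₂ k₁ k₂ : ℝ} (hr₁ : 0 < r₁) (hr₂ : 0 < r₂)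
    (hk₁ : 0 < k₁) (hk₂ : 0 < k₂)
    {σ : ℂ → ℝ} (hσ₁ : ∀ x ∈ Metric.ball γ₁ r₁, σ x = k₁)
    (hσ₂ : ∀ x ∈ Metric.ball γ₂ r₂, σ x = k₂)
    (hσ₀ : ∀ x, x ∉ Metric.closedBall γ₁ r₁ → x ∉ Metric.closedBall γ₂ r₂ → σ x = 1)
    {F h₁ h₂ : ℂ → ℂ} (hF : Differentiable ℂ F) {U₁ U₂ : Set ℂ} (hU₁ : IsOpen U₁)
    (hU₂ : IsOpen U₂) (hs₁ : Metric.closedBall γ₁ r₁ ⊆ U₁) (hs₂ : Metric.closedBall γ₂ r₂ ⊆ U₂)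
    (hh₁ : DifferentiableOn ℂ h₁ U₁) (hh₂ : DifferentiableOn ℂ h₂ U₂)
    (e₁ : ∀ z ∈ Metric.ball γ₁ r₁, h₁ z = F z + diskPotential (contrast k₂) h₂ γ₂ r₂ z)
    (e₂ : ∀ z ∈ Metric.ball γ₂ r₂, h₂ z = F z + diskPotential (contrast k₁) h₁ γ₁ r₁ z) :
    IsSolution σ (fun z => (F z).re) fun z => (F z).re +
      (diskPotential (contrast k₁) h₁ γ₁ r₁ z + diskPotential (contrast k₂) h₂ γ₂ r₂ z).re := by
  set t₁ := contrast k₁ with ht₁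
  set t₂ := contrast k₂ with ht₂
  set p : ℂ → ℂ := fun z => diskPotential t₁ h₁ γ₁ r₁ z + diskPotential t₂ h₂ γ₂ r₂ z with hp
  obtain ⟨K₁, hK₁⟩ := exists_lipschitzWith_diskPotential t₁ hU₁ hh₁ hr₁ hs₁
  obtain ⟨K₂, hK₂⟩ := exists_lipschitzWith_diskPotential t₂ hU₂ hh₂ hr₂ hs₂
  have hKp : LipschitzWith (K₁ + K₂) p := hK₁.add hK₂
  have hre : LipschitzWith (K₁ + K₂) fun z => (p z).re := by
    refine LipschitzWith.of_dist_le_mul fun x y => le_trans ?_ (hKp.dist_le_mul x y)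
    rw [Real.dist_eq, dist_eq_norm, ← Complex.sub_re]
    exact Complex.abs_re_le_norm _
  have him : LipschitzWith (K₁ + K₂) fun z => (p z).im := by
    refine LipschitzWith.of_dist_le_mul fun x y => le_trans ?_ (hKp.dist_le_mul x y)
    rw [Real.dist_eq, dist_eq_norm, ← Complex.sub_im]
    exact Complex.abs_im_le_norm _
  have cF : ContDiff ℝ 1 F := (hF.contDiff (n := 1)).restrict_scalars ℝ
  have cre : ContDiff ℝ 1 fun z => (F z).re := Complex.reCLM.contDiff.comp cF
  have cim : ContDiff ℝ 1 fun z => (F z).im := Complex.imCLM.contDiff.comp cF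
  set v : ℂ → ℝ := fun z => (F z).re + (p z).re with hv
  set q : ℂ → ℝ := fun z => (F z).im + (p z).im with hq
  -- Off the circles, `q` is a stream function of `v`: its gradient is `σ ∇v` turned by a right
  -- angle. As `q` is continuous across the circles, with an `L²_loc` weak gradient, the flux `σ ∇v`
  -- is weakly divergence free.
  have loc : ∀ x, x ∉ Metric.sphere γ₁ r₁ → x ∉ Metric.sphere γ₂ r₂ →
      ∃ d : ℂ, (∀ w, fderiv ℝ v x w = (d * w).re) ∧ ∀ w, fderiv ℝ q x w = σ x * (d * w).im := by
    intro x hx₁ hx₂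
    by_cases hb₁ : x ∈ Metric.ball γ₁ r₁
    · rw [hσ₁ x hb₁]
      have hev : ∀ᶠ z in 𝓝 x, F z + p z = h₁ z + -t₁ * (conj (h₁ z) - conj (h₁ γ₁)) := by
        filter_upwards [Metric.isOpen_ball.mem_nhds hb₁] with z hz
        have : diskPotential t₁ h₁ γ₁ r₁ z = -t₁ * (conj (h₁ z) - conj (h₁ γ₁)) := by
          rw [diskPotential, diskRetract_of_le (Metric.mem_ball.1 hz).le]
        rw [← this, e₁ z hz, hp]
        ring
      refine exists_conjugate_deriv_inside (C := conj (h₁ γ₁)) hk₁ ht₁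
        (hh₁.differentiableAt (hU₁.mem_nhds (hs₁ (Metric.ball_subset_closedBall hb₁)))) ?_ ?_
      · filter_upwards [hev] with z hz
        rw [← hz, hv, Complex.add_re]
      · filter_upwards [hev] with z hz
        rw [← hz, hq, Complex.add_im]
    by_cases hb₂ : x ∈ Metric.ball γ₂ r₂
    · rw [hσ₂ x hb₂]
      have hev : ∀ᶠ z in 𝓝 x, F z + p z = h₂ z + -t₂ * (conj (h₂ z) - conj (h₂ γ₂)) := by
        filter_upwards [Metric.isOpen_ball.mem_nhds hb₂] with z hz
        have : diskPotential t₂ h₂ γ₂ r₂ z = -t₂ * (conj (h₂ z) - conj (h₂ γ₂)) := by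
          rw [diskPotential, diskRetract_of_le (Metric.mem_ball.1 hz).le]
        rw [← this, e₂ z hz, hp]
        ring
      refine exists_conjugate_deriv_inside (C := conj (h₂ γ₂)) hk₂ ht₂
        (hh₂.differentiableAt (hU₂.mem_nhds (hs₂ (Metric.ball_subset_closedBall hb₂)))) ?_ ?_
      · filter_upwards [hev] with z hz
        rw [← hz, hv, Complex.add_re]
      · filter_upwards [hev] with z hz
        rw [← hz, hq, Complex.add_im]
    have hc₁ : x ∉ Metric.closedBall γ₁ r₁ := fun h => by
      rw [← Metric.ball_union_sphere] at h; exact h.elim hb₁ hx₁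
    have hc₂ : x ∉ Metric.closedBall γ₂ r₂ := fun h => by
      rw [← Metric.ball_union_sphere] at h; exact h.elim hb₂ hx₂
    rw [hσ₀ x hc₁ hc₂]
    have key : ∀ {γ : ℂ} {r t : ℝ} {h : ℂ → ℂ} {U : Set ℂ}, 0 < r → IsOpen U →
        Metric.closedBall γ r ⊆ U → DifferentiableOn ℂ h U → x ∉ Metric.closedBall γ r →
        DifferentiableAt ℂ (diskPotential t h γ r) x := by
      intro γ r t h U hr hU hs hh hc
      have hxr : r < dist x γ := not_le.1 (by simpa using hc)
      have hi : EuclideanGeometry.inversion γ r x ∈ U :=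
        hs (Metric.mem_closedBall.2 (dist_inversion_le hr hxr.le))
      have h1 := (((differentiableAt_conj_comp_inversion (dist_pos.1 (hr.trans hxr))
        (hh.differentiableAt (hU.mem_nhds hi))).sub_const (conj (h γ))).const_mul (-t : ℂ))
      refine h1.congr_of_eventuallyEq ?_
      filter_upwards [Metric.isClosed_closedBall.isOpen_compl.mem_nhds hc] with z hz
      rw [diskPotential, diskRetract_of_ge (not_le.1 (by simpa using hz)).le]
    obtain ⟨d, hd⟩ : ∃ d, HasDerivAt (fun z => F z + p z) d x :=
      ⟨_, (hF x).hasDerivAt.add ((key (t := t₁) hr₁ hU₁ hs₁ hh₁ hc₁).hasDerivAt.add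
        (key (t := t₂) hr₂ hU₂ hs₂ hh₂ hc₂).hasDerivAt)⟩
    have d1 : HasFDerivAt v _ x := hd.hasFDerivAt_re
    have d2 : HasFDerivAt q _ x := hd.hasFDerivAt_im
    refine ⟨d, fun w => ?_, fun w => ?_⟩
    · rw [d1.fderiv]; simp
    · rw [d2.fderiv]; simp
  refine ⟨cre.continuous.add hre.continuous, ⟨planeGradient v,
    fun K hK => memLp_planeGradient cre hre hK, hasWeakGradient_add_lipschitz cre hre, ?_⟩, ?_⟩
  · intro φ hφ hφc
    rw [← integral_stream_eq_zero
      (hasWeakGradient_add_lipschitz cim him)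
      (memLp_locallyIntegrable fun K hK => memLp_planeGradient cim him hK) hφ hφc]
    have n₁ : ∀ᵐ x : ℂ, x ∉ Metric.sphere γ₁ r₁ :=
      measure_eq_zero_iff_ae_notMem.1 (Measure.addHaar_sphere volume γ₁ r₁)
    have n₂ : ∀ᵐ x : ℂ, x ∉ Metric.sphere γ₂ r₂ :=
      measure_eq_zero_iff_ae_notMem.1 (Measure.addHaar_sphere volume γ₂ r₂)
    refine integral_congr_ae ?_
    filter_upwards [n₁, n₂] with x h1 h2
    obtain ⟨d, hd1, hd2⟩ := loc x h1 h2
    rw [← inner_planeGradient φ x (planeGradient v x)]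
    simp only [Complex.inner, planeGradient]
    simp [hd1]
    change _ = fderiv ℝ q x Complex.I * _ - fderiv ℝ q x 1 * _
    rw [hd2, hd2]
    simp
    ring
  · have := (diskPotential_isBigO t₁ hU₁ hh₁ hr₁ hs₁).add (diskPotential_isBigO t₂ hU₂ hh₂ hr₂ hs₂)
    refine IsBigO.trans (IsBigO.of_bound 1 (Eventually.of_forall fun x => ?_)) this
    rw [hv]
    simp only [add_sub_cancel_left, one_mul]
    exact Complex.abs_re_le_norm _

theorem abs_contrast_lt_one {k : ℝ} (hk : 0 < k) : |contrast k| < 1 := by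
  unfold contrast
  rw [abs_lt, lt_div_iff₀ (by linarith), div_lt_one (by linarith)]
  constructor <;> linarith

theorem abs_contrast_mul_lt_one {k₁ k₂ : ℝ} (h₁ : 0 < k₁) (h₂ : 0 < k₂) :
    |contrast k₁ * contrast k₂| < 1 := by
  rw [abs_mul]
  exact mul_lt_one_of_nonneg_of_lt_one_left (abs_nonneg _) (abs_contrast_lt_one h₁)
    (abs_contrast_lt_one h₂).le

namespace PencilData
variable {a r₁ r₂ c₁ c₂ : ℝ}

theorem inversion_eq (h : PencilData a r₁ r₂ c₁ c₂) {z : ℂ} (hz : r₁ ≤ ‖z + c₁‖) :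
    EuclideanGeometry.inversion (-(c₁ : ℂ)) r₁ z = -conj (pencilMap a c₁ z) := by
  have hne : z + c₁ ≠ 0 := norm_pos_iff.1 (h.r₁_pos.trans_le hz)
  rw [inversion_eq_conj _ _ (fun e => hne (by rw [e]; ring)), pencilMap_eq hne]
  have : (c₁ : ℂ) ^ 2 - a ^ 2 = r₁ ^ 2 := by
    have := h.eq₁
    rw [← Complex.ofReal_pow, ← Complex.ofReal_pow, ← Complex.ofReal_sub, this]; simp
  rw [this]
  simp
  ring

/-- The disk potential of the disk around `-c₁` in its exterior. -/
theorem diskPotential_eq_imageField (h : PencilData a r₁ r₂ c₁ c₂) {t₁ t₂ : ℝ}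
    (ht : |t₁ * t₂| < 1) {F : ℂ → ℂ} (hF : Differentiable ℂ F) {z : ℂ} (hz : r₁ ≤ ‖z + c₁‖) :
    diskPotential t₁ (fun z => F z + imageField a c₂ c₁ t₂ t₁ (fun w => F (-w)) (-z)) (-c₁) r₁ z
      = imageField a c₁ c₂ t₁ t₂ F z := by
  rw [diskPotential, diskRetract_of_ge (by rwa [dist_eq_norm, sub_neg_eq_add]), h.inversion_eq hz,
    h.imageField_eq ht hF hz]
  simp

theorem diskPotential_eq_imageField_neg (h : PencilData a r₁ r₂ c₁ c₂) {t₁ t₂ : ℝ}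
    (ht : |t₁ * t₂| < 1) {F : ℂ → ℂ} (hF : Differentiable ℂ F) {z : ℂ} (hz : r₂ ≤ ‖z - c₂‖) :
    diskPotential t₂ (fun z => F z + imageField a c₁ c₂ t₁ t₂ F z) c₂ r₂ z
      = imageField a c₂ c₁ t₂ t₁ (fun w => F (-w)) (-z) := by
  have hz' : r₂ ≤ ‖-z + c₂‖ := by rwa [← norm_neg, neg_add, neg_neg, ← sub_eq_add_neg]
  have hinv : EuclideanGeometry.inversion (c₂ : ℂ) r₂ z = conj (pencilMap a c₂ (-z)) := by
    have h1 := h.symm.inversion_eq hz'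
    have h2 : (-z : ℂ) ≠ -c₂ := fun e => by
      rw [e] at hz'; simp at hz'; linarith [h.r₂_pos]
    rw [inversion_eq_conj _ _ h2] at h1
    rw [inversion_eq_conj _ _ (fun e => h2 (by rw [e])), ← neg_inj, ← h1]
    rw [show (-z : ℂ) - -c₂ = -(z - c₂) by ring, map_neg, div_neg]
    ring
  rw [diskPotential, diskRetract_of_ge (by rwa [dist_eq_norm]), hinv,
    h.symm.imageField_eq (F := fun w => F (-w)) (by rwa [mul_comm])
      (hF.comp differentiable_neg) hz']
  simp

theorem closedBall_subset (h : PencilData a r₁ r₂ c₁ c₂) :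
    ∀ z ∈ Metric.closedBall (-(c₁ : ℂ)) r₁, r₂ < ‖z - c₂‖ := by
  intro z hz
  rw [Metric.mem_closedBall, dist_eq_norm, sub_neg_eq_add] at hz
  have h1 : ‖((c₁ + c₂ : ℝ) : ℂ)‖ ≤ ‖z + c₁‖ + ‖z - c₂‖ := by
    have : ((c₁ + c₂ : ℝ) : ℂ) = (z + c₁) - (z - c₂) := by push_cast; ring
    rw [this]; exact norm_sub_le _ _
  rw [Complex.norm_real, Real.norm_of_nonneg (by linarith [h.c₁_pos, h.c₂_pos])] at h1
  linarith [h.r_lt, h.symm.r_lt]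

theorem closedBall_subset' (h : PencilData a r₁ r₂ c₁ c₂) :
    ∀ z ∈ Metric.closedBall (c₂ : ℂ) r₂, r₁ < ‖z + c₁‖ := by
  intro z hz
  by_contra! hn
  have := h.closedBall_subset z (by rwa [Metric.mem_closedBall, dist_eq_norm, sub_neg_eq_add])
  rw [Metric.mem_closedBall, dist_eq_norm] at hz
  linarith

end PencilData

/-- The data of the two disks of the problem. -/
theorem pencilData_disks {r₁ r₂ ε : ℝ} (h₁ : 0 < r₁) (h₂ : 0 < r₂) (hε : 0 < ε) :
    PencilData (alpha r₁ r₂ ε) r₁ r₂ (-center₁ r₁ r₂ ε) (center₂ r₁ r₂ ε) := by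
  obtain ⟨e₁, e₂⟩ := alpha_sq h₁ h₂ hε
  refine ⟨?_, h₁, h₂, ?_, ?_, by rw [e₁]; ring, by rw [e₂]; ring⟩
  · unfold alpha; positivity
  · unfold center₁
    rw [neg_neg]
    refine div_pos ?_ (by positivity)
    nlinarith [mul_pos h₁ h₂, mul_pos h₁ hε, mul_pos h₂ hε, mul_pos h₁ h₁]
  · unfold center₂
    refine div_pos ?_ (by positivity)
    nlinarith [mul_pos h₁ h₂, mul_pos h₁ hε, mul_pos h₂ hε, mul_pos h₂ h₂]

theorem measurable_conductivity (r₁ r₂ ε k₁ k₂ : ℝ) :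
    Measurable (conductivity r₁ r₂ ε k₁ k₂) := by
  unfold conductivity
  exact Measurable.ite Metric.isOpen_ball.measurableSet measurable_const
    (Measurable.ite Metric.isOpen_ball.measurableSet measurable_const measurable_const)

section Solution

variable {r₁ r₂ ε k₁ k₂ : ℝ} {H u : ℂ → ℝ} {F : ℂ → ℂ}

/-- Every solution is given by the image series. -/
theorem IsSolution.eq_diskPotential (h₁ : 0 < r₁) (h₂ : 0 < r₂) (hε : 0 < ε) (hk₁ : 0 < k₁)
    (hk₂ : 0 < k₂) (hF : Differentiable ℂ F) (hFH : ∀ z, (F z).re = H z)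
    (hu : IsSolution (conductivity r₁ r₂ ε k₁ k₂) H u) (z : ℂ) :
    u z = H z + (diskPotential (contrast k₁) (fun z => F z + imageField (alpha r₁ r₂ ε)
        (center₂ r₁ r₂ ε) (-center₁ r₁ r₂ ε) (contrast k₂) (contrast k₁) (fun w => F (-w)) (-z))
        (center₁ r₁ r₂ ε) r₁ z +
      diskPotential (contrast k₂) (fun z => F z + imageField (alpha r₁ r₂ ε)
        (-center₁ r₁ r₂ ε) (center₂ r₁ r₂ ε) (contrast k₁) (contrast k₂) F z)
        (center₂ r₁ r₂ ε) r₂ z).re := by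
  have hp := pencilData_disks h₁ h₂ hε
  obtain ⟨c₁, hc₁⟩ : ∃ c₁, center₁ r₁ r₂ ε = -c₁ := ⟨-center₁ r₁ r₂ ε, by ring⟩
  rw [hc₁, neg_neg] at hp
  rw [hc₁, neg_neg]
  set a := alpha r₁ r₂ ε with ha
  set c₂ := center₂ r₁ r₂ ε with hc₂
  have ht := abs_contrast_mul_lt_one hk₁ hk₂
  have hF' : Differentiable ℂ fun w => F (-w) := hF.comp differentiable_neg
  set σ := conductivity r₁ r₂ ε k₁ k₂ with hσ
  have hd₁ : disk₁ r₁ r₂ ε = Metric.ball (-(c₁ : ℂ)) r₁ := by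
    rw [disk₁, hc₁, Complex.ofReal_neg]
  have hd₂ : disk₂ r₁ r₂ ε = Metric.ball (c₂ : ℂ) r₂ := rfl
  have hσ₁ : ∀ x ∈ Metric.ball (-(c₁ : ℂ)) r₁, σ x = k₁ := fun x hx => by
    rw [← hd₁] at hx; rw [hσ, conductivity, if_pos hx]
  have hσ₂ : ∀ x ∈ Metric.ball (c₂ : ℂ) r₂, σ x = k₂ := fun x hx => by
    have hx1 : x ∉ disk₁ r₁ r₂ ε := fun h => by
      rw [hd₁] at h
      have := hp.closedBall_subset x (Metric.ball_subset_closedBall h)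
      rw [Metric.mem_ball, dist_eq_norm] at hx
      linarith
    rw [← hd₂] at hx
    rw [hσ, conductivity, if_neg hx1, if_pos hx]
  have hσ₀ : ∀ x, x ∉ Metric.closedBall (-(c₁ : ℂ)) r₁ → x ∉ Metric.closedBall (c₂ : ℂ) r₂ →
      σ x = 1 := fun x hx1 hx2 => by
    rw [hσ, conductivity, if_neg, if_neg]
    · rw [hd₂]; exact fun h => hx2 (Metric.ball_subset_closedBall h)
    · rw [hd₁]; exact fun h => hx1 (Metric.ball_subset_closedBall h)
  -- The inner potential of each disk is `F` plus the series of the other disk only, so it is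
  -- holomorphic on a neighbourhood of the closed disk.
  have hmem₁ : ∀ z ∈ Metric.closedBall (-(c₁ : ℂ)) r₁, -z ∈ extNhd a r₂ c₂ := fun z hz =>
    hp.symm.mem_extNhd (by
      rw [← norm_neg, neg_add, neg_neg, ← sub_eq_add_neg]; exact (hp.closedBall_subset z hz).le)
  have hmem₂ : ∀ z ∈ Metric.closedBall (c₂ : ℂ) r₂, z ∈ extNhd a r₁ c₁ := fun z hz =>
    hp.mem_extNhd (hp.closedBall_subset' z hz).le
  have hsol := isSolution_of_potentials (σ := σ) (F := F) (γ₁ := -c₁) (γ₂ := c₂)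
    (h₁ := fun z => F z + imageField a c₂ c₁ (contrast k₂) (contrast k₁) (fun w => F (-w)) (-z))
    (h₂ := fun z => F z + imageField a c₁ c₂ (contrast k₁) (contrast k₂) F z)
    h₁ h₂ hk₁ hk₂ hσ₁ hσ₂ hσ₀ hF ((isOpen_extNhd a r₂ c₂).preimage continuous_neg)
    (isOpen_extNhd a r₁ c₁) hmem₁ hmem₂
    (hF.differentiableOn.add ((hp.symm.differentiableOn_imageField (by rwa [mul_comm]) hF').comp
      differentiable_neg.differentiableOn fun z hz => hz))
    (hF.differentiableOn.add (hp.differentiableOn_imageField ht hF))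
    (fun z hz => by
      rw [hp.diskPotential_eq_imageField_neg ht hF
        (hp.closedBall_subset z (Metric.ball_subset_closedBall hz)).le])
    (fun z hz => by
      rw [hp.diskPotential_eq_imageField ht hF
        (hp.closedBall_subset' z (Metric.ball_subset_closedBall hz)).le])
  have hH : (fun z => (F z).re) = H := funext hFH
  rw [hH] at hsol
  have hbd : ∀ x, min k₁ (min k₂ 1) ≤ σ x ∧ σ x ≤ max k₁ (max k₂ 1) := by
    intro x
    rw [hσ, conductivity]
    split_ifs <;> simp
  have := IsSolution.unique (m := min k₁ (min k₂ 1)) (by positivity)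
    (measurable_conductivity r₁ r₂ ε k₁ k₂) hbd hu hsol
  rw [this, ← hFH, Complex.ofReal_neg]

end Solution

/-! ### Size and variation of the image kernel, uniformly in the gap. -/

/-- Comparison constant between `‖z + s‖` and `s + ‖z‖` outside a disk of radius `r`. -/
noncomputable def gapConst (r A : ℝ) : ℝ := r / (3 * r + 2 * A)

theorem gapConst_pos {r A : ℝ} (hr : 0 < r) (hA : 0 ≤ A) : 0 < gapConst r A :=
  div_pos hr (by linarith)

/-- With `d = ‖z + s‖`, being outside the disk gives `d ≥ s - (c₁ - r₁)`, and `c₁ - r₁ = a²/(c₁ +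
r₁)` is small enough for `r₁ s ≤ (A + r₁) d`. Adding `‖z‖ ≤ d + s` produces the denominator `3 r₁ +
2 A`. The constant does not degenerate as `a` tends to `0`. -/
theorem PencilData.norm_add_ge {a r₁ r₂ c₁ c₂ A : ℝ} (h : PencilData a r₁ r₂ c₁ c₂) (hA : a ≤ A)
    {z : ℂ} (hz : r₁ ≤ ‖z + c₁‖) {s : ℝ} (hs : a ≤ s) (hsc : s ≤ c₁) :
    gapConst r₁ A * (s + ‖z‖) ≤ ‖z + s‖ := by
  have ha := h.a_pos
  have hr := h.r₁_pos
  have h1 : ‖z + c₁‖ ≤ ‖z + s‖ + (c₁ - s) := by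
    have h2 : z + c₁ = (z + s) + ((c₁ - s : ℝ) : ℂ) := by push_cast; ring
    rw [h2]
    refine (norm_add_le _ _).trans ?_
    rw [Complex.norm_real, Real.norm_of_nonneg (by linarith)]
  have h2 : ‖z‖ ≤ ‖z + s‖ + s := by
    have h3 : z = (z + s) - (s : ℂ) := by ring
    conv_lhs => rw [h3]
    refine (norm_sub_le _ _).trans ?_
    rw [Complex.norm_real, Real.norm_of_nonneg (by linarith)]
  set d := ‖z + s‖
  -- `r s ≤ (A + r) d`
  have h3 : r₁ * s ≤ (A + r₁) * d := by
    have h4 : r₁ - c₁ + s ≤ d := by linarith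
    have h5 : r₁ * s ≤ (A + r₁) * (r₁ - c₁ + s) := by
      have h6 : (A + r₁) * (c₁ - r₁) ≤ A * a := by
        have e := h.eq₁
        have h7 : (c₁ - r₁) * (c₁ + r₁) = a ^ 2 := by linear_combination e
        have h8 : a ≤ c₁ := h.a_lt.le
        have h9 : 0 < c₁ - r₁ := by linarith [h.r_lt]
        have h10 : (c₁ - r₁) * (a + r₁) ≤ a * a := by nlinarith
        have h11 : c₁ - r₁ ≤ a := by linarith [h.c_lt]
        nlinarith
      nlinarith
    exact h5.trans (by gcongr; linarith)
  unfold gapConst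
  rw [div_mul_eq_mul_div, div_le_iff₀ (by linarith)]
  nlinarith

/-- The summand of the derivative of the image series, as a function of the image position. -/
noncomputable def imageKernel (a : ℝ) (E : ℂ → ℂ) (z : ℂ) (s : ℝ) : ℂ :=
  E (pencilMap a s z) * ((s ^ 2 - a ^ 2) / (z + s) ^ 2)

/-- A monotone majorant of the variation of `imageKernel`. -/
noncomputable def kernelMajorant (a κ A B m s : ℝ) : ℝ :=
  B * κ⁻¹ ^ 4 * s + A * κ⁻¹ ^ 3 * (s ^ 2 / (s + m) ^ 2 - a ^ 2 / s ^ 2)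

theorem hasDerivAt_kernelMajorant {a κ A B m s : ℝ} (hs : 0 < s) (hm : 0 ≤ m) :
    HasDerivAt (kernelMajorant a κ A B m)
      (B * κ⁻¹ ^ 4 + A * κ⁻¹ ^ 3 * (2 * s * m / (s + m) ^ 3 + 2 * a ^ 2 / s ^ 3)) s := by
  have h0 : s + m ≠ 0 := by positivity
  have h1 := hs.ne'
  have d1 : HasDerivAt (fun s : ℝ => s ^ 2) (2 * s) s := by
    simpa using hasDerivAt_pow 2 s
  have d2 : HasDerivAt (fun s : ℝ => (s + m) ^ 2) (2 * (s + m)) s := by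
    have := ((hasDerivAt_id s).add_const m).pow 2
    convert! this using 1
    simp
  have d3 := (((hasDerivAt_id s).const_mul (B * κ⁻¹ ^ 4))).add
    (((d1.div d2 (pow_ne_zero _ h0)).sub
      ((hasDerivAt_const s (a ^ 2)).div d1 (pow_ne_zero _ h1))).const_mul (A * κ⁻¹ ^ 3))
  convert! d3 using 1
  field_simp
  ring

theorem hasDerivAt_imageKernel {a s : ℝ} {E : ℂ → ℂ} (hE : Differentiable ℂ E) {z : ℂ}
    (hz : z + s ≠ 0) :
    HasDerivAt (imageKernel a E z)
      (deriv E (pencilMap a s z) * ((z ^ 2 - a ^ 2) / (z + s) ^ 2)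
          * ((s ^ 2 - a ^ 2) / (z + s) ^ 2)
        + E (pencilMap a s z) * (2 * (s * z + a ^ 2) / (z + s) ^ 3)) s := by
  have d0 : HasDerivAt (fun s : ℝ => (s : ℂ)) 1 s := Complex.ofRealCLM.hasDerivAt
  have dz : HasDerivAt (fun s : ℝ => z + (s : ℂ)) 1 s := d0.const_add z
  have d1 : HasDerivAt (fun s : ℝ => pencilMap a s z) ((z ^ 2 - a ^ 2) / (z + s) ^ 2) s := by
    have h := ((d0.mul_const z).add_const ((a : ℂ) ^ 2)).div dz hz
    convert! h using 1
    field_simp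
    ring
  have d2 : HasDerivAt (fun s : ℝ => ((s : ℂ) ^ 2 - a ^ 2) / (z + s) ^ 2)
      (2 * (s * z + a ^ 2) / (z + s) ^ 3) s := by
    have h := ((d0.pow 2).sub_const ((a : ℂ) ^ 2)).div (dz.pow 2) (pow_ne_zero 2 hz)
    convert! h using 1
    simp
    field_simp
    ring
  have d3 : HasDerivAt (fun s : ℝ => E (pencilMap a s z))
      (deriv E (pencilMap a s z) * ((z ^ 2 - a ^ 2) / (z + s) ^ 2)) s :=
    (hE _).hasDerivAt.comp s d1
  exact d3.mul d2

section Bounds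

variable {a c κ A B : ℝ} {z : ℂ} {E : ℂ → ℂ}

theorem norm_sq_sub_sq_div_le (ha : 0 < a) (hκ : 0 < κ) {s : ℝ} (hs : a ≤ s)
    (hz : κ * (s + ‖z‖) ≤ ‖z + s‖) :
    ‖((s : ℂ) ^ 2 - (a : ℂ) ^ 2) / (z + s) ^ 2‖ ≤ κ⁻¹ ^ 2 := by
  have hD : 0 < s + ‖z‖ := by have := norm_nonneg z; linarith
  have h1 : ‖(s : ℂ) ^ 2 - (a : ℂ) ^ 2‖ ≤ (s + ‖z‖) ^ 2 := by
    rw [← Complex.ofReal_pow, ← Complex.ofReal_pow, ← Complex.ofReal_sub, Complex.norm_real,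
      Real.norm_of_nonneg (by nlinarith)]
    nlinarith [norm_nonneg z]
  rw [norm_div, norm_pow]
  calc _ ≤ (s + ‖z‖) ^ 2 / (κ * (s + ‖z‖)) ^ 2 := by gcongr
    _ = _ := by field_simp

theorem norm_mul_add_sq_le (ha : 0 < a) {s : ℝ} (hs : a ≤ s) (z : ℂ) :
    ‖(s : ℂ) * z + (a : ℂ) ^ 2‖ ≤ s * ‖z‖ + a ^ 2 := by
  refine (norm_add_le _ _).trans (le_of_eq ?_)
  rw [norm_mul, norm_pow, Complex.norm_real, Complex.norm_real,
    Real.norm_of_nonneg (ha.le.trans hs), Real.norm_of_nonneg ha.le]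

theorem norm_pencilMap_le_div (ha : 0 < a) (hκ : 0 < κ) {s : ℝ} (hs : a ≤ s)
    (hz : κ * (s + ‖z‖) ≤ ‖z + s‖) : ‖pencilMap a s z‖ ≤ s / κ := by
  have hD : 0 < s + ‖z‖ := by have := norm_nonneg z; linarith
  have hs0 : 0 < s := by linarith
  have h1 := norm_mul_add_sq_le ha hs z
  rw [pencilMap, norm_div]
  calc _ ≤ (s * (s + ‖z‖)) / (κ * (s + ‖z‖)) := by
        gcongr
        nlinarith
    _ = _ := by field_simp

theorem norm_imageKernel_le (ha : 0 < a) (hκ : 0 < κ)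
    (hE : ∀ w, ‖w‖ ≤ c / κ → ‖E w‖ ≤ A) {s : ℝ} (hs : a ≤ s) (hsc : s ≤ c)
    (hz : κ * (s + ‖z‖) ≤ ‖z + s‖) : ‖imageKernel a E z s‖ ≤ A * κ⁻¹ ^ 2 := by
  rw [imageKernel, norm_mul]
  have h1 := hE _ ((norm_pencilMap_le_div ha hκ hs hz).trans (by gcongr))
  have hA : 0 ≤ A := (norm_nonneg _).trans h1
  gcongr
  exact norm_sq_sub_sq_div_le ha hκ hs hz

/-- The `s`-derivative of the kernel is dominated by that of `kernelMajorant`, whose terms have the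
explicit primitives `s`, `s²/(s + m)²` and `-a²/s²`. -/
theorem norm_imageKernel_sub_le (ha : 0 < a) (hκ : 0 < κ) (hEd : Differentiable ℂ E)
    (hE : ∀ w, ‖w‖ ≤ c / κ → ‖E w‖ ≤ A) (hE' : ∀ w, ‖w‖ ≤ c / κ → ‖deriv E w‖ ≤ B)
    (hz : ∀ s : ℝ, a ≤ s → s ≤ c → κ * (s + ‖z‖) ≤ ‖z + s‖) {s' s : ℝ} (hs' : a ≤ s')
    (hss : s' ≤ s) (hsc : s ≤ c) :
    ‖imageKernel a E z s - imageKernel a E z s'‖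
      ≤ kernelMajorant a κ A B ‖z‖ s - kernelMajorant a κ A B ‖z‖ s' := by
  have hne : ∀ x : ℝ, a ≤ x → x ≤ c → z + x ≠ 0 := fun x h1 h2 => by
    refine norm_pos_iff.1 (lt_of_lt_of_le ?_ (hz x h1 h2))
    have := norm_nonneg z
    exact mul_pos hκ (by linarith)
  have hd : ∀ x ∈ Icc s' s, HasDerivAt (imageKernel a E z) _ x := fun x hx =>
    hasDerivAt_imageKernel (a := a) hEd (hne x (hs'.trans hx.1) (hx.2.trans hsc))
  have hh : ∀ x ∈ Icc s' s, HasDerivAt (kernelMajorant a κ A B ‖z‖) _ x := fun x hx =>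
    hasDerivAt_kernelMajorant (ha.trans_le (hs'.trans hx.1)) (norm_nonneg z)
  refine image_norm_le_of_norm_deriv_right_le_deriv_boundary'
    (f := fun x => imageKernel a E z x - imageKernel a E z s')
    (B := fun x => kernelMajorant a κ A B ‖z‖ x - kernelMajorant a κ A B ‖z‖ s')
    (fun x hx => ((hd x hx).sub_const _).continuousAt.continuousWithinAt)
    (fun x hx => ((hd x (Ico_subset_Icc_self hx)).sub_const _).hasDerivWithinAt)
    (by simp)
    (fun x hx => ((hh x hx).sub_const _).continuousAt.continuousWithinAt)
    (fun x hx => ((hh x (Ico_subset_Icc_self hx)).sub_const _).hasDerivWithinAt)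
    (fun x hx => ?_) (right_mem_Icc.2 hss)
  have hax : a ≤ x := hs'.trans hx.1
  have hxc : x ≤ c := hx.2.le.trans hsc
  have hx0 : 0 < x := ha.trans_le hax
  have hzx := hz x hax hxc
  have hP := (norm_pencilMap_le_div ha hκ hax hzx).trans
    (show x / κ ≤ c / κ by gcongr)
  have b1 := hE _ hP
  have b2 := hE' _ hP
  have hA : 0 ≤ A := (norm_nonneg _).trans b1
  have hB : 0 ≤ B := (norm_nonneg _).trans b2
  have hm := norm_nonneg z
  have hD : 0 < x + ‖z‖ := by linarith
  refine (norm_add_le _ _).trans (add_le_add ?_ ?_)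
  · rw [norm_mul, norm_mul]
    have b3 := norm_sq_sub_sq_div_le ha hκ hax hzx
    have b4 : ‖(z ^ 2 - (a : ℂ) ^ 2) / (z + x) ^ 2‖ ≤ κ⁻¹ ^ 2 := by
      have h1 : ‖z ^ 2 - (a : ℂ) ^ 2‖ ≤ (x + ‖z‖) ^ 2 := by
        refine (norm_sub_le _ _).trans ?_
        rw [norm_pow, norm_pow, Complex.norm_real, Real.norm_of_nonneg ha.le]
        nlinarith
      rw [norm_div, norm_pow]
      calc _ ≤ (x + ‖z‖) ^ 2 / (κ * (x + ‖z‖)) ^ 2 := by gcongr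
        _ = _ := by field_simp
    calc _ ≤ B * κ⁻¹ ^ 2 * κ⁻¹ ^ 2 := by gcongr
      _ = _ := by ring
  · rw [norm_mul, mul_assoc A]
    refine mul_le_mul b1 ?_ (norm_nonneg _) hA
    have b5 := norm_mul_add_sq_le ha hax z
    rw [norm_div, norm_mul, norm_pow, Complex.norm_ofNat]
    calc _ ≤ 2 * (x * ‖z‖ + a ^ 2) / (κ * (x + ‖z‖)) ^ 3 := by gcongr
      _ = κ⁻¹ ^ 3 * (2 * x * ‖z‖ / (x + ‖z‖) ^ 3 + 2 * a ^ 2 / (x + ‖z‖) ^ 3) := by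
          field_simp
      _ ≤ _ := by
          gcongr
          linarith

/-- Both quotients in the majorant lie in `[0, 1]`, so the total variation is bounded independently
of `a` and of `m = ‖z‖`. -/
theorem kernelMajorant_sub_le (ha : 0 < a) (hκ : 0 < κ) (hA : 0 ≤ A) (hB : 0 ≤ B)
    {m s s' : ℝ} (hm : 0 ≤ m) (hs' : a ≤ s') (hs : a ≤ s) (hsc : s ≤ c) :
    kernelMajorant a κ A B m s - kernelMajorant a κ A B m s'
      ≤ B * κ⁻¹ ^ 4 * c + 2 * A * κ⁻¹ ^ 3 := by
  unfold kernelMajorant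
  have hs0 : 0 < s := ha.trans_le hs
  have hs0' : 0 < s' := ha.trans_le hs'
  have h1 : s ^ 2 / (s + m) ^ 2 ≤ 1 := by
    rw [div_le_one (by positivity)]; nlinarith
  have h2 : a ^ 2 / s' ^ 2 ≤ 1 := by
    rw [div_le_one (by positivity)]; nlinarith
  have h3 : 0 ≤ a ^ 2 / s ^ 2 := by positivity
  have h4 : 0 ≤ s' ^ 2 / (s' + m) ^ 2 := by positivity
  have hk4 : 0 ≤ B * κ⁻¹ ^ 4 := by positivity
  have hk3 : 0 ≤ A * κ⁻¹ ^ 3 := by positivity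
  nlinarith [mul_nonneg hk4 hs0'.le, mul_le_mul_of_nonneg_left hsc hk4]

end Bounds

/-! ### Power series with bounded coefficients or coefficients of bounded variation. -/

theorem norm_tsum_le_of_sum_range_le {f : ℕ → ℂ} {C : ℝ}
    (h : ∀ N, ∑ n ∈ Finset.range N, ‖f n‖ ≤ C) : ‖∑' n, f n‖ ≤ C := by
  have hs : Summable fun n => ‖f n‖ := summable_of_sum_range_le (fun n => norm_nonneg _) h
  exact (norm_tsum_le_tsum_norm hs).trans (hs.tsum_le_of_sum_range_le h)

theorem norm_tsum_pow_mul_le_of_nonneg {T A : ℝ} (hT0 : 0 ≤ T) (hT1 : T < 1) {b : ℕ → ℂ}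
    (hb : ∀ n, ‖b n‖ ≤ A) : ‖∑' n, (T : ℂ) ^ n * b n‖ ≤ A / (1 - T) := by
  refine tsum_of_norm_bounded (g := fun n => A * T ^ n) ?_ fun n => ?_
  · exact (hasSum_geometric_of_lt_one hT0 hT1).mul_left A
  · rw [norm_mul, norm_pow, Complex.norm_real, Real.norm_of_nonneg hT0, mul_comm]
    gcongr
    exact hb n

theorem summable_pow_mul_of_bounded {T A : ℝ} (hT : |T| < 1) {b : ℕ → ℂ}
    (hb : ∀ n, ‖b n‖ ≤ A) : Summable fun n => (T : ℂ) ^ n * b n := by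
  refine Summable.of_norm_bounded
    ((summable_geometric_of_lt_one (abs_nonneg _) hT).mul_right A) fun n => ?_
  rw [norm_mul, norm_pow, Complex.norm_real, Real.norm_eq_abs]
  gcongr
  exact hb n

/-- Alternating power series with coefficients of bounded variation. -/
theorem norm_tsum_pow_mul_le_of_nonpos {T A K : ℝ} (hT0 : T ≤ 0) (hT1 : -1 < T) {b : ℕ → ℂ}
    {h : ℕ → ℝ} (hb : ∀ n, ‖b n‖ ≤ A) (hv : ∀ n, ‖b n - b (n + 1)‖ ≤ h n - h (n + 1))
    (hK : ∀ n, h 0 - h n ≤ K) : ‖∑' n, (T : ℂ) ^ n * b n‖ ≤ A + K := by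
  have habs : |T| < 1 := by rw [abs_lt]; constructor <;> linarith
  have hs := summable_pow_mul_of_bounded habs hb
  have hs1 := (summable_pow_mul_of_bounded habs fun n => hb (n + 1)).mul_left (T : ℂ)
  -- Summation by parts. Since `1 - T ≥ 1`, there is no loss as `T` approaches `-1`, where the
  -- geometric majorant blows up.
  have key : (1 - T : ℂ) * ∑' n, (T : ℂ) ^ n * b n
      = b 0 - ∑' n, (T : ℂ) ^ (n + 1) * (b n - b (n + 1)) := by
    have e1 : ∑' n, (T : ℂ) ^ n * b n = b 0 + ∑' n, (T : ℂ) * ((T : ℂ) ^ n * b (n + 1)) := by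
      rw [hs.tsum_eq_zero_add]
      simp only [pow_zero, one_mul, pow_succ]
      congr 1
      exact tsum_congr fun n => by ring
    have e2 : ∑' n, (T : ℂ) ^ (n + 1) * (b n - b (n + 1))
        = (∑' n, (T : ℂ) * ((T : ℂ) ^ n * b n)) - ∑' n, (T : ℂ) * ((T : ℂ) ^ n * b (n + 1)) := by
      rw [← (hs.mul_left (T : ℂ)).tsum_sub hs1]
      exact tsum_congr fun n => by ring
    rw [e2, tsum_mul_left, sub_mul, one_mul]
    nth_rewrite 1 [e1]
    ring
  have h1 : ‖∑' n, (T : ℂ) ^ (n + 1) * (b n - b (n + 1))‖ ≤ K := by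
    refine norm_tsum_le_of_sum_range_le fun N => ?_
    refine (Finset.sum_le_sum fun n _ => ?_).trans
      ((Finset.sum_range_sub' h N).le.trans (hK N))
    rw [norm_mul, norm_pow, Complex.norm_real, Real.norm_eq_abs]
    exact (mul_le_of_le_one_left (norm_nonneg _) (pow_le_one₀ (abs_nonneg _) habs.le)).trans (hv n)
  have h2 : ‖(1 - T : ℂ) * ∑' n, (T : ℂ) ^ n * b n‖ ≤ A + K := by
    rw [key]
    exact (norm_sub_le _ _).trans (add_le_add (hb 0) h1)
  rw [norm_mul] at h2
  have h3 : 1 ≤ ‖(1 - T : ℂ)‖ := by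
    rw [← Complex.ofReal_one, ← Complex.ofReal_sub, Complex.norm_real,
      Real.norm_of_nonneg (by linarith)]
    linarith
  exact (le_mul_of_one_le_left (norm_nonneg _) h3).trans h2

theorem one_sub_le_neg_log {T : ℝ} (hT : 0 < T) : 1 - T ≤ -Real.log T := by
  have := Real.log_le_sub_one_of_pos hT
  linarith

/-! ### Replacing the sum over image positions by an integral along the axis. -/

/-- The bipolar coordinate of a point on the axis, normalized to be `1` at `c`. -/
noncomputable def axisRatio (a c s : ℝ) : ℝ := (s - a) / (s + a) / pencilMod a c

section AxisRatio

variable {a c : ℝ}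

theorem axisRatio_nonneg (ha : 0 < a) (hac : a < c) {s : ℝ} (hs : a ≤ s) :
    0 ≤ axisRatio a c s :=
  div_nonneg (div_nonneg (by linarith) (by linarith)) (pencilMod_pos ha hac).le

theorem axisRatio_pos (ha : 0 < a) (hac : a < c) {s : ℝ} (hs : a < s) :
    0 < axisRatio a c s :=
  div_pos (div_pos (by linarith) (by linarith)) (pencilMod_pos ha hac)

theorem axisRatio_left (a c : ℝ) : axisRatio a c a = 0 := by simp [axisRatio]

theorem axisRatio_right (ha : 0 < a) (hac : a < c) : axisRatio a c c = 1 :=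
  div_self (pencilMod_pos ha hac).ne'

theorem axisRatio_le_one (ha : 0 < a) (hac : a < c) {s : ℝ} (hs : a ≤ s) (hsc : s ≤ c) :
    axisRatio a c s ≤ 1 := by
  rw [axisRatio, div_le_one (pencilMod_pos ha hac), pencilMod,
    div_le_div_iff₀ (by linarith) (by linarith)]
  nlinarith

theorem axisRatio_pencilCenter (ha : 0 < a) {x : ℝ} (hx : x < 1) :
    axisRatio a c (pencilCenter a x) = x / pencilMod a c := by
  have h1 : 1 - x ≠ 0 := by linarith
  have h2 : pencilCenter a x - a = 2 * a * x / (1 - x) := by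
    unfold pencilCenter; field_simp; ring
  have h3 : pencilCenter a x + a = 2 * a / (1 - x) := by
    unfold pencilCenter; field_simp; ring
  have h4 := ha.ne'
  rw [axisRatio, h2, h3]
  congr 1
  field_simp

theorem hasDerivAt_axisRatio_rpow (ha : 0 < a) (hac : a < c) {b s : ℝ} (hs : a < s) :
    HasDerivAt (fun s => axisRatio a c s ^ b)
      (b * (2 * a / (s ^ 2 - a ^ 2)) * axisRatio a c s ^ b) s := by
  have hp := axisRatio_pos ha hac hs
  have hs1 : s - a ≠ 0 := by linarith
  have hs2 : s + a ≠ 0 := by linarith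
  have hs3 : s ^ 2 - a ^ 2 ≠ 0 := by
    have := mul_ne_zero hs1 hs2
    intro h; apply this; linear_combination h
  have d1 : HasDerivAt (axisRatio a c) (axisRatio a c s * (2 * a / (s ^ 2 - a ^ 2))) s := by
    have h := ((((hasDerivAt_id s).sub_const a).div ((hasDerivAt_id s).add_const a) hs2)).div_const
      (pencilMod a c)
    convert! h using 1
    have hμ := (pencilMod_pos ha hac).ne'
    unfold axisRatio
    simp only [id]
    field_simp
    ring
  have h := d1.rpow_const (p := b) (Or.inl hp.ne')
  convert h using 1
  rw [Real.rpow_sub_one hp.ne']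
  field_simp

theorem continuousOn_axisRatio_rpow (ha : 0 < a) {b : ℝ} (hb : 0 ≤ b) :
    ContinuousOn (fun s => axisRatio a c s ^ b) (Icc a c) := by
  refine ContinuousOn.rpow_const ?_ fun x _ => Or.inr hb
  unfold axisRatio
  refine ContinuousOn.div_const (ContinuousOn.div (by fun_prop) (by fun_prop) fun x hx => ?_) _
  linarith [hx.1]

end AxisRatio

section SumIntegral

variable {a c lam T : ℝ}

theorem tendsto_pencilCenter (a : ℝ) (hl0 : 0 < lam) (hl1 : lam < 1) (μ : ℝ) :
    Tendsto (fun n : ℕ => pencilCenter a (lam ^ n * μ)) atTop (𝓝 a) := by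
  have h1 : Tendsto (fun n : ℕ => lam ^ n * μ) atTop (𝓝 0) := by
    simpa using (tendsto_pow_atTop_nhds_zero_of_lt_one hl0.le hl1).mul_const μ
  have h2 : Tendsto (fun x : ℝ => pencilCenter a x) (𝓝 0) (𝓝 (pencilCenter a 0)) := by
    refine ContinuousAt.tendsto ?_
    unfold pencilCenter
    exact ContinuousAt.div (by fun_prop) (by fun_prop) (by norm_num)
  have h3 : pencilCenter a 0 = a := by simp [pencilCenter]
  rw [h3] at h2
  exact h2.comp h1

/-- One step of the comparison of a series with an integral. -/
theorem norm_sub_setIntegral_le (ha : 0 < a) (hac : a < c) (hl1 : lam < 1) (hl0 : 0 < lam)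
    (hT0 : 0 < T) (hT1 : T < 1) {k : ℝ → ℂ} (hk : ContinuousOn k (Icc a c)) {A : ℝ} {h : ℝ → ℝ}
    (hfA : ∀ s, a ≤ s → s ≤ c → ‖((s ^ 2 - a ^ 2 : ℝ) : ℂ) * k s‖ ≤ A)
    (hfv : ∀ s' s, a ≤ s' → s' ≤ s → s ≤ c →
      ‖((s ^ 2 - a ^ 2 : ℝ) : ℂ) * k s - ((s' ^ 2 - a ^ 2 : ℝ) : ℂ) * k s'‖ ≤ h s - h s')
    {b L : ℝ} (hL : L = -Real.log lam) (hb : b = Real.log T / Real.log lam) (n : ℕ) {s₀ s₁ : ℝ}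
    (hs₀ : s₀ = pencilCenter a (lam ^ n * pencilMod a c))
    (hs₁ : s₁ = pencilCenter a (lam ^ (n + 1) * pencilMod a c)) :
    ‖(T : ℂ) ^ n * (((s₀ ^ 2 - a ^ 2 : ℝ) : ℂ) * k s₀)
      - ∫ s in s₁..s₀, ((2 * a / L * axisRatio a c s ^ b : ℝ) : ℂ) * k s‖
      ≤ (T ^ n - T ^ (n + 1)) * A + (h s₀ - h s₁) := by
  have hμ0 := pencilMod_pos ha hac
  have hμ1 := pencilMod_lt_one ha hac
  have hlog : Real.log lam < 0 := Real.log_neg hl0 hl1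
  have hLpos : 0 < L := by rw [hL]; linarith
  have hlT : Real.log T < 0 := Real.log_neg hT0 hT1
  have hbpos : 0 < b := by rw [hb]; exact div_pos_of_neg_of_neg hlT hlog
  have hbL : b * L = -Real.log T := by
    rw [hb, hL]
    have := hlog.ne
    field_simp
  have hx : ∀ m : ℕ, lam ^ m * pencilMod a c < 1 := fun m =>
    (mul_le_of_le_one_left hμ0.le (pow_le_one₀ hl0.le hl1.le)).trans_lt hμ1
  -- `axisRatio` takes the value `lam ^ m` at the image positions, and `b` is chosen so that `lam ^
  -- b = T`.
  have hy : ∀ m : ℕ, axisRatio a c (pencilCenter a (lam ^ m * pencilMod a c)) ^ b = T ^ m := by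
    intro m
    rw [axisRatio_pencilCenter ha (hx m), mul_div_assoc, div_self hμ0.ne', mul_one,
      ← Real.rpow_natCast, ← Real.rpow_mul hl0.le, mul_comm, Real.rpow_mul hl0.le]
    rw [← Real.rpow_natCast]
    congr 1
    rw [Real.rpow_def_of_pos hl0, hb, mul_div_cancel₀ _ hlog.ne, Real.exp_log hT0]
  have has₁ : a < s₁ := by
    rw [hs₁, pencilCenter, lt_div_iff₀ (by linarith [hx (n + 1)])]
    have : 0 < lam ^ (n + 1) * pencilMod a c := by positivity
    nlinarith
  have h10 : s₁ ≤ s₀ := by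
    rw [hs₁, hs₀]
    refine pencilCenter_mono ha ?_ (hx n)
    gcongr ?_ * _
    exact pow_le_pow_of_le_one hl0.le hl1.le (Nat.le_succ n)
  have h0c : s₀ ≤ c := by
    rw [hs₀]
    conv_rhs => rw [← pencilCenter_pencilMod ha hac]
    exact pencilCenter_mono ha (mul_le_of_le_one_left hμ0.le (pow_le_one₀ hl0.le hl1.le)) hμ1
  -- Moving the factor `s² - a²` from the weight to the integrand makes `w` the exact derivative of
  -- `axisRatio ^ b / (b L)` and `f` the function of bounded variation.
  set w : ℝ → ℝ := fun s => 2 * a / L / (s ^ 2 - a ^ 2) * axisRatio a c s ^ b with hw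
  set f : ℝ → ℂ := fun s => ((s ^ 2 - a ^ 2 : ℝ) : ℂ) * k s with hf
  have hpos : ∀ s, s₁ ≤ s → 0 < s ^ 2 - a ^ 2 := fun s hs => by nlinarith
  have hsub : uIcc s₁ s₀ ⊆ Icc a c := by
    rw [uIcc_of_le h10]; exact Icc_subset_Icc has₁.le h0c
  have hsub' : uIcc s₁ s₀ = Icc s₁ s₀ := uIcc_of_le h10
  have hwc : ContinuousOn w (uIcc s₁ s₀) := by
    refine ContinuousOn.mul (ContinuousOn.div (by fun_prop) (by fun_prop) fun s hs => ?_)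
      ((continuousOn_axisRatio_rpow ha hbpos.le).mono hsub)
    rw [hsub'] at hs
    exact (hpos s hs.1).ne'
  have hfc : ContinuousOn f (uIcc s₁ s₀) :=
    ContinuousOn.mul (by fun_prop) (hk.mono hsub)
  have hw0 : ∀ s, s₁ ≤ s → 0 ≤ w s := fun s hs =>
    mul_nonneg (div_nonneg (div_nonneg (by linarith) hLpos.le) (hpos s hs).le)
      (Real.rpow_nonneg (axisRatio_nonneg ha hac (has₁.le.trans hs)) _)
  -- the mass of the interval
  set m : ℝ := (T ^ n - T ^ (n + 1)) / (-Real.log T) with hm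
  have hmass : ∫ s in s₁..s₀, w s = m := by
    have hd : ∀ s ∈ uIcc s₁ s₀, HasDerivAt (fun s => axisRatio a c s ^ b / (b * L)) (w s) s := by
      intro s hs
      rw [hsub'] at hs
      have h1 := (hasDerivAt_axisRatio_rpow ha hac (b := b) (has₁.trans_le hs.1)).div_const (b * L)
      convert! h1 using 1
      have := (hpos s hs.1).ne'
      rw [hw]
      field_simp
    rw [intervalIntegral.integral_eq_sub_of_hasDerivAt hd hwc.intervalIntegrable, hs₀, hs₁, hy, hy,
      hbL, ← sub_div]
  have hTn : 0 < T ^ n := by positivity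
  have hlog1 := one_sub_le_neg_log hT0
  have hlogpos : 0 < -Real.log T := by linarith
  have hm0 : 0 ≤ m := by
    rw [hm]; refine div_nonneg ?_ hlogpos.le
    rw [pow_succ]; nlinarith
  -- The bounds `1 - T ≤ -log T ≤ 1/T - 1` place the mass between `T ^ (n + 1)` and `T ^ n`. Hence
  -- the defect `T ^ n - m` is bounded by a telescoping difference, and no factor `1/(1 - T)`
  -- appears.
  have hmle : m ≤ T ^ n := by
    rw [hm, div_le_iff₀ hlogpos, pow_succ]; nlinarith
  have hmge : T ^ n - m ≤ T ^ n - T ^ (n + 1) := by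
    have h2 : -Real.log T ≤ T⁻¹ - 1 := by
      rw [← Real.log_inv]; exact Real.log_le_sub_one_of_pos (by positivity)
    have h3 : T * (-Real.log T) ≤ 1 - T := by
      calc T * (-Real.log T) ≤ T * (T⁻¹ - 1) := by gcongr
        _ = 1 - T := by field_simp
    have : T ^ (n + 1) ≤ m := by
      rw [hm, le_div_iff₀ hlogpos, pow_succ]; nlinarith
    linarith
  have hm1 : m ≤ 1 := hmle.trans (pow_le_one₀ hT0.le hT1.le)
  have hint : ∫ s in s₁..s₀, ((2 * a / L * axisRatio a c s ^ b : ℝ) : ℂ) * k s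
      = ∫ s in s₁..s₀, (w s : ℂ) * f s := by
    refine intervalIntegral.integral_congr fun s hs => ?_
    rw [hsub'] at hs
    have := (hpos s hs.1).ne'
    have h1 : w s * (s ^ 2 - a ^ 2) = 2 * a / L * axisRatio a c s ^ b := by
      rw [hw]; field_simp
    simp only [hf]
    rw [← mul_assoc, ← Complex.ofReal_mul, h1]
  have hwcc : ContinuousOn (fun s => (w s : ℂ)) (uIcc s₁ s₀) :=
    Complex.continuous_ofReal.comp_continuousOn hwc
  have hsplit : ∫ s in s₁..s₀, (w s : ℂ) * f s
      = m * f s₀ + ∫ s in s₁..s₀, (w s : ℂ) * (f s - f s₀) := by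
    have e : ∀ s, (w s : ℂ) * f s = (w s : ℂ) * f s₀ + (w s : ℂ) * (f s - f s₀) := fun s => by ring
    have i1 : IntervalIntegrable (fun s => (w s : ℂ) * f s₀) volume s₁ s₀ :=
      (hwcc.mul continuousOn_const).intervalIntegrable
    have i2 : IntervalIntegrable (fun s => (w s : ℂ) * (f s - f s₀)) volume s₁ s₀ :=
      (hwcc.mul (hfc.sub continuousOn_const)).intervalIntegrable
    simp_rw [e]
    rw [intervalIntegral.integral_add i1 i2,
      intervalIntegral.integral_mul_const, intervalIntegral.integral_ofReal, hmass]
  have herr : ‖∫ s in s₁..s₀, (w s : ℂ) * (f s - f s₀)‖ ≤ m * (h s₀ - h s₁) := by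
    have h1 : ∀ᵐ s, s ∈ Ioc s₁ s₀ → ‖(w s : ℂ) * (f s - f s₀)‖ ≤ w s * (h s₀ - h s₁) := by
      refine Eventually.of_forall fun s hs => ?_
      rw [norm_mul, Complex.norm_real, Real.norm_of_nonneg (hw0 s hs.1.le)]
      refine mul_le_mul_of_nonneg_left ?_ (hw0 s hs.1.le)
      have h2 := hfv s s₀ (has₁.le.trans hs.1.le) hs.2 h0c
      have h3 := (norm_nonneg _).trans (hfv s₁ s has₁.le hs.1.le (hs.2.trans h0c))
      rw [norm_sub_rev]
      exact h2.trans (by linarith)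
    have h2 := intervalIntegral.norm_integral_le_of_norm_le h10 h1
      (hwc.mul continuousOn_const).intervalIntegrable
    rwa [intervalIntegral.integral_mul_const, hmass] at h2
  have hh0 : 0 ≤ h s₀ - h s₁ := (norm_nonneg _).trans (hfv s₁ s₀ has₁.le h10 h0c)
  have hA := hfA s₀ (has₁.le.trans h10) h0c
  have hA0 : 0 ≤ A := (norm_nonneg _).trans hA
  rw [hint, hsplit]
  have e : (T : ℂ) ^ n * f s₀ - (m * f s₀ + ∫ s in s₁..s₀, (w s : ℂ) * (f s - f s₀))
      = ((T ^ n - m : ℝ) : ℂ) * f s₀ - ∫ s in s₁..s₀, (w s : ℂ) * (f s - f s₀) := by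
    push_cast; ring
  rw [e]
  refine (norm_sub_le _ _).trans (add_le_add ?_ (herr.trans (mul_le_of_le_one_left hh0 hm1)))
  rw [norm_mul, Complex.norm_real, Real.norm_of_nonneg (by linarith)]
  exact mul_le_mul hmge hA (norm_nonneg _) (by
    rw [pow_succ]; nlinarith)

/-- Comparison of the series over the image positions with an integral. -/
theorem norm_tsum_sub_integral_le (ha : 0 < a) (hac : a < c) (hl1 : lam < 1) (hl0 : 0 < lam)
    (hT0 : 0 < T) (hT1 : T < 1) {k : ℝ → ℂ} (hk : ContinuousOn k (Icc a c)) {A K : ℝ} {h : ℝ → ℝ}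
    (hfA : ∀ s, a ≤ s → s ≤ c → ‖((s ^ 2 - a ^ 2 : ℝ) : ℂ) * k s‖ ≤ A)
    (hfv : ∀ s' s, a ≤ s' → s' ≤ s → s ≤ c →
      ‖((s ^ 2 - a ^ 2 : ℝ) : ℂ) * k s - ((s' ^ 2 - a ^ 2 : ℝ) : ℂ) * k s'‖ ≤ h s - h s')
    (hK : ∀ s, a ≤ s → s ≤ c → h c - h s ≤ K) :
    ‖(∑' n : ℕ, (T : ℂ) ^ n * (((pencilCenter a (lam ^ n * pencilMod a c) ^ 2 - a ^ 2 : ℝ) : ℂ)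
        * k (pencilCenter a (lam ^ n * pencilMod a c))))
      - ∫ s in a..c, ((2 * a / (-Real.log lam)
          * axisRatio a c s ^ (Real.log T / Real.log lam) : ℝ) : ℂ) * k s‖ ≤ A + K := by
  set L := -Real.log lam with hL
  set b := Real.log T / Real.log lam with hb
  have hμ0 := pencilMod_pos ha hac
  have hμ1 := pencilMod_lt_one ha hac
  have hbpos : 0 < b := by
    rw [hb]; exact div_pos_of_neg_of_neg (Real.log_neg hT0 hT1) (Real.log_neg hl0 hl1)
  set s : ℕ → ℝ := fun n => pencilCenter a (lam ^ n * pencilMod a c) with hs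
  have hmem : ∀ n, a ≤ s n ∧ s n ≤ c := fun n => by
    have hx : lam ^ n * pencilMod a c ≤ pencilMod a c :=
      mul_le_of_le_one_left hμ0.le (pow_le_one₀ hl0.le hl1.le)
    refine ⟨le_pencilCenter ha (by positivity) (hx.trans_lt hμ1), ?_⟩
    conv_rhs => rw [← pencilCenter_pencilMod ha hac]
    exact pencilCenter_mono ha hx hμ1
  have hs0 : s 0 = c := by simp [hs, pencilCenter_pencilMod ha hac]
  set g : ℝ → ℂ := fun s => ((2 * a / L * axisRatio a c s ^ b : ℝ) : ℂ) * k s with hg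
  have hgc : ContinuousOn g (Icc a c) := by
    refine ContinuousOn.mul (Complex.continuous_ofReal.comp_continuousOn ?_) hk
    exact continuousOn_const.mul (continuousOn_axisRatio_rpow ha hbpos.le)
  have hgi : ∀ x y, a ≤ x → x ≤ c → a ≤ y → y ≤ c → IntervalIntegrable g volume x y :=
    fun x y h1 h2 h3 h4 => (hgc.mono (uIcc_subset_Icc ⟨h1, h2⟩ ⟨h3, h4⟩)).intervalIntegrable
  have hpart : ∀ N, ‖(∑ n ∈ Finset.range N, (T : ℂ) ^ n * (((s n ^ 2 - a ^ 2 : ℝ) : ℂ) * k (s n)))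
      - ∫ x in s N..c, g x‖ ≤ A + K := by
    intro N
    have h1 : ∫ x in s N..c, g x = ∑ n ∈ Finset.range N, ∫ x in s (n + 1)..s n, g x := by
      have h2 := intervalIntegral.sum_integral_adjacent_intervals (a := s) (n := N) (μ := volume)
        (f := g) fun i _ => hgi _ _ (hmem i).1 (hmem i).2 (hmem (i + 1)).1 (hmem (i + 1)).2
      rw [intervalIntegral.integral_symm, ← hs0, ← h2, ← Finset.sum_neg_distrib]
      exact Finset.sum_congr rfl fun i _ => (intervalIntegral.integral_symm _ _).symm
    rw [h1, ← Finset.sum_sub_distrib]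
    refine (norm_sum_le _ _).trans ?_
    refine (Finset.sum_le_sum fun n _ => norm_sub_setIntegral_le ha hac hl1 hl0 hT0 hT1 hk hfA hfv
      hL hb n (s₀ := s n) (s₁ := s (n + 1)) rfl rfl).trans ?_
    -- Both error terms telescope: the masses to at most `1`, the variation to at most `K`.
    rw [Finset.sum_add_distrib, ← Finset.sum_mul, Finset.sum_range_sub',
      Finset.sum_range_sub' (fun n => h (s n)), hs0]
    have hA0 : 0 ≤ A := (norm_nonneg _).trans (hfA a le_rfl hac.le)
    have h3 := hK (s N) (hmem N).1 (hmem N).2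
    have h4 : 0 < T ^ N := by positivity
    rw [pow_zero]
    nlinarith
  have hsum : Summable fun n => (T : ℂ) ^ n * (((s n ^ 2 - a ^ 2 : ℝ) : ℂ) * k (s n)) :=
    summable_pow_mul_of_bounded (by rwa [abs_of_pos hT0]) fun n => hfA _ (hmem n).1 (hmem n).2
  have ht1 := hsum.hasSum.tendsto_sum_nat
  have ht2 : Tendsto (fun N => ∫ x in s N..c, g x) atTop (𝓝 (∫ x in a..c, g x)) := by
    have hcp := intervalIntegral.continuousOn_primitive_interval_left
      (f := g) (a := a) (b := c) (μ := volume)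
      (by rw [uIcc_of_le hac.le]; exact hgc.integrableOn_Icc)
    have h1 : Tendsto s atTop (𝓝[uIcc a c] a) := by
      refine tendsto_nhdsWithin_iff.2 ⟨tendsto_pencilCenter a hl0 hl1 _, ?_⟩
      exact Eventually.of_forall fun n => by rw [uIcc_of_le hac.le]; exact hmem n
    exact (hcp a left_mem_uIcc).tendsto.comp h1
  exact le_of_tendsto (ht1.sub ht2).norm (Eventually.of_forall hpart)

end SumIntegral

/-! ### Estimates for the derivative of the image series. -/

/-- Uniform hypotheses on the geometry and the outer field. -/
structure FieldBounds (a c κ cmax A B : ℝ) (E : ℂ → ℂ) (z : ℂ) : Prop where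
  a_pos : 0 < a
  a_lt : a < c
  κ_pos : 0 < κ
  c_le : c ≤ cmax
  diff : Differentiable ℂ E
  bound : ∀ w, ‖w‖ ≤ cmax / κ → ‖E w‖ ≤ A
  bound' : ∀ w, ‖w‖ ≤ cmax / κ → ‖deriv E w‖ ≤ B
  dist : ∀ s : ℝ, a ≤ s → s ≤ c → κ * (s + ‖z‖) ≤ ‖z + s‖

/-- Bound for the total variation of `imageKernel`. -/
noncomputable def variationBound (κ cmax A B : ℝ) : ℝ := B * κ⁻¹ ^ 4 * cmax + 2 * A * κ⁻¹ ^ 3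

namespace FieldBounds
variable {a c κ cmax A B : ℝ} {E : ℂ → ℂ} {z : ℂ}

theorem cmax_pos (h : FieldBounds a c κ cmax A B E z) : 0 < cmax :=
  (h.a_pos.trans h.a_lt).trans_le h.c_le

theorem norm_zero_le (h : FieldBounds a c κ cmax A B E z) : ‖(0 : ℂ)‖ ≤ cmax / κ := by
  rw [norm_zero]
  exact div_nonneg h.cmax_pos.le h.κ_pos.le

theorem A_nonneg (h : FieldBounds a c κ cmax A B E z) : 0 ≤ A :=
  (norm_nonneg _).trans (h.bound 0 h.norm_zero_le)

theorem B_nonneg (h : FieldBounds a c κ cmax A B E z) : 0 ≤ B :=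
  (norm_nonneg _).trans (h.bound' 0 h.norm_zero_le)

theorem div_le (h : FieldBounds a c κ cmax A B E z) : c / κ ≤ cmax / κ := by
  have := h.c_le
  have := h.κ_pos
  gcongr

theorem kernel_le (h : FieldBounds a c κ cmax A B E z) {s : ℝ} (hs : a ≤ s) (hsc : s ≤ c) :
    ‖imageKernel a E z s‖ ≤ A * κ⁻¹ ^ 2 :=
  norm_imageKernel_le h.a_pos h.κ_pos (fun w hw => h.bound w (hw.trans h.div_le)) hs hsc
    (h.dist s hs hsc)

theorem kernel_sub_le (h : FieldBounds a c κ cmax A B E z) {s' s : ℝ} (hs' : a ≤ s')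
    (hss : s' ≤ s) (hsc : s ≤ c) :
    ‖imageKernel a E z s - imageKernel a E z s'‖
      ≤ kernelMajorant a κ A B ‖z‖ s - kernelMajorant a κ A B ‖z‖ s' :=
  norm_imageKernel_sub_le h.a_pos h.κ_pos h.diff (fun w hw => h.bound w (hw.trans h.div_le))
    (fun w hw => h.bound' w (hw.trans h.div_le)) h.dist hs' hss hsc

theorem variationBound_nonneg (h : FieldBounds a c κ cmax A B E z) :
    0 ≤ variationBound κ cmax A B := by
  have := h.A_nonneg
  have := h.B_nonneg
  have := h.cmax_pos
  have := h.κ_pos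
  unfold variationBound
  positivity

theorem majorant_sub_le (h : FieldBounds a c κ cmax A B E z) {s s' : ℝ} (hs' : a ≤ s')
    (hs : a ≤ s) (hsc : s ≤ c) :
    kernelMajorant a κ A B ‖z‖ s - kernelMajorant a κ A B ‖z‖ s' ≤ variationBound κ cmax A B := by
  refine (kernelMajorant_sub_le h.a_pos h.κ_pos h.A_nonneg h.B_nonneg (norm_nonneg z) hs' hs
    hsc).trans ?_
  have := h.B_nonneg
  have := h.c_le
  have := h.κ_pos
  unfold variationBound
  gcongr

theorem add_ne_zero (h : FieldBounds a c κ cmax A B E z) {s : ℝ} (hs : a ≤ s) (hsc : s ≤ c) :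
    z + s ≠ 0 := by
  have ha := h.a_pos
  refine norm_pos_iff.1 (lt_of_lt_of_le ?_ (h.dist s hs hsc))
  have := norm_nonneg z
  exact mul_pos h.κ_pos (by linarith)

theorem norm_inv_sq_le (h : FieldBounds a c κ cmax A B E z) {s : ℝ} (hs : a ≤ s) (hsc : s ≤ c) :
    ‖1 / (z + s) ^ 2‖ ≤ κ⁻¹ ^ 2 / s ^ 2 := by
  have ha := h.a_pos
  have hκ := h.κ_pos
  have h1 := h.dist s hs hsc
  have h2 : κ * s ≤ ‖z + s‖ := le_trans (by gcongr; linarith [norm_nonneg z]) h1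
  have hs0 : 0 < s := by linarith
  rw [norm_div, norm_one, norm_pow]
  calc 1 / ‖z + s‖ ^ 2 ≤ 1 / (κ * s) ^ 2 := by gcongr
    _ = _ := by field_simp

end FieldBounds

/-- Bound for one family of images, for products of contrasts away from `1`. -/
theorem FieldBounds.norm_tsum_le {a c κ cmax A B : ℝ} {E : ℂ → ℂ} {z : ℂ}
    (h : FieldBounds a c κ cmax A B E z) {T δ : ℝ} (hT : |T| < 1) (hδ : 0 < δ) (hTδ : T ≤ 1 - δ)
    {s : ℕ → ℝ} (hs : Antitone s) (hmem : ∀ n, a ≤ s n ∧ s n ≤ c) :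
    ‖∑' n, (T : ℂ) ^ n * imageKernel a E z (s n)‖
      ≤ A * κ⁻¹ ^ 2 / δ + (A * κ⁻¹ ^ 2 + variationBound κ cmax A B) := by
  have hA := h.A_nonneg
  have hκ := h.κ_pos
  have hV := h.variationBound_nonneg
  have hb : ∀ n, ‖imageKernel a E z (s n)‖ ≤ A * κ⁻¹ ^ 2 := fun n =>
    h.kernel_le (hmem n).1 (hmem n).2
  -- The distance `δ` from `1` is needed only for `T ≥ 0`. For negative `T` cancellation between
  -- consecutive images suffices.
  rcases le_total 0 T with h0 | h0
  · refine (norm_tsum_pow_mul_le_of_nonneg h0 (abs_lt.1 hT).2 hb).trans ?_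
    have : A * κ⁻¹ ^ 2 / (1 - T) ≤ A * κ⁻¹ ^ 2 / δ := by gcongr; linarith
    have : 0 ≤ A * κ⁻¹ ^ 2 := by positivity
    linarith
  · refine (norm_tsum_pow_mul_le_of_nonpos h0 (abs_lt.1 hT).1 hb
      (h := fun n => kernelMajorant a κ A B ‖z‖ (s n)) (fun n =>
        h.kernel_sub_le (hmem (n + 1)).1 (hs (Nat.le_succ n)) (hmem n).2) fun n =>
        h.majorant_sub_le (hmem n).1 (hmem 0).1 (hmem 0).2).trans ?_
    have : 0 ≤ A * κ⁻¹ ^ 2 / δ := by positivity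
    linarith

section Field

variable {a r₁ r₂ c₁ c₂ κ cmax A B : ℝ} {F : ℂ → ℂ} {z : ℂ} {t₁ t₂ : ℝ}

theorem oddCenter_antitone (h : PencilData a r₁ r₂ c₁ c₂) : Antitone (oddCenter a c₁ c₂) := by
  refine antitone_nat_of_succ_le fun n => ?_
  refine pencilCenter_mono h.a_pos ?_ ((h.odd_arg n).2.trans_lt h.mod_lt_one)
  have := h.mod_pos
  gcongr ?_ * _
  exact pow_le_pow_of_le_one h.ratio_pos.le h.ratio_lt_one.le (Nat.le_succ n)

theorem evenCenter_antitone (h : PencilData a r₁ r₂ c₁ c₂) : Antitone (evenCenter a c₁ c₂) := by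
  refine antitone_nat_of_succ_le fun n => ?_
  refine pencilCenter_mono h.a_pos ?_ ((h.even_arg n).2.trans_lt h.mod_lt_one)
  exact pow_le_pow_of_le_one h.ratio_pos.le h.ratio_lt_one.le (Nat.le_succ _)

theorem even_le_odd (h : PencilData a r₁ r₂ c₁ c₂) (n : ℕ) :
    evenCenter a c₁ c₂ n ≤ oddCenter a c₁ c₂ n := by
  refine pencilCenter_mono h.a_pos ?_ ((h.odd_arg n).2.trans_lt h.mod_lt_one)
  rw [pow_succ]
  have := h.ratio_pos
  gcongr
  exact mul_le_of_le_one_right h.mod_pos.le h.symm.mod_lt_one.le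

theorem odd_succ_le_even (h : PencilData a r₁ r₂ c₁ c₂) (n : ℕ) :
    oddCenter a c₁ c₂ (n + 1) ≤ evenCenter a c₁ c₂ n := by
  refine pencilCenter_mono h.a_pos ?_ ((h.even_arg n).2.trans_lt h.mod_lt_one)
  exact mul_le_of_le_one_right (pow_pos h.ratio_pos _).le h.mod_lt_one.le

theorem deriv_imageField_eq (h : PencilData a r₁ r₂ c₁ c₂) (ht : |t₁ * t₂| < 1)
    (hF : Differentiable ℂ F) (hz : r₁ ≤ ‖z + c₁‖)
    (hE : FieldBounds a c₁ κ cmax A B (deriv F) z)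
    (hE' : FieldBounds a c₁ κ cmax A B (fun w => conjFun (deriv F) (-w)) z) :
    deriv (imageField a c₁ c₂ t₁ t₂ F) z
      = (t₁ * t₂ : ℝ) * ∑' n, ((t₁ * t₂ : ℝ) : ℂ) ^ n
          * imageKernel a (deriv F) z (evenCenter a c₁ c₂ n)
        + t₁ * ∑' n, ((t₁ * t₂ : ℝ) : ℂ) ^ n
          * imageKernel a (fun w => conjFun (deriv F) (-w)) z (oddCenter a c₁ c₂ n) := by
  have hs := (h.hasSum_deriv_imageField ht hF (h.mem_extNhd hz)).tsum_eq
  rw [← hs, ← tsum_mul_left, ← tsum_mul_left, ← Summable.tsum_add]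
  · refine tsum_congr fun n => ?_
    simp only [imageKernel]
    push_cast
    ring
  · exact (summable_pow_mul_of_bounded ht fun n =>
      hE.kernel_le (h.even_mem n).1 (h.even_mem n).2).mul_left _
  · exact (summable_pow_mul_of_bounded ht fun n =>
      hE'.kernel_le (h.odd_mem n).1 (h.odd_mem n).2).mul_left _

/-- The field of the images is bounded as long as the product of the contrasts is away
from `1`. -/
theorem norm_deriv_imageField_le (h : PencilData a r₁ r₂ c₁ c₂) (ht₁ : |t₁| < 1)
    (ht : |t₁ * t₂| < 1) {δ : ℝ} (hδ : 0 < δ) (hTδ : t₁ * t₂ ≤ 1 - δ)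
    (hF : Differentiable ℂ F) (hz : r₁ ≤ ‖z + c₁‖)
    (hE : FieldBounds a c₁ κ cmax A B (deriv F) z)
    (hE' : FieldBounds a c₁ κ cmax A B (fun w => conjFun (deriv F) (-w)) z) :
    ‖deriv (imageField a c₁ c₂ t₁ t₂ F) z‖
      ≤ 2 * (A * κ⁻¹ ^ 2 / δ + (A * κ⁻¹ ^ 2 + variationBound κ cmax A B)) := by
  rw [deriv_imageField_eq h ht hF hz hE hE']
  refine (norm_add_le _ _).trans ?_
  rw [norm_mul, norm_mul, Complex.norm_real, Complex.norm_real, Real.norm_eq_abs, Real.norm_eq_abs,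
    two_mul]
  refine add_le_add ?_ ?_
  · exact (mul_le_of_le_one_left (norm_nonneg _) ht.le).trans
      (hE.norm_tsum_le ht hδ hTδ (evenCenter_antitone h) h.even_mem)
  · exact (mul_le_of_le_one_left (norm_nonneg _) ht₁.le).trans
      (hE'.norm_tsum_le ht hδ hTδ (oddCenter_antitone h) h.odd_mem)

/-- The continuous distribution of images. -/
noncomputable def lineField (a c L b : ℝ) (k : ℝ → ℂ) : ℂ :=
  ∫ s in a..c, ((2 * a / L * axisRatio a c s ^ b : ℝ) : ℂ) * k s

theorem FieldBounds.continuousOn_inv_sq (h : FieldBounds a c₁ κ cmax A B F z) :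
    ContinuousOn (fun s : ℝ => 1 / (z + s) ^ 2) (Icc a c₁) := by
  refine ContinuousOn.div continuousOn_const
    ((continuous_const.add Complex.continuous_ofReal).pow 2).continuousOn fun s hs => ?_
  exact pow_ne_zero _ (h.add_ne_zero hs.1 hs.2)

theorem FieldBounds.continuousOn_pencilMap (h : FieldBounds a c₁ κ cmax A B F z) :
    ContinuousOn (fun s : ℝ => pencilMap a s z) (Icc a c₁) := by
  unfold pencilMap
  refine ContinuousOn.div ?_ (continuous_const.add Complex.continuous_ofReal).continuousOn
    fun s hs => h.add_ne_zero hs.1 hs.2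
  exact ((Complex.continuous_ofReal.mul continuous_const).add continuous_const).continuousOn

/-- The positions `oddCenter` are exactly those of `norm_tsum_sub_integral_le`, and `kernelMajorant`
serves as the variation function. -/
theorem FieldBounds.norm_tsum_odd_sub_le (hd : PencilData a r₁ r₂ c₁ c₂)
    (h : FieldBounds a c₁ κ cmax A B F z) {T : ℝ} (hT0 : 0 < T) (hT1 : T < 1) :
    ‖∑' n, (T : ℂ) ^ n * imageKernel a F z (oddCenter a c₁ c₂ n)
      - lineField a c₁ (-Real.log (pencilRatio a c₁ c₂))
          (Real.log T / Real.log (pencilRatio a c₁ c₂))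
          (fun s => F (pencilMap a s z) * (1 / (z + s) ^ 2))‖
      ≤ A * κ⁻¹ ^ 2 + variationBound κ cmax A B := by
  have e : ∀ s : ℝ, imageKernel a F z s
      = ((s ^ 2 - a ^ 2 : ℝ) : ℂ) * (F (pencilMap a s z) * (1 / (z + s) ^ 2)) := fun s => by
    unfold imageKernel; push_cast; ring
  have hk : ContinuousOn (fun s : ℝ => F (pencilMap a s z) * (1 / (z + s) ^ 2)) (Icc a c₁) :=
    (h.diff.continuous.comp_continuousOn h.continuousOn_pencilMap).mul h.continuousOn_inv_sq
  have := norm_tsum_sub_integral_le hd.a_pos hd.a_lt hd.ratio_lt_one hd.ratio_pos hT0 hT1 hk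
    (A := A * κ⁻¹ ^ 2) (K := variationBound κ cmax A B) (h := kernelMajorant a κ A B ‖z‖)
    (fun s h1 h2 => by rw [← e]; exact h.kernel_le h1 h2)
    (fun s' s h1 h2 h3 => by rw [← e, ← e]; exact h.kernel_sub_le h1 h2 h3)
    (fun s h1 h2 => h.majorant_sub_le h1 hd.a_lt.le le_rfl)
  simp_rw [e]
  exact this

/-- Even and odd positions interlace, so termwise differences are bounded by one total variation of
the kernel, uniformly in `T`. Hence only the odd positions need comparison with an integral. -/
theorem FieldBounds.norm_tsum_even_sub_odd_le (hd : PencilData a r₁ r₂ c₁ c₂)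
    (h : FieldBounds a c₁ κ cmax A B F z) {T : ℝ} (hT0 : 0 < T) (hT1 : T < 1) :
    ‖∑' n, (T : ℂ) ^ n * imageKernel a F z (evenCenter a c₁ c₂ n)
      - ∑' n, (T : ℂ) ^ n * imageKernel a F z (oddCenter a c₁ c₂ n)‖
      ≤ variationBound κ cmax A B := by
  have hT : |T| < 1 := by rwa [abs_of_pos hT0]
  rw [← Summable.tsum_sub
    (summable_pow_mul_of_bounded hT fun n => h.kernel_le (hd.even_mem n).1 (hd.even_mem n).2)
    (summable_pow_mul_of_bounded hT fun n => h.kernel_le (hd.odd_mem n).1 (hd.odd_mem n).2)]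
  refine norm_tsum_le_of_sum_range_le fun N => ?_
  refine (Finset.sum_le_sum fun n _ => ?_).trans
    ((Finset.sum_range_sub' (fun n => kernelMajorant a κ A B ‖z‖ (oddCenter a c₁ c₂ n)) N).le.trans
      (h.majorant_sub_le (hd.odd_mem N).1 (hd.odd_mem 0).1 (hd.odd_mem 0).2))
  rw [← mul_sub, norm_mul, norm_pow, Complex.norm_real, Real.norm_of_nonneg hT0.le, norm_sub_rev]
  refine (mul_le_of_le_one_left (norm_nonneg _) (pow_le_one₀ hT0.le hT1.le)).trans ?_
  have h1 := h.kernel_sub_le (hd.even_mem n).1 (even_le_odd hd n) (hd.odd_mem n).2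
  have h2 := (norm_nonneg _).trans (h.kernel_sub_le (hd.odd_mem (n + 1)).1 (odd_succ_le_even hd n)
    (hd.even_mem n).2)
  linarith

/-- Freezing the outer field at the origin. -/
theorem FieldBounds.norm_lineField_sub_le (h : FieldBounds a c₁ κ cmax A B F z) {L b lmax : ℝ}
    (hL : 0 < L) (hb : 0 ≤ b) (hlm : 2 * a / L ≤ lmax) :
    ‖lineField a c₁ L b (fun s => F (pencilMap a s z) * (1 / (z + s) ^ 2))
      - F 0 * lineField a c₁ L b (fun s => 1 / (z + s) ^ 2)‖ ≤ lmax * (2 * B * κ⁻¹ ^ 3) := by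
  have ha := h.a_pos
  have hac := h.a_lt
  have hκ := h.κ_pos
  have hB := h.B_nonneg
  have hl0 : 0 ≤ 2 * a / L := by positivity
  have cw : ContinuousOn (fun s => ((2 * a / L * axisRatio a c₁ s ^ b : ℝ) : ℂ)) (Icc a c₁) :=
    Complex.continuous_ofReal.comp_continuousOn
      (continuousOn_const.mul (continuousOn_axisRatio_rpow ha hb))
  have hu : uIcc a c₁ = Icc a c₁ := uIcc_of_le hac.le
  have i1 : IntervalIntegrable (fun s : ℝ => ((2 * a / L * axisRatio a c₁ s ^ b : ℝ) : ℂ)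
      * (F (pencilMap a s z) * (1 / (z + s) ^ 2))) volume a c₁ := by
    refine ContinuousOn.intervalIntegrable ?_
    rw [hu]
    exact cw.mul ((h.diff.continuous.comp_continuousOn h.continuousOn_pencilMap).mul
      h.continuousOn_inv_sq)
  have i2 : IntervalIntegrable (fun s : ℝ => F 0 * (((2 * a / L * axisRatio a c₁ s ^ b : ℝ) : ℂ)
      * (1 / (z + s) ^ 2))) volume a c₁ := by
    refine ContinuousOn.intervalIntegrable ?_
    rw [hu]
    exact continuousOn_const.mul (cw.mul h.continuousOn_inv_sq)
  unfold lineField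
  rw [← intervalIntegral.integral_const_mul, ← intervalIntegral.integral_sub i1 i2]
  -- The freezing error is at most `B ‖pencilMap a s z‖ / ‖z + s‖²`, which has the shape of the
  -- derivative of the majorant with `A` replaced by `B` and `B` by `0`; its integral is bounded
  -- uniformly in `a` and `z`.
  have hmaj : ∀ s ∈ uIcc a c₁, HasDerivAt (kernelMajorant a κ B 0 ‖z‖)
      (0 * κ⁻¹ ^ 4 + B * κ⁻¹ ^ 3 * (2 * s * ‖z‖ / (s + ‖z‖) ^ 3 + 2 * a ^ 2 / s ^ 3)) s :=
    fun s hs => by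
      rw [hu] at hs
      exact hasDerivAt_kernelMajorant (ha.trans_le hs.1) (norm_nonneg z)
  have cmaj : ContinuousOn (fun s : ℝ =>
      0 * κ⁻¹ ^ 4 + B * κ⁻¹ ^ 3 * (2 * s * ‖z‖ / (s + ‖z‖) ^ 3 + 2 * a ^ 2 / s ^ 3))
      (uIcc a c₁) := by
    rw [hu]
    refine continuousOn_const.add (continuousOn_const.mul (ContinuousOn.add
      (ContinuousOn.div (by fun_prop) (by fun_prop) fun s hs => ?_)
      (ContinuousOn.div (by fun_prop) (by fun_prop) fun s hs => ?_)))
    · have := norm_nonneg z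
      have := ha.trans_le hs.1
      positivity
    · have := ha.trans_le hs.1
      positivity
  have hint : ∫ s in a..c₁, (0 * κ⁻¹ ^ 4
      + B * κ⁻¹ ^ 3 * (2 * s * ‖z‖ / (s + ‖z‖) ^ 3 + 2 * a ^ 2 / s ^ 3)) ≤ 2 * B * κ⁻¹ ^ 3 := by
    rw [intervalIntegral.integral_eq_sub_of_hasDerivAt hmaj cmaj.intervalIntegrable]
    refine (kernelMajorant_sub_le (c := c₁) ha hκ hB le_rfl (norm_nonneg z) le_rfl hac.le
      le_rfl).trans ?_
    simp
  have hbd : ∀ᵐ s : ℝ, s ∈ Ioc a c₁ →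
      ‖((2 * a / L * axisRatio a c₁ s ^ b : ℝ) : ℂ) * (F (pencilMap a s z) * (1 / (z + s) ^ 2))
        - F 0 * (((2 * a / L * axisRatio a c₁ s ^ b : ℝ) : ℂ) * (1 / (z + s) ^ 2))‖
      ≤ 2 * a / L * (0 * κ⁻¹ ^ 4
      + B * κ⁻¹ ^ 3 * (2 * s * ‖z‖ / (s + ‖z‖) ^ 3 + 2 * a ^ 2 / s ^ 3)) := by
    refine Eventually.of_forall fun s hs => ?_
    have has := hs.1.le
    have hs0 : 0 < s := ha.trans hs.1
    have hm := norm_nonneg z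
    have hzs := h.dist s has hs.2
    have hD : 0 < s + ‖z‖ := by linarith
    have e : ((2 * a / L * axisRatio a c₁ s ^ b : ℝ) : ℂ)
        * (F (pencilMap a s z) * (1 / (z + s) ^ 2))
        - F 0 * (((2 * a / L * axisRatio a c₁ s ^ b : ℝ) : ℂ) * (1 / (z + s) ^ 2))
        = ((2 * a / L * axisRatio a c₁ s ^ b : ℝ) : ℂ)
          * ((F (pencilMap a s z) - F 0) * (1 / (z + s) ^ 2)) := by ring
    have hy0 := axisRatio_nonneg ha hac has
    have hy1 := axisRatio_le_one ha hac has hs.2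
    have hyb : axisRatio a c₁ s ^ b ≤ 1 := Real.rpow_le_one hy0 hy1 hb
    have hyb0 : 0 ≤ axisRatio a c₁ s ^ b := Real.rpow_nonneg hy0 b
    rw [e, norm_mul, Complex.norm_real, Real.norm_of_nonneg (by positivity), mul_assoc]
    refine mul_le_mul_of_nonneg_left ?_ hl0
    refine (mul_le_of_le_one_left (norm_nonneg _) hyb).trans ?_
    have hP : ‖pencilMap a s z‖ ≤ cmax / κ :=
      (norm_pencilMap_le_div ha hκ has hzs).trans (by have := hs.2.trans h.c_le; gcongr)
    have hFd : ‖F (pencilMap a s z) - F 0‖ ≤ B * ‖pencilMap a s z‖ := by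
      have := (convex_closedBall (0 : ℂ) (cmax / κ)).norm_image_sub_le_of_norm_deriv_le
        (fun x _ => h.diff x) (fun x hx => h.bound' x (by simpa using hx))
        (show (0 : ℂ) ∈ _ by simpa using h.norm_zero_le)
        (show pencilMap a s z ∈ _ by simpa using hP)
      simpa using this
    have hP2 : ‖pencilMap a s z‖ ≤ (s * ‖z‖ + a ^ 2) / ‖z + s‖ := by
      rw [pencilMap, norm_div]
      have := norm_mul_add_sq_le ha has z
      gcongr
    have hzpos : 0 < ‖z + s‖ := (mul_pos hκ hD).trans_le hzs
    rw [norm_mul, norm_div, norm_one, norm_pow, zero_mul, zero_add]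
    calc ‖F (pencilMap a s z) - F 0‖ * (1 / ‖z + s‖ ^ 2)
        ≤ B * ((s * ‖z‖ + a ^ 2) / ‖z + s‖) * (1 / ‖z + s‖ ^ 2) := by
          gcongr
          exact hFd.trans (by gcongr)
      _ = B * ((s * ‖z‖ + a ^ 2) / ‖z + s‖ ^ 3) := by field_simp
      _ ≤ B * ((s * ‖z‖ + a ^ 2) / (κ * (s + ‖z‖)) ^ 3) := by gcongr
      _ = B * κ⁻¹ ^ 3 * (s * ‖z‖ / (s + ‖z‖) ^ 3 + a ^ 2 / (s + ‖z‖) ^ 3) := by field_simp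
      _ ≤ B * κ⁻¹ ^ 3 * (2 * s * ‖z‖ / (s + ‖z‖) ^ 3 + 2 * a ^ 2 / s ^ 3) := by
          have h1 : a ^ 2 / (s + ‖z‖) ^ 3 ≤ 2 * a ^ 2 / s ^ 3 := by
            gcongr <;> nlinarith
          have h2 : s * ‖z‖ / (s + ‖z‖) ^ 3 ≤ 2 * s * ‖z‖ / (s + ‖z‖) ^ 3 := by
            gcongr; nlinarith
          gcongr
  have := intervalIntegral.norm_integral_le_of_norm_le hac.le hbd
    (cmaj.const_mul (2 * a / L)).intervalIntegrable
  refine this.trans ?_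
  rw [intervalIntegral.integral_const_mul]
  have h2 : 0 ≤ 2 * B * κ⁻¹ ^ 3 := by positivity
  calc _ ≤ 2 * a / L * (2 * B * κ⁻¹ ^ 3) := by gcongr
    _ ≤ _ := by gcongr

end Field

namespace FieldBounds
variable {a c κ cmax A B : ℝ} {E : ℂ → ℂ} {z : ℂ}

/-- Balls around `0` are invariant under negation and conjugation, so the Schwarz-reflected field of
the odd images obeys the same bounds. -/
theorem conj_neg (h : FieldBounds a c κ cmax A B E z) :
    FieldBounds a c κ cmax A B (fun w => conjFun E (-w)) z := by
  have hd : ∀ w, HasDerivAt (fun w => conjFun E (-w)) (conjFun (deriv E) (-w) * -1) w := fun w =>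
    (hasDerivAt_conjFun h.diff (-w)).comp w (hasDerivAt_neg w)
  refine ⟨h.a_pos, h.a_lt, h.κ_pos, h.c_le, fun w => (hd w).differentiableAt, fun w hw => ?_,
    fun w hw => ?_, h.dist⟩
  · simpa [conjFun] using h.bound (conj (-w)) (by simpa using hw)
  · rw [(hd w).deriv]
    simpa [conjFun] using h.bound' (conj (-w)) (by simpa using hw)

theorem neg_comp_neg (h : FieldBounds a c κ cmax A B E z) :
    FieldBounds a c κ cmax A B (fun w => -E (-w)) z := by
  have hd : ∀ w, HasDerivAt (fun w => -E (-w)) (-(deriv E (-w) * -1)) w := fun w =>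
    ((h.diff (-w)).hasDerivAt.comp w (hasDerivAt_neg w)).neg
  refine ⟨h.a_pos, h.a_lt, h.κ_pos, h.c_le, fun w => (hd w).differentiableAt, fun w hw => ?_,
    fun w hw => ?_, h.dist⟩
  · simpa using h.bound (-w) (by simpa using hw)
  · rw [(hd w).deriv]
    simpa using h.bound' (-w) (by simpa using hw)

theorem one (h : FieldBounds a c κ cmax A B E z) :
    FieldBounds a c κ cmax 1 0 (fun _ => 1) z :=
  ⟨h.a_pos, h.a_lt, h.κ_pos, h.c_le, differentiable_const _, fun _ _ => by simp,
    fun _ _ => by simp, h.dist⟩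

end FieldBounds

/-! ### Changing the parameters of the line distribution and splitting the charge. -/

/-- Bernoulli's inequality for the difference of two powers. -/
theorem rpow_sub_rpow_le {y b d : ℝ} (hy0 : 0 ≤ y) (hy1 : y ≤ 1) (hb : 0 < b) (hbd : b ≤ d) :
    |y ^ b - y ^ d| ≤ d / b - 1 := by
  have hx0 : 0 ≤ y ^ b := Real.rpow_nonneg hy0 b
  have hx1 : y ^ b ≤ 1 := Real.rpow_le_one hy0 hy1 hb.le
  have hp : 1 ≤ d / b := (one_le_div hb).2 hbd
  have e : y ^ d = (y ^ b) ^ (d / b) := by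
    rw [← Real.rpow_mul hy0, mul_div_cancel₀ _ hb.ne']
  have h1 := one_add_mul_self_le_rpow_one_add (s := y ^ b - 1) (by linarith) hp
  rw [add_sub_cancel] at h1
  have h2 : (y ^ b) ^ (d / b) ≤ y ^ b := by
    conv_rhs => rw [← Real.rpow_one (y ^ b)]
    exact Real.rpow_le_rpow_of_exponent_ge' hx0 hx1 zero_le_one hp
  rw [e, abs_of_nonneg (by linarith)]
  nlinarith

theorem abs_rpow_sub_rpow_le {y b d m : ℝ} (hy0 : 0 ≤ y) (hy1 : y ≤ 1) (hb : 0 < b) (hd : 0 < d)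
    (h1 : b / d - 1 ≤ m) (h2 : d / b - 1 ≤ m) : |y ^ b - y ^ d| ≤ m := by
  rcases le_total b d with h | h
  · exact (rpow_sub_rpow_le hy0 hy1 hb h).trans h2
  · rw [abs_sub_comm]
    exact (rpow_sub_rpow_le hy0 hy1 hd h).trans h1

section Field

variable {a r₁ r₂ c₁ c₂ κ cmax A B : ℝ} {F : ℂ → ℂ} {z : ℂ} {t₁ t₂ : ℝ}

/-- The comparison of series and integral is used backwards with constant field `1`: the series is
at most `κ⁻² / (1 - T)`. -/
theorem norm_lineField_inv_sq_le (hd : PencilData a r₁ r₂ c₁ c₂)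
    (h : FieldBounds a c₁ κ cmax A B F z) {T : ℝ} (hT0 : 0 < T) (hT1 : T < 1) :
    ‖lineField a c₁ (-Real.log (pencilRatio a c₁ c₂))
          (Real.log T / Real.log (pencilRatio a c₁ c₂)) (fun s => 1 / (z + s) ^ 2)‖
      ≤ κ⁻¹ ^ 2 / (1 - T) + (κ⁻¹ ^ 2 + variationBound κ cmax 1 0) := by
  have h1 := h.one.norm_tsum_odd_sub_le hd hT0 hT1
  have h2 := norm_tsum_pow_mul_le_of_nonneg hT0.le hT1 (b := fun n =>
    imageKernel a (fun _ => 1) z (oddCenter a c₁ c₂ n)) (A := 1 * κ⁻¹ ^ 2) fun n =>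
      h.one.kernel_le (hd.odd_mem n).1 (hd.odd_mem n).2
  simp only [one_mul] at h1 h2
  rw [norm_sub_rev] at h1
  exact (norm_le_norm_add_norm_sub' _ _).trans (add_le_add h2 h1)

/-- Comparison of two line distributions with nearby parameters. -/
theorem FieldBounds.norm_lineField_sub_lineField_le (h : FieldBounds a c₁ κ cmax A B F z)
    {L L' b b' m₁ m₂ lmax : ℝ} (hb : 0 ≤ b) (hb' : 0 ≤ b') (hL' : 0 ≤ 2 * a / L')
    (hlm : 2 * a / L' ≤ lmax) (h₁ : |2 * a / L - 2 * a / L'| ≤ m₁ * a)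
    (h₂ : ∀ y : ℝ, 0 ≤ y → y ≤ 1 → |y ^ b - y ^ b'| ≤ m₂ * a) :
    ‖lineField a c₁ L b (fun s => 1 / (z + s) ^ 2)
      - lineField a c₁ L' b' (fun s => 1 / (z + s) ^ 2)‖ ≤ κ⁻¹ ^ 2 * (m₁ + lmax * m₂) := by
  have ha := h.a_pos
  have hac := h.a_lt
  have hκ := h.κ_pos
  have hu : uIcc a c₁ = Icc a c₁ := uIcc_of_le hac.le
  have ii : ∀ L b : ℝ, 0 ≤ b → IntervalIntegrable (fun s : ℝ =>
      ((2 * a / L * axisRatio a c₁ s ^ b : ℝ) : ℂ) * (1 / (z + s) ^ 2)) volume a c₁ := by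
    intro L b hb
    refine ContinuousOn.intervalIntegrable ?_
    rw [hu]
    exact (Complex.continuous_ofReal.comp_continuousOn
      (continuousOn_const.mul (continuousOn_axisRatio_rpow ha hb))).mul h.continuousOn_inv_sq
  simp only [lineField]
  rw [← intervalIntegral.integral_sub (ii L b hb) (ii L' b' hb')]
  have hm2 : 0 ≤ m₂ * a := (abs_nonneg _).trans (h₂ 0 le_rfl zero_le_one)
  have hm1 : 0 ≤ m₁ * a := (abs_nonneg _).trans h₁
  have hl : 0 ≤ lmax := hL'.trans hlm
  -- The integral of `s⁻²` over `[a, c₁]` is at most `1/a`, which cancels the factor `a` in the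
  -- parameter errors.
  have hD : ∀ s ∈ uIcc a c₁, HasDerivAt (fun s : ℝ => -s⁻¹) (s ^ 2)⁻¹ s := fun s hs => by
    rw [hu] at hs
    have := (hasDerivAt_inv (ha.trans_le hs.1).ne').neg
    convert! this using 1
    simp
  have hci : IntervalIntegrable (fun s : ℝ => (s ^ 2)⁻¹) volume a c₁ := by
    refine ContinuousOn.intervalIntegrable (ContinuousOn.inv₀ (by fun_prop) fun s hs => ?_)
    rw [hu] at hs
    exact pow_ne_zero _ (ha.trans_le hs.1).ne'
  have hbd : ∀ᵐ s : ℝ, s ∈ Ioc a c₁ →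
      ‖((2 * a / L * axisRatio a c₁ s ^ b : ℝ) : ℂ) * (1 / (z + s) ^ 2)
        - ((2 * a / L' * axisRatio a c₁ s ^ b' : ℝ) : ℂ) * (1 / (z + s) ^ 2)‖
      ≤ κ⁻¹ ^ 2 * (m₁ * a + lmax * (m₂ * a)) * (s ^ 2)⁻¹ := by
    refine Eventually.of_forall fun s hs => ?_
    have hy0 := axisRatio_nonneg ha hac hs.1.le
    have hy1 := axisRatio_le_one ha hac hs.1.le hs.2
    have hyb : axisRatio a c₁ s ^ b ≤ 1 := Real.rpow_le_one hy0 hy1 hb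
    have hyb0 : 0 ≤ axisRatio a c₁ s ^ b := Real.rpow_nonneg hy0 b
    have h3 := h₂ _ hy0 hy1
    have h4 := h.norm_inv_sq_le hs.1.le hs.2
    rw [← sub_mul, norm_mul, ← Complex.ofReal_sub, Complex.norm_real, Real.norm_eq_abs]
    have h5 : |2 * a / L * axisRatio a c₁ s ^ b - 2 * a / L' * axisRatio a c₁ s ^ b'|
        ≤ m₁ * a + lmax * (m₂ * a) := by
      have e : 2 * a / L * axisRatio a c₁ s ^ b - 2 * a / L' * axisRatio a c₁ s ^ b'
          = (2 * a / L - 2 * a / L') * axisRatio a c₁ s ^ b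
            + 2 * a / L' * (axisRatio a c₁ s ^ b - axisRatio a c₁ s ^ b') := by ring
      rw [e]
      refine (abs_add_le _ _).trans ?_
      rw [abs_mul, abs_mul, abs_of_nonneg hyb0, abs_of_nonneg hL']
      refine add_le_add ((mul_le_of_le_one_right (abs_nonneg _) hyb).trans h₁) ?_
      exact mul_le_mul hlm h3 (abs_nonneg _) hl
    calc _ ≤ (m₁ * a + lmax * (m₂ * a)) * (κ⁻¹ ^ 2 / s ^ 2) :=
          mul_le_mul h5 h4 (norm_nonneg _) (by positivity)
      _ = _ := by rw [div_eq_mul_inv]; ring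
  refine (intervalIntegral.norm_integral_le_of_norm_le hac.le hbd (hci.const_mul _)).trans ?_
  rw [intervalIntegral.integral_const_mul, intervalIntegral.integral_eq_sub_of_hasDerivAt hD hci]
  have hc0 : 0 < c₁ := ha.trans hac
  have h6 : -c₁⁻¹ - -a⁻¹ ≤ a⁻¹ := by have := inv_pos.2 hc0; linarith
  calc _ ≤ κ⁻¹ ^ 2 * (m₁ * a + lmax * (m₂ * a)) * a⁻¹ := by gcongr
    _ = _ := by field_simp

/-- Error of the line approximation of one family of images. -/
noncomputable def lineError (κ cmax A B lmax : ℝ) : ℝ :=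
  A * κ⁻¹ ^ 2 + 2 * variationBound κ cmax A B + lmax * (2 * B * κ⁻¹ ^ 3)

/-- Three replacements are chained: even positions by odd ones, the sum by an integral, the field at
image points by its value at `0`. Each costs a constant independent of `t₁ t₂`. Even images
contribute `t₁ t₂ F'(0)` to the charge and odd images `t₁ conj F'(0)`. -/
theorem norm_deriv_imageField_sub_le (h : PencilData a r₁ r₂ c₁ c₂) (ht₁ : |t₁| < 1)
    (hT0 : 0 < t₁ * t₂) (hT1 : t₁ * t₂ < 1) (hF : Differentiable ℂ F) (hz : r₁ ≤ ‖z + c₁‖)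
    (hE : FieldBounds a c₁ κ cmax A B (deriv F) z) {lmax : ℝ}
    (hlm : 2 * a / (-Real.log (pencilRatio a c₁ c₂)) ≤ lmax) :
    ‖deriv (imageField a c₁ c₂ t₁ t₂ F) z
      - ((t₁ * t₂ : ℝ) * deriv F 0 + t₁ * conj (deriv F 0))
        * lineField a c₁ (-Real.log (pencilRatio a c₁ c₂))
          (Real.log (t₁ * t₂) / Real.log (pencilRatio a c₁ c₂)) (fun s => 1 / (z + s) ^ 2)‖
      ≤ 2 * lineError κ cmax A B lmax := by
  have ht : |t₁ * t₂| < 1 := by rwa [abs_of_pos hT0]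
  have hL : 0 < -Real.log (pencilRatio a c₁ c₂) := neg_pos.2 (Real.log_neg h.ratio_pos h.ratio_lt_one)
  have hb : 0 ≤ Real.log (t₁ * t₂) / Real.log (pencilRatio a c₁ c₂) :=
    (div_pos_of_neg_of_neg (Real.log_neg hT0 hT1) (Real.log_neg h.ratio_pos h.ratio_lt_one)).le
  rw [deriv_imageField_eq h ht hF hz hE hE.conj_neg]
  have e1 := hE.norm_tsum_odd_sub_le h hT0 hT1
  have e2 := hE.norm_tsum_even_sub_odd_le h hT0 hT1
  have e3 := hE.norm_lineField_sub_le hL hb hlm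
  have o1 := hE.conj_neg.norm_tsum_odd_sub_le h hT0 hT1
  have o3 := hE.conj_neg.norm_lineField_sub_le hL hb hlm
  have hG0 : conjFun (deriv F) (-0) = conj (deriv F 0) := by simp [conjFun]
  rw [hG0] at o3
  set I := lineField a c₁ (-Real.log (pencilRatio a c₁ c₂))
          (Real.log (t₁ * t₂) / Real.log (pencilRatio a c₁ c₂)) (fun s => 1 / (z + s) ^ 2)
  have he := (norm_add_le _ _).trans (add_le_add ((norm_add_le _ _).trans (add_le_add e2 e1)) e3)
  have ho := (norm_add_le _ _).trans (add_le_add o1 o3)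
  rw [sub_add_sub_cancel, sub_add_sub_cancel] at he
  rw [sub_add_sub_cancel] at ho
  set S₁ := ∑' n, ((t₁ * t₂ : ℝ) : ℂ) ^ n * imageKernel a (deriv F) z (evenCenter a c₁ c₂ n)
  set S₂ := ∑' n, ((t₁ * t₂ : ℝ) : ℂ) ^ n
          * imageKernel a (fun w => conjFun (deriv F) (-w)) z (oddCenter a c₁ c₂ n)
  have hV := hE.variationBound_nonneg
  have e : ((t₁ * t₂ : ℝ) : ℂ) * S₁ + t₁ * S₂
      - (((t₁ * t₂ : ℝ) : ℂ) * deriv F 0 + t₁ * conj (deriv F 0)) * I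
      = ((t₁ * t₂ : ℝ) : ℂ) * (S₁ - deriv F 0 * I) + t₁ * (S₂ - conj (deriv F 0) * I) := by ring
  rw [e, two_mul]
  refine (norm_add_le _ _).trans ?_
  rw [norm_mul, norm_mul, Complex.norm_real, Complex.norm_real, Real.norm_eq_abs, Real.norm_eq_abs]
  refine add_le_add ?_ ?_
  · refine (mul_le_of_le_one_left (norm_nonneg _) ht.le).trans (he.trans ?_)
    unfold lineError
    linarith
  · refine (mul_le_of_le_one_left (norm_nonneg _) ht₁.le).trans (ho.trans ?_)
    unfold lineError
    linarith

/-- Total error of the approximation by a line distribution. -/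
noncomputable def fieldError (κ cmax A B lmax m₁ m₂ : ℝ) : ℝ :=
  2 * lineError κ cmax A B lmax + A * (2 * κ⁻¹ ^ 2 + variationBound κ cmax 1 0)
    + 2 * A * (κ⁻¹ ^ 2 * (m₁ + lmax * m₂))

/-- The exact parameters of the line distribution may be replaced by nearby ones, and a charge
of size `1 - t₁ t₂` is negligible. -/
theorem norm_deriv_imageField_sub_lineField_le (h : PencilData a r₁ r₂ c₁ c₂) (ht₁ : |t₁| < 1)
    (hT0 : 0 < t₁ * t₂) (hT1 : t₁ * t₂ < 1) (hF : Differentiable ℂ F) (hz : r₁ ≤ ‖z + c₁‖)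
    (hE : FieldBounds a c₁ κ cmax A B (deriv F) z) {lmax m₁ m₂ L' b' : ℝ}
    (hlm : 2 * a / (-Real.log (pencilRatio a c₁ c₂)) ≤ lmax) (hb' : 0 ≤ b')
    (hL' : 0 ≤ 2 * a / L') (hlm' : 2 * a / L' ≤ lmax)
    (h₁ : |2 * a / (-Real.log (pencilRatio a c₁ c₂)) - 2 * a / L'| ≤ m₁ * a)
    (h₂ : ∀ y : ℝ, 0 ≤ y → y ≤ 1 →
      |y ^ (Real.log (t₁ * t₂) / Real.log (pencilRatio a c₁ c₂)) - y ^ b'| ≤ m₂ * a)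
    {q q' : ℂ} (hq : ((t₁ * t₂ : ℝ) : ℂ) * deriv F 0 + t₁ * conj (deriv F 0) = q + q')
    (hqA : ‖q‖ ≤ 2 * A) (hq' : ‖q'‖ ≤ A * (1 - t₁ * t₂)) :
    ‖deriv (imageField a c₁ c₂ t₁ t₂ F) z
      - q * lineField a c₁ L' b' (fun s => 1 / (z + s) ^ 2)‖
      ≤ fieldError κ cmax A B lmax m₁ m₂ := by
  have hb : 0 ≤ Real.log (t₁ * t₂) / Real.log (pencilRatio a c₁ c₂) :=
    (div_pos_of_neg_of_neg (Real.log_neg hT0 hT1) (Real.log_neg h.ratio_pos h.ratio_lt_one)).le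
  have e1 := norm_deriv_imageField_sub_le h ht₁ hT0 hT1 hF hz hE hlm
  have e2 := norm_lineField_inv_sq_le h hE hT0 hT1
  have e3 := hE.norm_lineField_sub_lineField_le hb hb' hL' hlm' h₁ h₂
  rw [hq] at e1
  set I := lineField a c₁ (-Real.log (pencilRatio a c₁ c₂))
          (Real.log (t₁ * t₂) / Real.log (pencilRatio a c₁ c₂)) (fun s => 1 / (z + s) ^ 2)
  set I' := lineField a c₁ L' b' (fun s => 1 / (z + s) ^ 2)
  have hA := hE.A_nonneg
  have hκ := hE.κ_pos
  have hV := hE.one.variationBound_nonneg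
  have hT : 0 < 1 - t₁ * t₂ := by linarith
  -- The factor `1 - t₁ t₂` in `q'` compensates the `1/(1 - t₁ t₂)` growth of the line field.
  have e4 : ‖q' * I‖ ≤ A * (2 * κ⁻¹ ^ 2 + variationBound κ cmax 1 0) := by
    rw [norm_mul]
    calc ‖q'‖ * ‖I‖ ≤ A * (1 - t₁ * t₂)
          * (κ⁻¹ ^ 2 / (1 - t₁ * t₂) + (κ⁻¹ ^ 2 + variationBound κ cmax 1 0)) := by gcongr
      _ = A * (κ⁻¹ ^ 2 + (1 - t₁ * t₂) * (κ⁻¹ ^ 2 + variationBound κ cmax 1 0)) := by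
          field_simp
      _ ≤ A * (κ⁻¹ ^ 2 + 1 * (κ⁻¹ ^ 2 + variationBound κ cmax 1 0)) := by gcongr; linarith
      _ = _ := by ring
  have e5 : ‖q * (I - I')‖ ≤ 2 * A * (κ⁻¹ ^ 2 * (m₁ + lmax * m₂)) := by
    rw [norm_mul]
    exact mul_le_mul hqA e3 (norm_nonneg _) (by positivity)
  have e : deriv (imageField a c₁ c₂ t₁ t₂ F) z - q * I'
      = deriv (imageField a c₁ c₂ t₁ t₂ F) z - (q + q') * I + q' * I + q * (I - I') := by ring
  rw [e]
  exact (norm_add_le _ _).trans (add_le_add ((norm_add_le _ _).trans (add_le_add e1 e4)) e5)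

/-- Splitting of the charge for two contrasts of the same sign. -/
theorem charge_split_pos (w : ℂ) (h₁ : 0 < t₁) (h₁' : t₁ < 1) (h₂ : 0 < t₂) (h₂' : t₂ < 1) :
    ((t₁ * t₂ : ℝ) : ℂ) * w + t₁ * conj w = ((t₁ * t₂ + t₁) * w.re : ℝ)
        + ((t₁ * t₂ - t₁) * w.im : ℝ) * Complex.I ∧
      ‖(((t₁ * t₂ + t₁) * w.re : ℝ) : ℂ)‖ ≤ 2 * ‖w‖ ∧
      ‖(((t₁ * t₂ - t₁) * w.im : ℝ) : ℂ) * Complex.I‖ ≤ ‖w‖ * (1 - t₁ * t₂) := by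
  have h3 : t₁ * t₂ ≤ 1 := mul_le_one₀ h₁'.le h₂.le h₂'.le
  have h4 : 0 < t₁ * t₂ := by positivity
  refine ⟨by apply Complex.ext <;> simp <;> ring, ?_, ?_⟩
  · rw [Complex.norm_real, Real.norm_eq_abs, abs_mul, abs_of_pos (by positivity)]
    exact mul_le_mul (by linarith) (Complex.abs_re_le_norm w) (abs_nonneg _) (by norm_num)
  · rw [norm_mul, Complex.norm_I, mul_one, Complex.norm_real, Real.norm_eq_abs, abs_mul, mul_comm]
    refine mul_le_mul (Complex.abs_im_le_norm w) ?_ (abs_nonneg _) (norm_nonneg _)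
    rw [abs_le]
    constructor <;> nlinarith

/-- For negative contrasts the real and imaginary parts exchange roles: now `|t₁ t₂ + t₁| = |t₁| (1
- |t₂|)`, which is at most `1 - t₁ t₂`. -/
theorem charge_split_neg (w : ℂ) (h₁ : t₁ < 0) (h₁' : -1 < t₁) (h₂ : t₂ < 0) (h₂' : -1 < t₂) :
    ((t₁ * t₂ : ℝ) : ℂ) * w + t₁ * conj w = ((t₁ * t₂ - t₁) * w.im : ℝ) * Complex.I
        + ((t₁ * t₂ + t₁) * w.re : ℝ) ∧
      ‖(((t₁ * t₂ - t₁) * w.im : ℝ) : ℂ) * Complex.I‖ ≤ 2 * ‖w‖ ∧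
      ‖(((t₁ * t₂ + t₁) * w.re : ℝ) : ℂ)‖ ≤ ‖w‖ * (1 - t₁ * t₂) := by
  have h3 : t₁ * t₂ ≤ 1 := by nlinarith
  have h4 : 0 < t₁ * t₂ := mul_pos_of_neg_of_neg h₁ h₂
  refine ⟨by apply Complex.ext <;> simp <;> ring, ?_, ?_⟩
  · rw [norm_mul, Complex.norm_I, mul_one, Complex.norm_real, Real.norm_eq_abs, abs_mul,
      abs_of_pos (by linarith)]
    exact mul_le_mul (by linarith) (Complex.abs_im_le_norm w) (abs_nonneg _) (by norm_num)
  · rw [Complex.norm_real, Real.norm_eq_abs, abs_mul, mul_comm]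
    refine mul_le_mul (Complex.abs_re_le_norm w) ?_ (abs_nonneg _) (norm_nonneg _)
    rw [abs_le]
    constructor <;> nlinarith

end Field

/-! ### Asymptotics of the geometry as the gap closes. -/

namespace PencilData

variable {a r₁ r₂ c₁ c₂ : ℝ}

theorem r_le_c (h : PencilData a r₁ r₂ c₁ c₂) : r₁ ≤ c₁ := h.r_lt.le

theorem mod_eq (h : PencilData a r₁ r₂ c₁ c₂) : pencilMod a c₁ = ((c₁ + a) / r₁) ^ (-2 : ℤ) := by
  have h1 := h.eq₁
  have hr := h.r₁_pos
  have hc := h.c₁_pos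
  have ha := h.a_pos
  have e : (c₁ - a) * (c₁ + a) = r₁ ^ 2 := by linear_combination h1
  rw [pencilMod, zpow_neg, div_zpow, inv_div, div_eq_div_iff (by positivity) (by positivity)]
  norm_cast
  linear_combination (c₁ + a) * e

theorem log_mod (h : PencilData a r₁ r₂ c₁ c₂) :
    Real.log (pencilMod a c₁) = -2 * Real.log ((c₁ + a) / r₁) := by
  rw [h.mod_eq, Real.log_zpow]
  norm_num

theorem inv_div_eq (h : PencilData a r₁ r₂ c₁ c₂) : ((c₁ + a) / r₁)⁻¹ = (c₁ - a) / r₁ := by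
  have h1 := h.eq₁
  have hr := h.r₁_pos
  have hc := h.c₁_pos
  have ha := h.a_pos
  rw [inv_div, div_eq_div_iff (by positivity) (by positivity)]
  linear_combination -h1

/-- The bounds `1 - 1/t ≤ log t ≤ t - 1` at `t = (c₁ + a)/r₁` equal `a/r₁ ∓ (c₁ - r₁)/r₁`, because
`1/t = (c₁ - a)/r₁`; moreover `c₁ - r₁ ≤ a²/r₁`. -/
theorem abs_log_sub_le (h : PencilData a r₁ r₂ c₁ c₂) :
    |Real.log ((c₁ + a) / r₁) - a / r₁| ≤ a ^ 2 / r₁ ^ 2 := by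
  have h1 := h.eq₁
  have hr := h.r₁_pos
  have hc := h.c₁_pos
  have ha := h.a_pos
  have hrc := h.r_le_c
  have ht : 0 < (c₁ + a) / r₁ := by positivity
  have u := Real.log_le_sub_one_of_pos ht
  have l := Real.one_sub_inv_le_log_of_pos ht
  rw [h.inv_div_eq] at l
  have hcr : (c₁ - r₁) / r₁ ≤ a ^ 2 / r₁ ^ 2 := by
    rw [div_le_div_iff₀ hr (by positivity)]
    have : (c₁ - r₁) * r₁ ≤ a ^ 2 := by nlinarith
    nlinarith
  have e1 : (c₁ + a) / r₁ - 1 = a / r₁ + (c₁ - r₁) / r₁ := by field_simp; ring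
  have e2 : 1 - (c₁ - a) / r₁ = a / r₁ - (c₁ - r₁) / r₁ := by field_simp; ring
  rw [e1] at u
  rw [e2] at l
  rw [abs_le]
  constructor <;> linarith

theorem le_log (h : PencilData a r₁ r₂ c₁ c₂) :
    a / (2 * c₁) ≤ Real.log ((c₁ + a) / r₁) := by
  have h1 := h.eq₁
  have hr := h.r₁_pos
  have hc := h.c₁_pos
  have ha := h.a_pos
  have hrc := h.r_le_c
  have hac := h.a_lt
  have ht : 0 < (c₁ + a) / r₁ := by positivity
  have l := Real.one_sub_inv_le_log_of_pos ht
  rw [h.inv_div_eq] at l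
  refine le_trans ?_ l
  have e : 1 - (c₁ - a) / r₁ = (r₁ + a - c₁) / r₁ := by field_simp; ring
  rw [e, div_le_div_iff₀ (by positivity) hr]
  have e2 : (r₁ + a - c₁) * (c₁ + r₁) = a * (c₁ + r₁ - a) := by linear_combination -h1
  refine le_of_mul_le_mul_right (a := c₁ + r₁) ?_ (by positivity)
  have e3 : (c₁ + r₁) * r₁ ≤ (2 * c₁) * (c₁ + r₁ - a) :=
    mul_le_mul (by linarith) (by linarith) hr.le (by positivity)
  calc a * r₁ * (c₁ + r₁) = a * ((c₁ + r₁) * r₁) := by ring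
    _ ≤ a * ((2 * c₁) * (c₁ + r₁ - a)) := by gcongr
    _ = _ := by linear_combination -(2 * c₁) * e2

theorem neg_log_ratio (h : PencilData a r₁ r₂ c₁ c₂) :
    -Real.log (pencilRatio a c₁ c₂)
      = 2 * Real.log ((c₁ + a) / r₁) + 2 * Real.log ((c₂ + a) / r₂) := by
  rw [pencilRatio, Real.log_mul h.mod_pos.ne' h.symm.mod_pos.ne', h.log_mod, h.symm.log_mod]
  ring

/-- This lower bound requires no small gap, so `2a/L`, with `L` the right-hand side, stays bounded
over all `0 < ε ≤ ε₀`. -/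
theorem le_neg_log_ratio (h : PencilData a r₁ r₂ c₁ c₂) {cmax : ℝ} (hc : c₁ ≤ cmax) :
    a / cmax ≤ -Real.log (pencilRatio a c₁ c₂) := by
  have h1 := h.le_log
  have h2 := h.symm.le_log
  have ha := h.a_pos
  have hc1 := h.c₁_pos
  have hc2 := h.symm.c₁_pos
  have h3 : 0 ≤ a / (2 * c₂) := by positivity
  have h4 : a / cmax ≤ 2 * (a / (2 * c₁)) := by
    rw [show 2 * (a / (2 * c₁)) = a / c₁ by field_simp]
    gcongr
  rw [h.neg_log_ratio]
  linarith

theorem abs_neg_log_ratio_sub_le (h : PencilData a r₁ r₂ c₁ c₂) :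
    |-Real.log (pencilRatio a c₁ c₂) - 2 * a / (r₁ * r₂ / (r₁ + r₂))|
      ≤ 2 * (1 / r₁ ^ 2 + 1 / r₂ ^ 2) * a ^ 2 := by
  have h1 := abs_le.1 h.abs_log_sub_le
  have h2 := abs_le.1 h.symm.abs_log_sub_le
  have hr := h.r₁_pos
  have hr2 := h.symm.r₁_pos
  have e : 2 * a / (r₁ * r₂ / (r₁ + r₂)) = 2 * (a / r₁) + 2 * (a / r₂) := by field_simp; ring
  have e2 : 2 * (1 / r₁ ^ 2 + 1 / r₂ ^ 2) * a ^ 2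
      = 2 * (a ^ 2 / r₁ ^ 2) + 2 * (a ^ 2 / r₂ ^ 2) := by ring
  rw [h.neg_log_ratio, e, e2, abs_le]
  constructor <;> linarith [h1.1, h1.2, h2.1, h2.2]

end PencilData

section Constants

variable {r₁ r₂ ε ε₀ : ℝ}

theorem rStar_sq (h₁ : 0 < r₁) (h₂ : 0 < r₂) : rStar r₁ r₂ ^ 2 = 2 * (r₁ * r₂ / (r₁ + r₂)) := by
  rw [rStar, Real.sq_sqrt (by positivity)]
  ring

theorem alpha_sq_eq (h₁ : 0 < r₁) (h₂ : 0 < r₂) (hε : 0 < ε) :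
    alpha r₁ r₂ ε ^ 2 = ε * (2 * r₁ + ε) * (2 * r₂ + ε) * (2 * r₁ + 2 * r₂ + ε)
      / (4 * (r₁ + r₂ + ε) ^ 2) := by
  rw [alpha, div_pow, Real.sq_sqrt (by positivity)]
  ring

/-- The fixed points are at distance `√(2 r₁ r₂ ε / (r₁ + r₂))` from the origin to leading
order. -/
theorem alpha_sq_bounds (h₁ : 0 < r₁) (h₂ : 0 < r₂) (hε : 0 < ε) :
    2 * (r₁ * r₂ / (r₁ + r₂)) * ε ≤ alpha r₁ r₂ ε ^ 2 ∧
      alpha r₁ r₂ ε ^ 2 ≤ 2 * (r₁ * r₂ / (r₁ + r₂)) * ε + ε ^ 2 := by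
  have hS : 0 < r₁ + r₂ := by positivity
  have e : alpha r₁ r₂ ε ^ 2 - 2 * (r₁ * r₂ / (r₁ + r₂)) * ε
      = ε ^ 2 * ((4 * (r₁ + r₂) ^ 3 - 12 * (r₁ * r₂) * (r₁ + r₂)
        + (4 * (r₁ + r₂) ^ 2 - 8 * (r₁ * r₂)) * ε + (r₁ + r₂) * ε ^ 2)
        / (4 * (r₁ + r₂) * (r₁ + r₂ + ε) ^ 2)) := by
    rw [alpha_sq_eq h₁ h₂ hε]
    have : r₁ + r₂ + ε ≠ 0 := by positivity
    field_simp
    ring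
  have p : 4 * (r₁ * r₂) ≤ (r₁ + r₂) ^ 2 := by nlinarith [sq_nonneg (r₁ - r₂)]
  have p0 : 0 < r₁ * r₂ := by positivity
  have n0 : 0 ≤ 4 * (r₁ + r₂) ^ 3 - 12 * (r₁ * r₂) * (r₁ + r₂) := by nlinarith
  have n1 : 0 ≤ (4 * (r₁ + r₂) ^ 2 - 8 * (r₁ * r₂)) * ε := mul_nonneg (by linarith) hε.le
  have q0 : 0 ≤ (4 * (r₁ + r₂) ^ 3 - 12 * (r₁ * r₂) * (r₁ + r₂)
        + (4 * (r₁ + r₂) ^ 2 - 8 * (r₁ * r₂)) * ε + (r₁ + r₂) * ε ^ 2)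
        / (4 * (r₁ + r₂) * (r₁ + r₂ + ε) ^ 2) := by
    apply div_nonneg _ (by positivity)
    have : 0 ≤ (r₁ + r₂) * ε ^ 2 := by positivity
    linarith
  have q1 : (4 * (r₁ + r₂) ^ 3 - 12 * (r₁ * r₂) * (r₁ + r₂)
        + (4 * (r₁ + r₂) ^ 2 - 8 * (r₁ * r₂)) * ε + (r₁ + r₂) * ε ^ 2)
        / (4 * (r₁ + r₂) * (r₁ + r₂ + ε) ^ 2) ≤ 1 := by
    rw [div_le_one (by positivity)]
    have i1 : 0 ≤ r₁ * r₂ * (r₁ + r₂) := by positivity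
    have i2 : 0 ≤ r₁ * r₂ * ε := by positivity
    have i3 : 0 ≤ (r₁ + r₂) * ε ^ 2 := by positivity
    have i4 : 0 ≤ (r₁ + r₂) ^ 2 * ε := by positivity
    nlinarith
  constructor
  · have : 0 ≤ ε ^ 2 * _ := mul_nonneg (sq_nonneg ε) q0
    linarith
  · have := mul_le_mul_of_nonneg_left q1 (sq_nonneg ε)
    linarith

/-- Parameters of the line distribution, uniformly in the gap. -/
structure Calibrated (a c₁ c₂ ρ e lmax m₁ m₂ : ℝ) : Prop where
  length_le : 2 * a / (-Real.log (pencilRatio a c₁ c₂)) ≤ lmax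
  ρ_pos : 0 < ρ
  ρ_le : ρ ≤ lmax
  length_sub : |2 * a / (-Real.log (pencilRatio a c₁ c₂)) - 2 * a / (2 * a / ρ)| ≤ m₁ * a
  e_pos : 0 < e
  rpow_sub : ∀ t y : ℝ, 0 < t → 0 ≤ y → y ≤ 1 →
    |y ^ (t / -Real.log (pencilRatio a c₁ c₂)) - y ^ (t * ρ / (2 * e))| ≤ m₂ * a

theorem Calibrated.symm {a c₁ c₂ ρ e lmax m₁ m₂ : ℝ} (h : Calibrated a c₁ c₂ ρ e lmax m₁ m₂) :
    Calibrated a c₂ c₁ ρ e lmax m₁ m₂ := by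
  have e : pencilRatio a c₂ c₁ = pencilRatio a c₁ c₂ := mul_comm _ _
  exact ⟨e ▸ h.length_le, h.ρ_pos, h.ρ_le, e ▸ h.length_sub, h.e_pos, e ▸ h.rpow_sub⟩

/-- Since `L = 2a/ρ + O(a²)` and `L ≥ a/cmax`, one has `2a/L = ρ + O(a)`. The exponents `t/L` and
`tρ/(2e)` have ratio `1 + O(a)` independently of `t`, and Bernoulli's inequality turns this ratio
into a bound uniform in `y`. -/
theorem PencilData.calibrated {a c₁ c₂ : ℝ} (h : PencilData a r₁ r₂ c₁ c₂) {cmax ρ e K w : ℝ}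
    (hc : c₁ ≤ cmax) (hρ : ρ = r₁ * r₂ / (r₁ + r₂)) (he : 0 < e) (hw : a ≤ w * e)
    (hea : |a - e| ≤ K * a ^ 2) :
    Calibrated a c₁ c₂ ρ e (2 * cmax + ρ) (ρ * (2 * (1 / r₁ ^ 2 + 1 / r₂ ^ 2)) * cmax)
      ((2 * K / ρ + 2 * (1 / r₁ ^ 2 + 1 / r₂ ^ 2)) * (cmax + ρ * w)) := by
  have ha := h.a_pos
  have hr := h.r₁_pos
  have hr2 := h.symm.r₁_pos
  have hc0 : 0 < cmax := h.c₁_pos.trans_le hc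
  have hρ0 : 0 < ρ := by rw [hρ]; positivity
  have hL := h.le_neg_log_ratio hc
  have hLs := h.abs_neg_log_ratio_sub_le
  rw [← hρ] at hLs
  set L := -Real.log (pencilRatio a c₁ c₂)
  set D := 2 * (1 / r₁ ^ 2 + 1 / r₂ ^ 2) with hD
  have hD0 : 0 < D := by positivity
  have hL0 : 0 < L := (by positivity : 0 < a / cmax).trans_le hL
  have hw0 : 0 < w := by
    by_contra! hcon
    nlinarith
  have hK0 : 0 ≤ K := by
    by_contra! hcon
    have := (abs_nonneg _).trans hea
    have : 0 < a ^ 2 := by positivity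
    nlinarith
  have h1 : 2 * a / L ≤ 2 * cmax := by
    rw [div_le_iff₀ hL0]
    rw [div_le_iff₀ hc0] at hL
    linarith
  have hdiff : |2 * e / ρ - L| ≤ (2 * K / ρ + D) * a ^ 2 := by
    have e1 : 2 * e / ρ - L = -(2 / ρ * (a - e)) - (L - 2 * a / ρ) := by ring
    rw [e1]
    refine (abs_sub _ _).trans ?_
    rw [abs_neg, abs_mul, abs_of_pos (by positivity : 0 < 2 / ρ)]
    calc _ ≤ 2 / ρ * (K * a ^ 2) + D * a ^ 2 := by gcongr
      _ = _ := by ring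
  refine ⟨h1.trans (by linarith), hρ0, by linarith, ?_, he, fun t y ht hy0 hy1 => ?_⟩
  · have e1 : 2 * a / L - 2 * a / (2 * a / ρ) = -(ρ * (L - 2 * a / ρ)) / L := by
      field_simp; ring
    rw [e1, abs_div, abs_neg, abs_mul, abs_of_pos hρ0, abs_of_pos hL0, div_le_iff₀ hL0]
    rw [div_le_iff₀ hc0] at hL
    calc ρ * |L - 2 * a / ρ| ≤ ρ * (D * a ^ 2) := by gcongr
      _ = ρ * D * a * a := by ring
      _ ≤ ρ * D * a * (L * cmax) := by gcongr
      _ = _ := by ring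
  · have hM : 0 ≤ 2 * K / ρ + D := by positivity
    refine abs_rpow_sub_rpow_le hy0 hy1 (by positivity) (by positivity) ?_ ?_
    · have e1 : t / L / (t * ρ / (2 * e)) - 1 = (2 * e / ρ - L) / L := by field_simp
      rw [e1, div_le_iff₀ hL0]
      rw [div_le_iff₀ hc0] at hL
      calc _ ≤ (2 * K / ρ + D) * a * a := (le_abs_self _).trans (hdiff.trans_eq (by ring))
        _ ≤ (2 * K / ρ + D) * a * (L * cmax) := by gcongr
        _ = (2 * K / ρ + D) * cmax * a * L := by ring
        _ ≤ _ := by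
          gcongr
          have : 0 < ρ * w := by positivity
          linarith
    · have e1 : t * ρ / (2 * e) / (t / L) - 1 = (L - 2 * e / ρ) / (2 * e / ρ) := by field_simp
      rw [e1, div_le_iff₀ (by positivity)]
      calc _ ≤ (2 * K / ρ + D) * a * a := by
            rw [abs_sub_comm] at hdiff
            exact (le_abs_self _).trans (hdiff.trans_eq (by ring))
        _ ≤ (2 * K / ρ + D) * a * (w * e) := by gcongr
        _ = (2 * K / ρ + D) * (ρ * w) * a * (e / ρ) := by field_simp
        _ ≤ (2 * K / ρ + D) * (cmax + ρ * w) * a * (2 * e / ρ) := by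
          gcongr <;> linarith

/-- The explicit quantity `e = r_* √ε` stands for `α`: its square `2ρε` is the leading term of `α²`,
with error at most `ε²`. -/
theorem exists_calibrated (h₁ : 0 < r₁) (h₂ : 0 < r₂) (hε₀ : 0 < ε₀) :
    ∃ lmax m₁ m₂ : ℝ, ∀ ε, 0 < ε → ε ≤ ε₀ →
      Calibrated (alpha r₁ r₂ ε) (-center₁ r₁ r₂ ε) (center₂ r₁ r₂ ε) (rStar r₁ r₂ ^ 2 / 2)
        (rStar r₁ r₂ * √ε) lmax m₁ m₂ := by
  have hρ : rStar r₁ r₂ ^ 2 / 2 = r₁ * r₂ / (r₁ + r₂) := by rw [rStar_sq h₁ h₂]; ring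
  set ρ := r₁ * r₂ / (r₁ + r₂) with hρd
  have hρ0 : 0 < ρ := by positivity
  set cmax := r₁ + r₂ + ε₀ with hcm
  rw [hρ]
  -- `α² ≤ (2ρ + ε₀) ε = w e²` with `w ≥ 1` gives `α ≤ w e`. The constant `K` arises from `(α - e) α
  -- ≤ α² - e² ≤ ε²` and `ε ≤ α²/(2ρ)`, one spare power of `α` being bounded by `cmax`.
  set w := (2 * ρ + ε₀) / (2 * ρ) with hw
  set K := (1 / (2 * ρ)) ^ 2 * cmax with hK
  refine ⟨_, _, _, fun ε hε hεε => (pencilData_disks h₁ h₂ hε).calibrated (cmax := cmax) (K := K)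
    (w := w) ?_ hρd ?_ ?_ ?_⟩
  · have := center_sub_center h₁ h₂ hε
    have := (pencilData_disks h₁ h₂ hε).symm.c₁_pos
    linarith
  · have : 0 < rStar r₁ r₂ := Real.sqrt_pos.2 (by positivity)
    positivity
  · have hr : 0 < rStar r₁ r₂ := Real.sqrt_pos.2 (by positivity)
    have ha := (pencilData_disks h₁ h₂ hε).a_pos
    have hb := alpha_sq_bounds h₁ h₂ hε
    rw [← hρd] at hb
    have hw1 : 1 ≤ w := by rw [hw, one_le_div (by positivity)]; linarith
    have he : (rStar r₁ r₂ * √ε) ^ 2 = 2 * ρ * ε := by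
      rw [mul_pow, Real.sq_sqrt hε.le, rStar_sq h₁ h₂]
    refine (sq_le_sq₀ ha.le (by positivity)).1 ?_
    rw [mul_pow, he]
    calc _ ≤ 2 * ρ * ε + ε ^ 2 := hb.2
      _ ≤ (2 * ρ + ε₀) * ε := by nlinarith
      _ = w * (2 * ρ * ε) := by rw [hw]; field_simp
      _ ≤ _ := by
        gcongr
        nlinarith
  · have hr : 0 < rStar r₁ r₂ := Real.sqrt_pos.2 (by positivity)
    have hd := pencilData_disks h₁ h₂ hε
    have ha := hd.a_pos
    have hb := alpha_sq_bounds h₁ h₂ hε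
    rw [← hρd] at hb
    have he : (rStar r₁ r₂ * √ε) ^ 2 = 2 * ρ * ε := by
      rw [mul_pow, Real.sq_sqrt hε.le, rStar_sq h₁ h₂]
    have he0 : 0 < rStar r₁ r₂ * √ε := by positivity
    set e := rStar r₁ r₂ * √ε
    set α := alpha r₁ r₂ ε
    have hac : α ≤ cmax := by
      have := center_sub_center h₁ h₂ hε
      have := hd.symm.c₁_pos
      have := hd.a_lt
      linarith
    have hle : e ≤ α := by
      refine (sq_le_sq₀ he0.le ha.le).1 ?_
      rw [he]; exact hb.1
    rw [abs_of_nonneg (by linarith)]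
    have h3 : ε ≤ 1 / (2 * ρ) * α ^ 2 := by
      rw [div_mul_eq_mul_div, one_mul, le_div_iff₀ (by positivity)]
      linarith [hb.1]
    have h4 : (α - e) * α ≤ ε ^ 2 := by nlinarith
    have h5 : ε ^ 2 ≤ (1 / (2 * ρ) * α ^ 2) ^ 2 := by gcongr
    refine le_of_mul_le_mul_right (h4.trans (h5.trans ?_)) ha
    calc _ = (1 / (2 * ρ)) ^ 2 * α ^ 2 * α * α := by ring
      _ ≤ (1 / (2 * ρ)) ^ 2 * α ^ 2 * cmax * α := by gcongr
      _ = _ := by rw [hK]; ring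

end Constants

/-! ### Potentials of line distributions. -/

/-- The complex potential of a continuous distribution of dipoles. -/
noncomputable def linePotential (a c b : ℝ) (z : ℂ) : ℂ :=
  ∫ s in a..c, ((axisRatio a c s ^ b : ℝ) : ℂ) * (1 / (z + s))

section LinePotential

variable {a c b : ℝ} {z : ℂ}

theorem continuousOn_ofReal_axisRatio_rpow (ha : 0 < a) (hb : 0 ≤ b) :
    ContinuousOn (fun s => ((axisRatio a c s ^ b : ℝ) : ℂ)) (Icc a c) :=
  Complex.continuous_ofReal.comp_continuousOn (continuousOn_axisRatio_rpow ha hb)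

theorem continuousOn_inv_pow_of_ne (n : ℕ) (hz : ∀ s ∈ Icc a c, z + (s : ℝ) ≠ 0) :
    ContinuousOn (fun s : ℝ => 1 / (z + s) ^ n) (Icc a c) :=
  ContinuousOn.div continuousOn_const
    ((continuous_const.add Complex.continuous_ofReal).pow n).continuousOn
    fun s hs => pow_ne_zero _ (hz s hs)

/-- Differentiation under the integral. The parameter `2 * a` in `lineField` normalizes its
prefactor `2a/L` to `1`. -/
theorem hasDerivAt_linePotential (ha : 0 < a) (hac : a < c) (hb : 0 ≤ b) {δ : ℝ} (hδ : 0 < δ)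
    (hz : ∀ s ∈ Icc a c, δ ≤ ‖z + (s : ℝ)‖) :
    HasDerivAt (linePotential a c b) (-lineField a c (2 * a) b fun s => 1 / (z + s) ^ 2) z := by
  have hu : uIcc a c = Icc a c := uIcc_of_le hac.le
  have hball : ∀ w ∈ Metric.ball z (δ / 2), ∀ s ∈ Icc a c, δ / 2 ≤ ‖w + (s : ℝ)‖ := by
    intro w hw s hs
    have h1 := hz s hs
    rw [mem_ball_iff_norm, norm_sub_rev] at hw
    have h2 : ‖z + (s : ℝ)‖ ≤ ‖z - w‖ + ‖w + s‖ := by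
      have := norm_add_le (z - w) (w + s)
      rwa [show z - w + (w + s) = z + s by ring] at this
    linarith
  have hne : ∀ w ∈ Metric.ball z (δ / 2), ∀ s ∈ Icc a c, w + (s : ℝ) ≠ 0 := fun w hw s hs =>
    norm_pos_iff.1 (lt_of_lt_of_le (by positivity) (hball w hw s hs))
  have hzz : z ∈ Metric.ball z (δ / 2) := Metric.mem_ball_self (by positivity)
  have cont : ∀ (n : ℕ), ∀ w ∈ Metric.ball z (δ / 2), ContinuousOn
      (fun s : ℝ => ((axisRatio a c s ^ b : ℝ) : ℂ) * (1 / (w + s) ^ n)) (Icc a c) :=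
    fun n w hw => (continuousOn_ofReal_axisRatio_rpow ha hb).mul
      (continuousOn_inv_pow_of_ne n (hne w hw))
  have ii : ∀ (n : ℕ), ∀ w ∈ Metric.ball z (δ / 2), IntervalIntegrable
      (fun s : ℝ => ((axisRatio a c s ^ b : ℝ) : ℂ) * (1 / (w + s) ^ n)) volume a c :=
    fun n w hw => ContinuousOn.intervalIntegrable (by rw [hu]; exact cont n w hw)
  have key := intervalIntegral.hasDerivAt_integral_of_dominated_loc_of_deriv_le
    (μ := volume) (a := a) (b := c) (x₀ := z) (s := Metric.ball z (δ / 2))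
    (F := fun w s => ((axisRatio a c s ^ b : ℝ) : ℂ) * (1 / (w + (s : ℝ)) ^ 1))
    (F' := fun w s => -(((axisRatio a c s ^ b : ℝ) : ℂ) * (1 / (w + (s : ℝ)) ^ 2)))
    (bound := fun _ => 1 / (δ / 2) ^ 2) (Metric.ball_mem_nhds z (by positivity))
    (Filter.eventually_of_mem (Metric.ball_mem_nhds z (by positivity : 0 < δ / 2)) fun w hw =>
      (ii 1 w hw).def'.aestronglyMeasurable) (ii 1 z hzz)
    (ii 2 z hzz).neg.def'.aestronglyMeasurable
    (Eventually.of_forall fun s hs w hw => ?_) intervalIntegrable_const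
    (Eventually.of_forall fun s hs w hw => ?_)
  · have h := key.2
    rw [intervalIntegral.integral_neg] at h
    have e1 : linePotential a c b
        = fun w => ∫ s in a..c, ((axisRatio a c s ^ b : ℝ) : ℂ) * (1 / (w + (s : ℝ)) ^ 1) := by
      funext w; simp [linePotential]
    have e2 : lineField a c (2 * a) b (fun s => 1 / (z + s) ^ 2)
        = ∫ s in a..c, ((axisRatio a c s ^ b : ℝ) : ℂ) * (1 / (z + (s : ℝ)) ^ 2) := by
      simp only [lineField, div_self (by positivity : 2 * a ≠ 0), one_mul]
    rw [e1, e2]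
    exact h
  · rw [uIoc_of_le hac.le] at hs
    have hs' : s ∈ Icc a c := ⟨hs.1.le, hs.2⟩
    have h1 := hball w hw s hs'
    have hy0 := axisRatio_nonneg ha hac hs'.1
    rw [norm_neg, norm_mul, Complex.norm_real, Real.norm_of_nonneg (Real.rpow_nonneg hy0 b),
      norm_div, norm_one, norm_pow]
    refine (mul_le_of_le_one_left (by positivity)
      (Real.rpow_le_one hy0 (axisRatio_le_one ha hac hs'.1 hs'.2) hb)).trans ?_
    gcongr
  · rw [uIoc_of_le hac.le] at hs
    have hs' : s ∈ Icc a c := ⟨hs.1.le, hs.2⟩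
    have h1 := ((hasDerivAt_id w).add_const (s : ℂ)).inv (hne w hw s hs')
    have h2 := h1.const_mul ((axisRatio a c s ^ b : ℝ) : ℂ)
    convert! h2 using 1
    · funext w; simp
    · simp only [id]; ring

theorem hasFDerivAt_log_norm (hz : z ≠ 0) :
    HasFDerivAt (fun z : ℂ => Real.log ‖z‖)
      (Complex.reCLM.comp ((1 / z) • (1 : ℂ →L[ℝ] ℂ))) z := by
  have h0 : ‖z‖ ^ 2 ≠ 0 := pow_ne_zero _ (norm_ne_zero_iff.2 hz)
  have h := ((hasStrictFDerivAt_norm_sq z).hasFDerivAt.log h0).const_mul (1 / 2)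
  have e : (fun z : ℂ => Real.log ‖z‖) = fun z => 1 / 2 * Real.log (‖z‖ ^ 2) := by
    funext w; rw [Real.log_pow]; push_cast; ring
  rw [e]
  convert! h using 1
  ext
  simp [Complex.inv_re, Complex.inv_im, Complex.normSq_eq_norm_sq, Complex.inner]
  field_simp
  ring

theorem hasDerivAt_log_norm_add (s : ℝ) (hz : z + s ≠ 0) :
    HasDerivAt (fun s : ℝ => Real.log ‖z + s‖) (1 / (z + s)).re s := by
  have h1 : HasDerivAt (fun s : ℝ => z + s) 1 s := (Complex.ofRealCLM.hasDerivAt (x := s)).const_add z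
  have h := (hasFDerivAt_log_norm hz).comp_hasDerivAt s h1
  convert! h using 1
  simp

/-- For `0 < b < 1` the density is unbounded at `s = a`. It is integrable as the nonnegative
derivative of a function continuous up to the endpoint. -/
theorem intervalIntegrable_deriv_axisRatio (ha : 0 < a) (hac : a < c) (hb : 0 ≤ b) :
    IntervalIntegrable (fun s => b * (2 * a / (s ^ 2 - a ^ 2)) * axisRatio a c s ^ b)
      volume a c := by
  refine intervalIntegral.intervalIntegrable_deriv_of_nonneg
    (g := fun s => axisRatio a c s ^ b) ?_ (fun s hs => ?_) fun s hs => ?_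
  · rw [uIcc_of_le hac.le]; exact continuousOn_axisRatio_rpow ha hb
  · rw [min_eq_left hac.le] at hs
    exact hasDerivAt_axisRatio_rpow ha hac hs.1
  · rw [min_eq_left hac.le] at hs
    have h1 := Real.rpow_nonneg (axisRatio_nonneg ha hac hs.1.le) b
    have h2 : 0 < s ^ 2 - a ^ 2 := by nlinarith [hs.1]
    positivity

/-- Integration by parts: a distribution of charges with density the derivative of `axisRatio ^ b`
is a point charge and a distribution of dipoles. -/
theorem integral_log_mul (ha : 0 < a) (hac : a < c) (hb : 0 < b)
    (hz : ∀ s ∈ Icc a c, z + (s : ℝ) ≠ 0) :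
    ∫ s in a..c, Real.log ‖z + (s : ℝ)‖ * (b * (2 * a / (s ^ 2 - a ^ 2)) * axisRatio a c s ^ b)
      = Real.log ‖z + c‖ - (linePotential a c b z).re := by
  have hu : uIcc a c = Icc a c := uIcc_of_le hac.le
  have hd : ∀ s ∈ Icc a c, HasDerivAt (fun s : ℝ => Real.log ‖z + s‖) (1 / (z + s)).re s :=
    fun s hs => hasDerivAt_log_norm_add s (hz s hs)
  have c1 : ContinuousOn (fun s : ℝ => (1 / (z + s)).re) (Icc a c) := by
    have := continuousOn_inv_pow_of_ne 1 hz
    simp only [pow_one] at this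
    exact Complex.continuous_re.comp_continuousOn this
  have h := intervalIntegral.integral_mul_deriv_eq_deriv_mul_of_hasDeriv_right
    (u := fun s : ℝ => Real.log ‖z + s‖) (u' := fun s => (1 / (z + s)).re)
    (v := fun s => axisRatio a c s ^ b)
    (v' := fun s => b * (2 * a / (s ^ 2 - a ^ 2)) * axisRatio a c s ^ b)
    (a := a) (b := c)
    (by rw [hu]; exact fun s hs => (hd s hs).continuousAt.continuousWithinAt)
    (by rw [hu]; exact continuousOn_axisRatio_rpow ha hb.le)
    (fun s hs => by
      rw [min_eq_left hac.le, max_eq_right hac.le] at hs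
      exact (hd s ⟨hs.1.le, hs.2.le⟩).hasDerivWithinAt)
    (fun s hs => by
      rw [min_eq_left hac.le] at hs
      exact (hasDerivAt_axisRatio_rpow ha hac hs.1).hasDerivWithinAt)
    (ContinuousOn.intervalIntegrable (by rw [hu]; exact c1))
    (intervalIntegrable_deriv_axisRatio ha hac hb.le)
  -- The boundary term vanishes at the limit point, where `axisRatio` is `0` and `b > 0`, and leaves
  -- a unit point charge at the center.
  rw [h, axisRatio_left, Real.zero_rpow hb.ne', axisRatio_right ha hac, Real.one_rpow, mul_one,
    mul_zero, sub_zero]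
  congr 1
  have hI : IntervalIntegrable (fun s : ℝ => ((axisRatio a c s ^ b : ℝ) : ℂ) * (1 / (z + s)))
      volume a c := by
    refine ContinuousOn.intervalIntegrable ?_
    rw [hu]
    have := continuousOn_inv_pow_of_ne 1 hz
    simp only [pow_one] at this
    exact (continuousOn_ofReal_axisRatio_rpow ha hb.le).mul this
  have h2 := Complex.reCLM.intervalIntegral_comp_comm hI
  simp only [Complex.reCLM_apply] at h2
  rw [linePotential, ← h2]
  refine intervalIntegral.integral_congr fun s _ => ?_
  simp only [Complex.re_ofReal_mul]
  ring

theorem integral_im_mul (ha : 0 < a) (hac : a < c) (hb : 0 < b)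
    (hz : ∀ s ∈ Icc a c, z + (s : ℝ) ≠ 0) :
    ∫ s in a..c, (z + (s : ℝ)).im / ‖z + (s : ℝ)‖ ^ 2 * axisRatio a c s ^ b
      = -(linePotential a c b z).im := by
  have hu : uIcc a c = Icc a c := uIcc_of_le hac.le
  have hI : IntervalIntegrable (fun s : ℝ => ((axisRatio a c s ^ b : ℝ) : ℂ) * (1 / (z + s)))
      volume a c := by
    refine ContinuousOn.intervalIntegrable ?_
    rw [hu]
    have := continuousOn_inv_pow_of_ne 1 hz
    simp only [pow_one] at this
    exact (continuousOn_ofReal_axisRatio_rpow ha hb.le).mul this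
  have h2 := Complex.imCLM.intervalIntegral_comp_comm hI
  simp only [Complex.imCLM_apply] at h2
  rw [linePotential, ← h2, ← intervalIntegral.integral_neg]
  refine intervalIntegral.integral_congr fun s _ => ?_
  simp only [Complex.im_ofReal_mul, one_div, Complex.inv_im, Complex.normSq_eq_norm_sq]
  ring

end LinePotential

namespace PencilData

variable {a r₁ r₂ c₁ c₂ : ℝ}

/-- `log (pencilMod a c₁)` is minus twice `log ((c₁ + a)/r₁)`, so the exponential is the normalizing
factor `(pencilMod a c₁) ^ (-b)`. -/
theorem exp_mul_rpow (h : PencilData a r₁ r₂ c₁ c₂) (b : ℝ) {s : ℝ} (hs : a ≤ s) :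
    Real.exp (2 * b * (Real.log (|c₁| + a) - Real.log r₁)) * ((s - a) / (s + a)) ^ b
      = axisRatio a c₁ s ^ b := by
  have ha := h.a_pos
  have hc := h.c₁_pos
  have hμ := h.mod_pos
  rw [axisRatio, Real.div_rpow (div_nonneg (by linarith) (by linarith)) hμ.le,
    div_eq_mul_inv (_ ^ b), ← Real.rpow_neg hμ.le, Real.rpow_def_of_pos hμ, h.log_mod, abs_of_pos hc,
    ← Real.log_div (by positivity) h.r₁_pos.ne', mul_comm]
  congr 2
  ring

theorem exp_mul_rpow_div (h : PencilData a r₁ r₂ c₁ c₂) (b : ℝ) {s : ℝ} (hs : a < s) :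
    2 * a * b * Real.exp (2 * b * (Real.log (|c₁| + a) - Real.log r₁))
        * ((s - a) ^ (b - 1) / (s + a) ^ (b + 1))
      = b * (2 * a / (s ^ 2 - a ^ 2)) * axisRatio a c₁ s ^ b := by
  have ha := h.a_pos
  have h1 : 0 < s - a := by linarith
  have h2 : 0 < s + a := by linarith
  rw [← h.exp_mul_rpow b hs.le, Real.rpow_sub_one h1.ne', Real.rpow_add_one h2.ne',
    Real.div_rpow h1.le h2.le, show s ^ 2 - a ^ 2 = (s - a) * (s + a) by ring]
  field_simp

end PencilData

/-! ### The densities of the theorem in terms of `axisRatio`. -/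

section Charges

variable {r₁ r₂ ε k₁ k₂ : ℝ}

theorem integral_Icc_eq_interval {a c : ℝ} (hac : a ≤ c) (f : ℝ → ℝ) :
    ∫ s in Icc a c, f s = ∫ s in a..c, f s := by
  rw [integral_Icc_eq_integral_Ioc, intervalIntegral.integral_of_le hac]

theorem integral_Icc_neg_eq_interval {a c : ℝ} (hac : a ≤ c) (f : ℝ → ℝ) :
    ∫ s in Icc (-c) (-a), f s = ∫ s in a..c, f (-s) := by
  rw [integral_Icc_eq_interval (by linarith), intervalIntegral.integral_comp_neg]

theorem integrableOn_Icc_of_eqOn {a c : ℝ} (hac : a ≤ c) {f g : ℝ → ℝ}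
    (hg : IntervalIntegrable g volume a c) (hfg : ∀ s, a < s → s ≤ c → f s = g s) :
    IntegrableOn f (Icc a c) := by
  rw [integrableOn_Icc_iff_integrableOn_Ioc]
  exact ((intervalIntegrable_iff_integrableOn_Ioc_of_le hac).1 hg).congr_fun
    (fun s hs => (hfg s hs.1 hs.2).symm) measurableSet_Ioc

theorem integrableOn_Icc_neg_of_eqOn {a c : ℝ} (hac : a ≤ c) {f g : ℝ → ℝ}
    (hg : IntervalIntegrable g volume a c) (hfg : ∀ s, a < s → s ≤ c → f (-s) = g s) :
    IntegrableOn f (Icc (-c) (-a)) := by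
  have h := (integrableOn_Icc_of_eqOn hac (f := fun s => f (-s)) hg hfg).comp_neg
  simpa using h

/-- Apart from the charge factor, the mirrored density is the derivative of `axisRatio ^ β`, as
required by `integral_log_mul`. The inequality is strict because the formulas for the derivative and
for `φ₁` can disagree at the limit point. -/
theorem phi₁_neg (h₁ : 0 < r₁) (h₂ : 0 < r₂) (hε : 0 < ε) {s : ℝ} (hs : alpha r₁ r₂ ε < s) :
    phi₁ r₁ r₂ ε k₁ k₂ (-s) = (tau k₁ k₂ + contrast k₁)
      * (beta r₁ r₂ ε k₁ k₂ * (2 * alpha r₁ r₂ ε / (s ^ 2 - alpha r₁ r₂ ε ^ 2))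
        * axisRatio (alpha r₁ r₂ ε) (-center₁ r₁ r₂ ε) s ^ beta r₁ r₂ ε k₁ k₂) := by
  have hd := pencilData_disks h₁ h₂ hε
  have ha := hd.a_pos
  rw [← hd.exp_mul_rpow_div _ hs, phi₁, abs_neg, xi₁,
    show |-s + alpha r₁ r₂ ε| = s - alpha r₁ r₂ ε by rw [abs_of_neg (by linarith)]; ring,
    show |-s - alpha r₁ r₂ ε| = s + alpha r₁ r₂ ε by rw [abs_of_neg (by linarith)]; ring]
  ring

theorem phi₂_eq (h₁ : 0 < r₁) (h₂ : 0 < r₂) (hε : 0 < ε) {s : ℝ} (hs : alpha r₁ r₂ ε < s) :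
    phi₂ r₁ r₂ ε k₁ k₂ s = (tau k₁ k₂ + contrast k₂)
      * (beta r₁ r₂ ε k₁ k₂ * (2 * alpha r₁ r₂ ε / (s ^ 2 - alpha r₁ r₂ ε ^ 2))
        * axisRatio (alpha r₁ r₂ ε) (center₂ r₁ r₂ ε) s ^ beta r₁ r₂ ε k₁ k₂) := by
  have hd := (pencilData_disks h₁ h₂ hε).symm
  rw [← hd.exp_mul_rpow_div _ hs, phi₂, xi₂]
  ring

theorem psi₁_neg (h₁ : 0 < r₁) (h₂ : 0 < r₂) (hε : 0 < ε) {s : ℝ} (hs : alpha r₁ r₂ ε ≤ s) :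
    psi₁ r₁ r₂ ε k₁ k₂ (-s) = (tau k₁ k₂ - contrast k₁)
      * axisRatio (alpha r₁ r₂ ε) (-center₁ r₁ r₂ ε) s ^ beta r₁ r₂ ε k₁ k₂ := by
  have hd := pencilData_disks h₁ h₂ hε
  rw [← hd.exp_mul_rpow _ hs, psi₁, abs_neg, xi₁,
    show (-s + alpha r₁ r₂ ε) / (-s - alpha r₁ r₂ ε)
      = (s - alpha r₁ r₂ ε) / (s + alpha r₁ r₂ ε) by rw [← neg_div_neg_eq]; ring_nf]
  ring

theorem psi₂_eq (h₁ : 0 < r₁) (h₂ : 0 < r₂) (hε : 0 < ε) {s : ℝ} (hs : alpha r₁ r₂ ε ≤ s) :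
    psi₂ r₁ r₂ ε k₁ k₂ s = (tau k₁ k₂ - contrast k₂)
      * axisRatio (alpha r₁ r₂ ε) (center₂ r₁ r₂ ε) s ^ beta r₁ r₂ ε k₁ k₂ := by
  have hd := (pencilData_disks h₁ h₂ hε).symm
  rw [← hd.exp_mul_rpow _ hs, psi₂, xi₂]
  ring

theorem intervalIntegrable_axisRatio {a c b : ℝ} (ha : 0 < a) (hac : a < c) (hb : 0 ≤ b) :
    IntervalIntegrable (fun s => axisRatio a c s ^ b) volume a c :=
  ContinuousOn.intervalIntegrable (by
    rw [uIcc_of_le hac.le]; exact continuousOn_axisRatio_rpow ha hb)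

theorem integrableOn_phi (h₁ : 0 < r₁) (h₂ : 0 < r₂) (hε : 0 < ε)
    (hb : 0 ≤ beta r₁ r₂ ε k₁ k₂) :
    IntegrableOn (phi₁ r₁ r₂ ε k₁ k₂) (Icc (center₁ r₁ r₂ ε) (-alpha r₁ r₂ ε)) ∧
      IntegrableOn (phi₂ r₁ r₂ ε k₁ k₂) (Icc (alpha r₁ r₂ ε) (center₂ r₁ r₂ ε)) := by
  have hd := pencilData_disks h₁ h₂ hε
  refine ⟨?_, integrableOn_Icc_of_eqOn hd.symm.a_lt.le
    ((intervalIntegrable_deriv_axisRatio hd.a_pos hd.symm.a_lt hb).const_mul _)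
    fun s hs _ => phi₂_eq h₁ h₂ hε hs⟩
  rw [← neg_neg (center₁ r₁ r₂ ε)]
  exact integrableOn_Icc_neg_of_eqOn hd.a_lt.le
    ((intervalIntegrable_deriv_axisRatio hd.a_pos hd.a_lt hb).const_mul _)
    fun s hs _ => phi₁_neg h₁ h₂ hε hs

theorem integrableOn_psi (h₁ : 0 < r₁) (h₂ : 0 < r₂) (hε : 0 < ε)
    (hb : 0 ≤ beta r₁ r₂ ε k₁ k₂) :
    IntegrableOn (psi₁ r₁ r₂ ε k₁ k₂) (Icc (center₁ r₁ r₂ ε) (-alpha r₁ r₂ ε)) ∧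
      IntegrableOn (psi₂ r₁ r₂ ε k₁ k₂) (Icc (alpha r₁ r₂ ε) (center₂ r₁ r₂ ε)) := by
  have hd := pencilData_disks h₁ h₂ hε
  refine ⟨?_, integrableOn_Icc_of_eqOn hd.symm.a_lt.le
    ((intervalIntegrable_axisRatio hd.a_pos hd.symm.a_lt hb).const_mul _)
    fun s hs _ => psi₂_eq h₁ h₂ hε hs.le⟩
  rw [← neg_neg (center₁ r₁ r₂ ε)]
  exact integrableOn_Icc_neg_of_eqOn hd.a_lt.le
    ((intervalIntegrable_axisRatio hd.a_pos hd.a_lt hb).const_mul _)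
    fun s hs _ => psi₁_neg h₁ h₂ hε hs.le

theorem intervalIntegral_congr_mul {a c q : ℝ} (hac : a ≤ c) {w f g : ℝ → ℝ}
    (hfg : ∀ s, a < s → s ≤ c → f s = q * g s) :
    ∫ s in a..c, w s * f s = q * ∫ s in a..c, w s * g s := by
  rw [← intervalIntegral.integral_const_mul]
  refine intervalIntegral.integral_congr_ae (Eventually.of_forall fun s hs => ?_)
  rw [uIoc_of_le hac] at hs
  rw [hfg s hs.1 hs.2]
  ring

theorem logCharge_phi₁ (h₁ : 0 < r₁) (h₂ : 0 < r₂) (hε : 0 < ε)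
    (hb : 0 < beta r₁ r₂ ε k₁ k₂) {z : ℂ}
    (hz : ∀ s ∈ Icc (alpha r₁ r₂ ε) (-center₁ r₁ r₂ ε), z + (s : ℝ) ≠ 0) :
    logCharge (center₁ r₁ r₂ ε) (-alpha r₁ r₂ ε) (phi₁ r₁ r₂ ε k₁ k₂) z
      = (tau k₁ k₂ + contrast k₁) * (Real.log ‖z + (-center₁ r₁ r₂ ε : ℝ)‖
        - (linePotential (alpha r₁ r₂ ε) (-center₁ r₁ r₂ ε) (beta r₁ r₂ ε k₁ k₂) z).re) := by
  have hd := pencilData_disks h₁ h₂ hε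
  rw [logCharge, ← neg_neg (center₁ r₁ r₂ ε), integral_Icc_neg_eq_interval hd.a_lt.le, neg_neg,
    ← integral_log_mul hd.a_pos hd.a_lt hb hz]
  simp only [Complex.ofReal_neg, sub_neg_eq_add]
  exact intervalIntegral_congr_mul (f := fun s => phi₁ r₁ r₂ ε k₁ k₂ (-s)) hd.a_lt.le
    fun s hs _ => phi₁_neg h₁ h₂ hε hs

theorem logCharge_phi₂ (h₁ : 0 < r₁) (h₂ : 0 < r₂) (hε : 0 < ε)
    (hb : 0 < beta r₁ r₂ ε k₁ k₂) {z : ℂ}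
    (hz : ∀ s ∈ Icc (alpha r₁ r₂ ε) (center₂ r₁ r₂ ε), -z + (s : ℝ) ≠ 0) :
    logCharge (alpha r₁ r₂ ε) (center₂ r₁ r₂ ε) (phi₂ r₁ r₂ ε k₁ k₂) z
      = (tau k₁ k₂ + contrast k₂) * (Real.log ‖-z + (center₂ r₁ r₂ ε : ℝ)‖
        - (linePotential (alpha r₁ r₂ ε) (center₂ r₁ r₂ ε) (beta r₁ r₂ ε k₁ k₂) (-z)).re) := by
  have hd := (pencilData_disks h₁ h₂ hε).symm
  rw [logCharge, integral_Icc_eq_interval hd.a_lt.le, ← integral_log_mul hd.a_pos hd.a_lt hb hz,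
    ← intervalIntegral_congr_mul (f := phi₂ r₁ r₂ ε k₁ k₂) hd.a_lt.le
      fun s hs _ => phi₂_eq h₁ h₂ hε hs]
  refine intervalIntegral.integral_congr fun s _ => ?_
  simp only [neg_add_eq_sub, norm_sub_rev]

theorem dipoleCharge_psi₁ (h₁ : 0 < r₁) (h₂ : 0 < r₂) (hε : 0 < ε)
    (hb : 0 < beta r₁ r₂ ε k₁ k₂) {z : ℂ}
    (hz : ∀ s ∈ Icc (alpha r₁ r₂ ε) (-center₁ r₁ r₂ ε), z + (s : ℝ) ≠ 0) :
    dipoleCharge (center₁ r₁ r₂ ε) (-alpha r₁ r₂ ε) (psi₁ r₁ r₂ ε k₁ k₂) z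
      = (tau k₁ k₂ - contrast k₁) *
        -(linePotential (alpha r₁ r₂ ε) (-center₁ r₁ r₂ ε) (beta r₁ r₂ ε k₁ k₂) z).im := by
  have hd := pencilData_disks h₁ h₂ hε
  rw [dipoleCharge, ← neg_neg (center₁ r₁ r₂ ε), integral_Icc_neg_eq_interval hd.a_lt.le, neg_neg,
    ← integral_im_mul hd.a_pos hd.a_lt hb hz]
  simp only [Complex.ofReal_neg, sub_neg_eq_add]
  exact intervalIntegral_congr_mul (f := fun s => psi₁ r₁ r₂ ε k₁ k₂ (-s)) hd.a_lt.le
    fun s hs _ => psi₁_neg h₁ h₂ hε hs.le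

theorem dipoleCharge_psi₂ (h₁ : 0 < r₁) (h₂ : 0 < r₂) (hε : 0 < ε)
    (hb : 0 < beta r₁ r₂ ε k₁ k₂) {z : ℂ}
    (hz : ∀ s ∈ Icc (alpha r₁ r₂ ε) (center₂ r₁ r₂ ε), -z + (s : ℝ) ≠ 0) :
    dipoleCharge (alpha r₁ r₂ ε) (center₂ r₁ r₂ ε) (psi₂ r₁ r₂ ε k₁ k₂) z
      = (tau k₁ k₂ - contrast k₂) *
        (linePotential (alpha r₁ r₂ ε) (center₂ r₁ r₂ ε) (beta r₁ r₂ ε k₁ k₂) (-z)).im := by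
  have hd := (pencilData_disks h₁ h₂ hε).symm
  have h := integral_im_mul hd.a_pos hd.a_lt hb hz
  rw [dipoleCharge, integral_Icc_eq_interval hd.a_lt.le, ← neg_eq_iff_eq_neg.2 h,
    ← intervalIntegral.integral_neg,
    intervalIntegral_congr_mul (f := psi₂ r₁ r₂ ε k₁ k₂) hd.a_lt.le
      fun s hs _ => psi₂_eq h₁ h₂ hε hs.le]
  congr 1
  refine intervalIntegral.integral_congr fun s _ => ?_
  simp only [neg_add_eq_sub, norm_sub_rev z, ← neg_mul, ← neg_div, ← Complex.neg_im, neg_sub]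

end Charges

/-! ### Uniform constants and the solution in terms of the image fields. -/

/-- Data which bound the gradient of the images uniformly in the gap. -/
structure UniformBounds (r₁ r₂ ε₀ κ cmax A B : ℝ) (F : ℂ → ℂ) : Prop where
  r₁_pos : 0 < r₁
  r₂_pos : 0 < r₂
  κ_pos : 0 < κ
  κ_le₁ : κ ≤ gapConst r₁ cmax
  κ_le₂ : κ ≤ gapConst r₂ cmax
  cmax_eq : cmax = r₁ + r₂ + ε₀
  two_cmax_le : 2 * cmax ≤ cmax / κ
  diff : Differentiable ℂ F
  bound : ∀ w, ‖w‖ ≤ cmax / κ → ‖deriv F w‖ ≤ A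
  bound' : ∀ w, ‖w‖ ≤ cmax / κ → ‖deriv (deriv F) w‖ ≤ B

theorem exists_uniformBounds {r₁ r₂ ε₀ : ℝ} (h₁ : 0 < r₁) (h₂ : 0 < r₂) (hε₀ : 0 < ε₀)
    {F : ℂ → ℂ} (hF : Differentiable ℂ F) :
    ∃ κ cmax A B, UniformBounds r₁ r₂ ε₀ κ cmax A B F := by
  have hc : 0 < r₁ + r₂ + ε₀ := by positivity
  have g₁ := gapConst_pos h₁ hc.le
  have g₂ := gapConst_pos h₂ hc.le
  set κ := min (gapConst r₁ (r₁ + r₂ + ε₀)) (gapConst r₂ (r₁ + r₂ + ε₀))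
  have hκ : 0 < κ := lt_min g₁ g₂
  have hF1 : Differentiable ℂ (deriv F) := fun w => (hF.analyticAt w).deriv.differentiableAt
  have hF2 : Differentiable ℂ (deriv (deriv F)) := fun w =>
    (hF1.analyticAt w).deriv.differentiableAt
  obtain ⟨A, hA⟩ := (isCompact_closedBall (0 : ℂ) ((r₁ + r₂ + ε₀) / κ)).exists_bound_of_continuousOn
    hF1.continuous.continuousOn
  obtain ⟨B, hB⟩ := (isCompact_closedBall (0 : ℂ) ((r₁ + r₂ + ε₀) / κ)).exists_bound_of_continuousOn
    hF2.continuous.continuousOn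
  refine ⟨κ, _, A, B, h₁, h₂, hκ, min_le_left _ _, min_le_right _ _, rfl, ?_, hF,
    fun w hw => hA w (by simpa using hw), fun w hw => hB w (by simpa using hw)⟩
  rw [le_div_iff₀ hκ]
  -- This makes the ball on which `F'` is bounded large enough to contain both disks, where the
  -- inner gradient involves `F'` itself.
  have h3 : κ ≤ 1 / 2 := by
    refine (min_le_left _ _).trans ?_
    rw [gapConst, div_le_div_iff₀ (by positivity) (by norm_num)]
    linarith
  nlinarith

theorem PencilData.fieldBounds {a r₁ r₂ c₁ c₂ κ cmax A B : ℝ} (h : PencilData a r₁ r₂ c₁ c₂)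
    (hκ : 0 < κ) (hκr : κ ≤ gapConst r₁ cmax) (hc : c₁ ≤ cmax) {E : ℂ → ℂ}
    (hE : Differentiable ℂ E) (hA : ∀ w, ‖w‖ ≤ cmax / κ → ‖E w‖ ≤ A)
    (hB : ∀ w, ‖w‖ ≤ cmax / κ → ‖deriv E w‖ ≤ B) {z : ℂ} (hz : r₁ ≤ ‖z + c₁‖) :
    FieldBounds a c₁ κ cmax A B E z := by
  refine ⟨h.a_pos, h.a_lt, hκ, hc, hE, hA, hB, fun s hs hsc => ?_⟩
  refine le_trans ?_ (h.norm_add_ge (h.a_lt.le.trans hc) hz hs hsc)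
  have := h.a_pos
  have := norm_nonneg z
  gcongr
  linarith

theorem deriv_fun_comp_neg (F : ℂ → ℂ) :
    deriv (fun w => F (-w)) = fun w => -deriv F (-w) :=
  funext (deriv_comp_neg F)

namespace UniformBounds

variable {r₁ r₂ ε₀ κ cmax A B ε : ℝ} {F : ℂ → ℂ} {z : ℂ}

theorem differentiable_deriv (h : UniformBounds r₁ r₂ ε₀ κ cmax A B F) :
    Differentiable ℂ (deriv F) := fun w => (h.diff.analyticAt w).deriv.differentiableAt

theorem center_le (h : UniformBounds r₁ r₂ ε₀ κ cmax A B F) (hε : 0 < ε) (hεε : ε ≤ ε₀) :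
    -center₁ r₁ r₂ ε ≤ cmax ∧ center₂ r₁ r₂ ε ≤ cmax := by
  have hd := pencilData_disks h.r₁_pos h.r₂_pos hε
  have h1 := center_sub_center h.r₁_pos h.r₂_pos hε
  have h2 := hd.c₁_pos
  have h3 := hd.c₂_pos
  have h4 := h.cmax_eq
  constructor <;> linarith

theorem fieldBounds_left (h : UniformBounds r₁ r₂ ε₀ κ cmax A B F) (hε : 0 < ε) (hεε : ε ≤ ε₀)
    (hz : r₁ ≤ ‖z + (-center₁ r₁ r₂ ε : ℝ)‖) :
    FieldBounds (alpha r₁ r₂ ε) (-center₁ r₁ r₂ ε) κ cmax A B (deriv F) z :=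
  (pencilData_disks h.r₁_pos h.r₂_pos hε).fieldBounds h.κ_pos h.κ_le₁ (h.center_le hε hεε).1
    h.differentiable_deriv h.bound h.bound' hz

theorem fieldBounds_right (h : UniformBounds r₁ r₂ ε₀ κ cmax A B F) (hε : 0 < ε) (hεε : ε ≤ ε₀)
    (hz : r₂ ≤ ‖z + (center₂ r₁ r₂ ε : ℝ)‖) :
    FieldBounds (alpha r₁ r₂ ε) (center₂ r₁ r₂ ε) κ cmax A B (deriv fun w => F (-w)) z := by
  rw [deriv_fun_comp_neg]
  exact ((pencilData_disks h.r₁_pos h.r₂_pos hε).symm.fieldBounds h.κ_pos h.κ_le₂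
    (h.center_le hε hεε).2 h.differentiable_deriv h.bound h.bound' hz).neg_comp_neg

theorem A_nonneg (h : UniformBounds r₁ r₂ ε₀ κ cmax A B F) (hε₀ : 0 < ε₀) : 0 ≤ A := by
  refine (norm_nonneg _).trans (h.bound 0 ?_)
  have := h.r₁_pos
  have := h.r₂_pos
  have := h.cmax_eq
  have := h.two_cmax_le
  rw [norm_zero]
  linarith

end UniformBounds

/-- The complex potential with sources in the left disk. -/
noncomputable def leftField (r₁ r₂ ε k₁ k₂ : ℝ) (F : ℂ → ℂ) : ℂ → ℂ :=
  imageField (alpha r₁ r₂ ε) (-center₁ r₁ r₂ ε) (center₂ r₁ r₂ ε) (contrast k₁) (contrast k₂) F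

/-- The complex potential with sources in the right disk, reflected to the left. -/
noncomputable def rightField (r₁ r₂ ε k₁ k₂ : ℝ) (F : ℂ → ℂ) : ℂ → ℂ :=
  imageField (alpha r₁ r₂ ε) (center₂ r₁ r₂ ε) (-center₁ r₁ r₂ ε) (contrast k₂) (contrast k₁)
    fun w => F (-w)

section Solution

variable {r₁ r₂ ε k₁ k₂ : ℝ} {F : ℂ → ℂ} {H u : ℂ → ℝ} {z : ℂ}

theorem norm_sub_center₁ (z : ℂ) : ‖z + (-center₁ r₁ r₂ ε : ℝ)‖ = ‖z - center₁ r₁ r₂ ε‖ := by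
  rw [Complex.ofReal_neg, ← sub_eq_add_neg]

theorem norm_sub_center₂ (z : ℂ) : ‖-z + (center₂ r₁ r₂ ε : ℝ)‖ = ‖z - center₂ r₁ r₂ ε‖ := by
  rw [neg_add_eq_sub, norm_sub_rev]

theorem diskPotential_left (h₁ : 0 < r₁) (h₂ : 0 < r₂) (hε : 0 < ε) (hk₁ : 0 < k₁) (hk₂ : 0 < k₂)
    (hF : Differentiable ℂ F) (hz : r₁ ≤ ‖z - center₁ r₁ r₂ ε‖) :
    diskPotential (contrast k₁) (fun z => F z + rightField r₁ r₂ ε k₁ k₂ F (-z))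
      (center₁ r₁ r₂ ε) r₁ z = leftField r₁ r₂ ε k₁ k₂ F z := by
  have h := (pencilData_disks h₁ h₂ hε).diskPotential_eq_imageField
    (abs_contrast_mul_lt_one hk₁ hk₂) hF (z := z) (by rwa [norm_sub_center₁])
  rw [Complex.ofReal_neg, neg_neg] at h
  exact h

theorem diskPotential_right (h₁ : 0 < r₁) (h₂ : 0 < r₂) (hε : 0 < ε) (hk₁ : 0 < k₁)
    (hk₂ : 0 < k₂) (hF : Differentiable ℂ F) (hz : r₂ ≤ ‖z - center₂ r₁ r₂ ε‖) :
    diskPotential (contrast k₂) (fun z => F z + leftField r₁ r₂ ε k₁ k₂ F z)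
      (center₂ r₁ r₂ ε) r₂ z = rightField r₁ r₂ ε k₁ k₂ F (-z) :=
  (pencilData_disks h₁ h₂ hε).diskPotential_eq_imageField_neg
    (abs_contrast_mul_lt_one hk₁ hk₂) hF hz

theorem TwoDisks.IsSolution.eq_fields (h₁ : 0 < r₁) (h₂ : 0 < r₂) (hε : 0 < ε) (hk₁ : 0 < k₁)
    (hk₂ : 0 < k₂) (hF : Differentiable ℂ F) (hFH : ∀ z, (F z).re = H z)
    (hu : IsSolution (conductivity r₁ r₂ ε k₁ k₂) H u) (hz₁ : r₁ ≤ ‖z - center₁ r₁ r₂ ε‖)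
    (hz₂ : r₂ ≤ ‖z - center₂ r₁ r₂ ε‖) :
    u z - H z = (leftField r₁ r₂ ε k₁ k₂ F z + rightField r₁ r₂ ε k₁ k₂ F (-z)).re := by
  rw [IsSolution.eq_diskPotential h₁ h₂ hε hk₁ hk₂ hF hFH hu z, add_sub_cancel_left,
    ← diskPotential_left h₁ h₂ hε hk₁ hk₂ hF hz₁, ← diskPotential_right h₁ h₂ hε hk₁ hk₂ hF hz₂]
  rfl

/-- Inside the disk the retraction is the identity, and taking the real part removes the
conjugation. What remains is the real part of a holomorphic function involving only the series of
the other disk. -/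
theorem TwoDisks.IsSolution.eq_left (h₁ : 0 < r₁) (h₂ : 0 < r₂) (hε : 0 < ε) (hk₁ : 0 < k₁)
    (hk₂ : 0 < k₂) (hF : Differentiable ℂ F) (hFH : ∀ z, (F z).re = H z)
    (hu : IsSolution (conductivity r₁ r₂ ε k₁ k₂) H u) (hz₁ : ‖z - center₁ r₁ r₂ ε‖ ≤ r₁)
    (hz₂ : r₂ ≤ ‖z - center₂ r₁ r₂ ε‖) :
    u z - H z = (-contrast k₁ * (F z + rightField r₁ r₂ ε k₁ k₂ F (-z)
      - (F (center₁ r₁ r₂ ε) + rightField r₁ r₂ ε k₁ k₂ F (-center₁ r₁ r₂ ε)))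
      + rightField r₁ r₂ ε k₁ k₂ F (-z)).re := by
  have h : u z = H z + (diskPotential (contrast k₁) (fun z => F z
      + rightField r₁ r₂ ε k₁ k₂ F (-z)) (center₁ r₁ r₂ ε) r₁ z +
      diskPotential (contrast k₂) (fun z => F z + leftField r₁ r₂ ε k₁ k₂ F z)
        (center₂ r₁ r₂ ε) r₂ z).re :=
    IsSolution.eq_diskPotential h₁ h₂ hε hk₁ hk₂ hF hFH hu z
  rw [h, add_sub_cancel_left, diskPotential_right h₁ h₂ hε hk₁ hk₂ hF hz₂, diskPotential,
    diskRetract_of_le (by rwa [dist_eq_norm])]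
  simp

theorem TwoDisks.IsSolution.eq_right (h₁ : 0 < r₁) (h₂ : 0 < r₂) (hε : 0 < ε) (hk₁ : 0 < k₁)
    (hk₂ : 0 < k₂) (hF : Differentiable ℂ F) (hFH : ∀ z, (F z).re = H z)
    (hu : IsSolution (conductivity r₁ r₂ ε k₁ k₂) H u) (hz₁ : r₁ ≤ ‖z - center₁ r₁ r₂ ε‖)
    (hz₂ : ‖z - center₂ r₁ r₂ ε‖ ≤ r₂) :
    u z - H z = (-contrast k₂ * (F z + leftField r₁ r₂ ε k₁ k₂ F z
      - (F (center₂ r₁ r₂ ε) + leftField r₁ r₂ ε k₁ k₂ F (center₂ r₁ r₂ ε)))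
      + leftField r₁ r₂ ε k₁ k₂ F z).re := by
  have h : u z = H z + (diskPotential (contrast k₁) (fun z => F z
      + rightField r₁ r₂ ε k₁ k₂ F (-z)) (center₁ r₁ r₂ ε) r₁ z +
      diskPotential (contrast k₂) (fun z => F z + leftField r₁ r₂ ε k₁ k₂ F z)
        (center₂ r₁ r₂ ε) r₂ z).re :=
    IsSolution.eq_diskPotential h₁ h₂ hε hk₁ hk₂ hF hFH hu z
  rw [h, add_sub_cancel_left, diskPotential_left h₁ h₂ hε hk₁ hk₂ hF hz₁, diskPotential,
    diskRetract_of_le (by rwa [dist_eq_norm])]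
  simp
  ring

theorem hasDerivAt_leftField (h₁ : 0 < r₁) (h₂ : 0 < r₂) (hε : 0 < ε) (hk₁ : 0 < k₁)
    (hk₂ : 0 < k₂) (hF : Differentiable ℂ F) (hz : r₁ ≤ ‖z - center₁ r₁ r₂ ε‖) :
    HasDerivAt (leftField r₁ r₂ ε k₁ k₂ F) (deriv (leftField r₁ r₂ ε k₁ k₂ F) z) z := by
  have hd := pencilData_disks h₁ h₂ hε
  have hm := hd.mem_extNhd (z := z) (by rwa [norm_sub_center₁])
  exact ((hd.differentiableOn_imageField (abs_contrast_mul_lt_one hk₁ hk₂) hF).differentiableAt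
    ((isOpen_extNhd _ _ _).mem_nhds hm)).hasDerivAt

theorem hasDerivAt_rightField_neg (h₁ : 0 < r₁) (h₂ : 0 < r₂) (hε : 0 < ε) (hk₁ : 0 < k₁)
    (hk₂ : 0 < k₂) (hF : Differentiable ℂ F) (hz : r₂ ≤ ‖z - center₂ r₁ r₂ ε‖) :
    HasDerivAt (fun z => rightField r₁ r₂ ε k₁ k₂ F (-z))
      (-deriv (rightField r₁ r₂ ε k₁ k₂ F) (-z)) z := by
  have hd := (pencilData_disks h₁ h₂ hε).symm
  have hm := hd.mem_extNhd (z := -z) (by rwa [norm_sub_center₂])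
  have h := ((hd.differentiableOn_imageField (abs_contrast_mul_lt_one hk₂ hk₁)
    (hF.comp differentiable_neg)).differentiableAt ((isOpen_extNhd _ _ _).mem_nhds hm)).hasDerivAt
  have h2 := h.comp z (hasDerivAt_neg z)
  rw [mul_neg_one] at h2
  exact h2

end Solution

/-! ### Gradient bound away from `τ = 1`. -/

/-- The real differential `v ↦ Re (d v)`. -/
noncomputable def reMul (d : ℂ) : ℂ →L[ℝ] ℝ := Complex.reCLM.comp (d • (1 : ℂ →L[ℝ] ℂ))

theorem reMul_apply (d v : ℂ) : reMul d v = (d * v).re := rfl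

theorem norm_reMul_le (d : ℂ) : ‖reMul d‖ ≤ ‖d‖ := by
  refine ContinuousLinearMap.opNorm_le_bound _ (norm_nonneg d) fun v => ?_
  rw [reMul_apply, ← norm_mul]
  exact Complex.abs_re_le_norm _

theorem gradient_bounded_of_hasFDerivAt {f : ℂ → ℝ} {x d : ℂ} {C : ℝ}
    (h : HasFDerivAt f (reMul d) x) (hd : ‖d‖ ≤ C) :
    DifferentiableAt ℝ f x ∧ ‖fderiv ℝ f x‖ ≤ C :=
  ⟨h.differentiableAt, by rw [h.fderiv]; exact (norm_reMul_le d).trans hd⟩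

theorem HasDerivAt.hasFDerivAt_reMul {f : ℂ → ℂ} {d x : ℂ} (h : HasDerivAt f d x) :
    HasFDerivAt (fun z => (f z).re) (reMul d) x := h.hasFDerivAt_re

section GradientBound

variable {r₁ r₂ ε ε₀ κ cmax A B k₁ k₂ : ℝ} {F : ℂ → ℂ} {H u : ℂ → ℝ} {z : ℂ}

theorem UniformBounds.norm_deriv_fields_le (h : UniformBounds r₁ r₂ ε₀ κ cmax A B F)
    (hε : 0 < ε) (hεε : ε ≤ ε₀) (hk₁ : 0 < k₁) (hk₂ : 0 < k₂) {δ : ℝ} (hδ : 0 < δ)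
    (hτ : tau k₁ k₂ ≤ 1 - δ) :
    (r₁ ≤ ‖z - center₁ r₁ r₂ ε‖ → ‖deriv (leftField r₁ r₂ ε k₁ k₂ F) z‖
      ≤ 2 * (A * κ⁻¹ ^ 2 / δ + (A * κ⁻¹ ^ 2 + variationBound κ cmax A B))) ∧
    (r₂ ≤ ‖z - center₂ r₁ r₂ ε‖ → ‖deriv (rightField r₁ r₂ ε k₁ k₂ F) (-z)‖
      ≤ 2 * (A * κ⁻¹ ^ 2 / δ + (A * κ⁻¹ ^ 2 + variationBound κ cmax A B))) := by
  have hd := pencilData_disks h.r₁_pos h.r₂_pos hε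
  constructor
  · intro hz
    rw [← norm_sub_center₁] at hz
    have hE := h.fieldBounds_left hε hεε hz
    exact norm_deriv_imageField_le hd (abs_contrast_lt_one hk₁) (abs_contrast_mul_lt_one hk₁ hk₂)
      hδ hτ h.diff hz hE hE.conj_neg
  · intro hz
    rw [← norm_sub_center₂] at hz
    have hE := h.fieldBounds_right hε hεε hz
    exact norm_deriv_imageField_le hd.symm (abs_contrast_lt_one hk₂)
      (abs_contrast_mul_lt_one hk₂ hk₁) hδ (by rwa [mul_comm]) (h.diff.comp differentiable_neg)
      hz hE hE.conj_neg

/-- Uniform gradient bound for products of contrasts away from `1`. -/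
theorem UniformBounds.gradientBoundedOn (h : UniformBounds r₁ r₂ ε₀ κ cmax A B F)
    (hε : 0 < ε) (hεε : ε ≤ ε₀) (hk₁ : 0 < k₁) (hk₂ : 0 < k₂) {δ : ℝ} (hδ : 0 < δ)
    (hτ : tau k₁ k₂ ≤ 1 - δ) (hFH : ∀ z, (F z).re = H z)
    (hu : IsSolution (conductivity r₁ r₂ ε k₁ k₂) H u) :
    GradientBoundedOn (fun x => u x - H x)
      (frontier (disk₁ r₁ r₂ ε) ∪ frontier (disk₂ r₁ r₂ ε))ᶜ
      (A + 2 * (2 * (A * κ⁻¹ ^ 2 / δ + (A * κ⁻¹ ^ 2 + variationBound κ cmax A B)))) := by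
  intro x hx
  have h₁ := h.r₁_pos
  have h₂ := h.r₂_pos
  have hd := pencilData_disks h₁ h₂ hε
  have hA := h.A_nonneg (hε.trans_le hεε)
  set C := 2 * (A * κ⁻¹ ^ 2 / δ + (A * κ⁻¹ ^ 2 + variationBound κ cmax A B)) with hC
  -- Each field is bounded on the whole exterior of its own disk, hence also inside the other disk.
  -- An inner gradient involves `F'` once and the other field twice, which gives `A + 2 C`.
  have hb : ∀ z : ℂ, (r₁ ≤ ‖z - center₁ r₁ r₂ ε‖ → ‖deriv (leftField r₁ r₂ ε k₁ k₂ F) z‖ ≤ C) ∧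
    (r₂ ≤ ‖z - center₂ r₁ r₂ ε‖ → ‖deriv (rightField r₁ r₂ ε k₁ k₂ F) (-z)‖ ≤ C) :=
    fun z => h.norm_deriv_fields_le hε hεε hk₁ hk₂ hδ hτ
  have hsub₁ : ∀ z : ℂ, ‖z - center₁ r₁ r₂ ε‖ ≤ r₁ → r₂ < ‖z - center₂ r₁ r₂ ε‖ := fun z hz =>
    hd.closedBall_subset z (by simpa [dist_eq_norm] using hz)
  have hsub₂ : ∀ z : ℂ, ‖z - center₂ r₁ r₂ ε‖ ≤ r₂ → r₁ < ‖z - center₁ r₁ r₂ ε‖ := fun z hz => by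
    simpa [← sub_eq_add_neg] using hd.closedBall_subset' z (by simpa [dist_eq_norm] using hz)
  have hFb : ∀ z, ‖z‖ ≤ 2 * cmax → ‖deriv F z‖ ≤ A := fun z hz =>
    h.bound z (hz.trans h.two_cmax_le)
  rw [disk₁, disk₂, frontier_ball _ h₁.ne', frontier_ball _ h₂.ne', mem_compl_iff, mem_union,
    not_or, mem_sphere_iff_norm, mem_sphere_iff_norm] at hx
  have cont : ∀ c : ℂ, Continuous fun z : ℂ => ‖z - c‖ := fun c => by fun_prop
  rcases lt_or_gt_of_ne hx.1 with hx₁ | hx₁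
  · have hx₂ := hsub₁ x hx₁.le
    have ev : ∀ᶠ z : ℂ in 𝓝 x, ‖z - center₁ r₁ r₂ ε‖ < r₁ :=
      (isOpen_lt (cont _) continuous_const).mem_nhds hx₁
    have g := hasDerivAt_rightField_neg h₁ h₂ hε hk₁ hk₂ h.diff hx₂.le
    have hD := ((((h.diff x).hasDerivAt.add g).sub_const (F (center₁ r₁ r₂ ε)
      + rightField r₁ r₂ ε k₁ k₂ F (-center₁ r₁ r₂ ε))).const_mul (-contrast k₁ : ℂ)).add g
    refine gradient_bounded_of_hasFDerivAt (hD.hasFDerivAt_reMul.congr_of_eventuallyEq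
      (ev.mono fun z hz => ?_)) ?_
    · exact hu.eq_left h₁ h₂ hε hk₁ hk₂ h.diff hFH hz.le (hsub₁ z hz.le).le
    · have b1 := (hb x).2 hx₂.le
      have b2 : ‖deriv F x‖ ≤ A := hFb x (by
        have e1 := norm_sub_norm_le x (center₁ r₁ r₂ ε)
        have e2 := (h.center_le hε hεε).1
        have e3 := hd.r_le_c
        have e4 := hd.c₁_pos
        rw [Complex.norm_real, Real.norm_of_nonpos (by linarith)] at e1
        linarith)
      have b3 := (abs_contrast_lt_one hk₁).le
      refine (norm_add_le _ _).trans ?_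
      rw [norm_mul, norm_neg, norm_neg, Complex.norm_real, Real.norm_eq_abs]
      have b4 := norm_add_le (deriv F x) (-deriv (rightField r₁ r₂ ε k₁ k₂ F) (-x))
      rw [norm_neg] at b4
      have b5 := mul_le_of_le_one_left (norm_nonneg (deriv F x
        + -deriv (rightField r₁ r₂ ε k₁ k₂ F) (-x))) b3
      linarith
  · rcases lt_or_gt_of_ne hx.2 with hx₂ | hx₂
    · have ev : ∀ᶠ z : ℂ in 𝓝 x, ‖z - center₂ r₁ r₂ ε‖ < r₂ :=
        (isOpen_lt (cont _) continuous_const).mem_nhds hx₂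
      have g := hasDerivAt_leftField h₁ h₂ hε hk₁ hk₂ h.diff hx₁.le
      have hD := ((((h.diff x).hasDerivAt.add g).sub_const (F (center₂ r₁ r₂ ε)
        + leftField r₁ r₂ ε k₁ k₂ F (center₂ r₁ r₂ ε))).const_mul (-contrast k₂ : ℂ)).add g
      refine gradient_bounded_of_hasFDerivAt (hD.hasFDerivAt_reMul.congr_of_eventuallyEq
        (ev.mono fun z hz => ?_)) ?_
      · exact hu.eq_right h₁ h₂ hε hk₁ hk₂ h.diff hFH (hsub₂ z hz.le).le hz.le
      · have b1 := (hb x).1 hx₁.le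
        have b2 : ‖deriv F x‖ ≤ A := hFb x (by
          have e1 := norm_sub_norm_le x (center₂ r₁ r₂ ε)
          have e2 := (h.center_le hε hεε).2
          have e3 := hd.symm.r_le_c
          have e4 := hd.c₂_pos
          rw [Complex.norm_real, Real.norm_of_nonneg (by linarith)] at e1
          linarith)
        have b3 := (abs_contrast_lt_one hk₂).le
        refine (norm_add_le _ _).trans ?_
        rw [norm_mul, norm_neg, Complex.norm_real, Real.norm_eq_abs]
        have b4 := norm_add_le (deriv F x) (deriv (leftField r₁ r₂ ε k₁ k₂ F) x)
        have b5 := mul_le_of_le_one_left (norm_nonneg (deriv F x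
          + deriv (leftField r₁ r₂ ε k₁ k₂ F) x)) b3
        linarith
    · have ev : ∀ᶠ z : ℂ in 𝓝 x, r₁ < ‖z - center₁ r₁ r₂ ε‖ ∧ r₂ < ‖z - center₂ r₁ r₂ ε‖ :=
        Filter.inter_mem ((isOpen_lt continuous_const (cont _)).mem_nhds hx₁)
          ((isOpen_lt continuous_const (cont _)).mem_nhds hx₂)
      have hD := (hasDerivAt_leftField h₁ h₂ hε hk₁ hk₂ h.diff hx₁.le).add
        (hasDerivAt_rightField_neg h₁ h₂ hε hk₁ hk₂ h.diff hx₂.le)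
      refine gradient_bounded_of_hasFDerivAt (hD.hasFDerivAt_reMul.congr_of_eventuallyEq
        (ev.mono fun z hz => ?_)) ?_
      · exact hu.eq_fields h₁ h₂ hε hk₁ hk₂ h.diff hFH hz.1.le hz.2.le
      · have b1 := (hb x).1 hx₁.le
        have b2 := (hb x).2 hx₂.le
        refine (norm_add_le _ _).trans ?_
        rw [norm_neg]
        linarith

end GradientBound

/-! ### When the product of the contrasts is close to `1`. -/

section Contrast

theorem contrast_eq {k : ℝ} (hk : 0 < k) : contrast k = 1 - 2 / (k + 1) := by
  unfold contrast
  have : k + 1 ≠ 0 := by positivity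
  field_simp
  ring

theorem contrast_inv {k : ℝ} (hk : 0 < k) : contrast k⁻¹ = -contrast k := by
  unfold contrast
  have : k + 1 ≠ 0 := by positivity
  have : 1 + k ≠ 0 := by positivity
  field_simp
  ring

theorem lt_of_lt_contrast {M k : ℝ} (hM : 0 < M) (hk : 0 < k)
    (h : 1 - 2 / (M + 1) < contrast k) : M < k := by
  rw [contrast_eq hk] at h
  have : 2 / (k + 1) < 2 / (M + 1) := by linarith
  rw [div_lt_div_iff₀ (by positivity) (by positivity)] at this
  linarith

/-- The product of the contrasts is close to `1` only if both conductivities are large or both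
are small. -/
theorem exists_large_of_tau {M : ℝ} (hM : 0 < M) : ∃ δ : ℝ, 0 < δ ∧ ∀ k₁ k₂ : ℝ, 0 < k₁ →
    0 < k₂ → 1 - δ < tau k₁ k₂ → (M < k₁ ∧ M < k₂) ∨ (k₁ < M⁻¹ ∧ k₂ < M⁻¹) := by
  have hpos : ∀ k₁ k₂ : ℝ, 0 < k₁ → 0 < k₂ → 0 < contrast k₁ → 0 < contrast k₂ →
      1 - min 1 (2 / (M + 1)) < tau k₁ k₂ → M < k₁ ∧ M < k₂ := by
    intro k₁ k₂ h₁ h₂ c₁ c₂ h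
    have b₁ := (abs_lt.1 (abs_contrast_lt_one h₁)).2
    have b₂ := (abs_lt.1 (abs_contrast_lt_one h₂)).2
    have hm := min_le_right 1 (2 / (M + 1))
    unfold tau at h
    constructor
    · exact lt_of_lt_contrast hM h₁ (by nlinarith)
    · exact lt_of_lt_contrast hM h₂ (by nlinarith)
  -- The bound `1` forces `τ > 0`, hence contrasts of equal sign; `2/(M + 1)` is `1 - contrast M`.
  -- Both negative reduces to both positive by inverting the conductivities, which leaves `τ`
  -- unchanged.
  refine ⟨min 1 (2 / (M + 1)), lt_min one_pos (by positivity), fun k₁ k₂ h₁ h₂ h => ?_⟩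
  have hτ : 0 < contrast k₁ * contrast k₂ := by
    have := min_le_left 1 (2 / (M + 1))
    unfold tau at h
    linarith
  rcases mul_pos_iff.1 hτ with ⟨c₁, c₂⟩ | ⟨c₁, c₂⟩
  · exact Or.inl (hpos k₁ k₂ h₁ h₂ c₁ c₂ h)
  · right
    have := hpos k₁⁻¹ k₂⁻¹ (inv_pos.2 h₁) (inv_pos.2 h₂) (by rw [contrast_inv h₁]; linarith)
      (by rw [contrast_inv h₂]; linarith)
      (by rwa [tau, contrast_inv h₁, contrast_inv h₂, neg_mul_neg])
    exact ⟨(lt_inv_comm₀ hM h₁).1 this.1, (lt_inv_comm₀ hM h₂).1 this.2⟩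

/-- With `M = 4/δ` each contrast of a large conductivity exceeds `1 - δ/2`; small conductivities are
inverted, which preserves `τ`. -/
theorem exists_tau_of_large {δ : ℝ} (hδ : 0 < δ) : ∃ M : ℝ, 0 < M ∧ ∀ k₁ k₂ : ℝ, 0 < k₁ →
    0 < k₂ → (M < k₁ ∧ M < k₂) ∨ (k₁ < M⁻¹ ∧ k₂ < M⁻¹) → 1 - δ < tau k₁ k₂ := by
  have hpos : ∀ k₁ k₂ : ℝ, 0 < k₁ → 0 < k₂ → 4 / δ < k₁ → 4 / δ < k₂ → 1 - δ < tau k₁ k₂ := by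
    intro k₁ k₂ h₁ h₂ c₁ c₂
    have key : ∀ k : ℝ, 0 < k → 4 / δ < k → 2 / (k + 1) < δ / 2 := fun k hk hc => by
      rw [div_lt_iff₀ hδ] at hc
      rw [div_lt_div_iff₀ (by positivity) (by norm_num)]
      nlinarith
    have b₁ := key k₁ h₁ c₁
    have b₂ := key k₂ h₂ c₂
    have p₁ : 0 < 2 / (k₁ + 1) := by positivity
    have p₂ : 0 < 2 / (k₂ + 1) := by positivity
    rw [tau, contrast_eq h₁, contrast_eq h₂]
    nlinarith
  refine ⟨4 / δ, by positivity, fun k₁ k₂ h₁ h₂ h => ?_⟩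
  have hM : 0 < 4 / δ := by positivity
  rcases h with h | h
  · exact hpos k₁ k₂ h₁ h₂ h.1 h.2
  · have := hpos k₁⁻¹ k₂⁻¹ (inv_pos.2 h₁) (inv_pos.2 h₂) ((lt_inv_comm₀ h₁ hM).1 h.1)
      ((lt_inv_comm₀ h₂ hM).1 h.2)
    rwa [tau, contrast_inv h₁, contrast_inv h₂, neg_mul_neg] at this

end Contrast

/-! ### The line-charge and dipole representations. -/

theorem reMul_add (c d : ℂ) : reMul (c + d) = reMul c + reMul d := by
  ext v
  simp [reMul_apply, add_mul]

theorem reMul_sub (c d : ℂ) : reMul (c - d) = reMul c - reMul d := by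
  ext v
  simp [reMul_apply, sub_mul]

theorem reMul_ofReal_mul (c : ℝ) (d : ℂ) : reMul (c * d) = c • reMul d := by
  ext v
  simp [reMul_apply, mul_assoc]

/-- The choice `L' = 2a/ρ` gives the prefactor `2a/L' = ρ`, which in the application is `r_*²/2`,
while `b` becomes `β`. -/
theorem norm_deriv_imageField_sub_charge_le {a r₁ r₂ c₁ c₂ κ cmax A B t₁ t₂ ρ e lmax m₁ m₂ b : ℝ}
    {F : ℂ → ℂ} {z : ℂ} (h : PencilData a r₁ r₂ c₁ c₂) (hcal : Calibrated a c₁ c₂ ρ e lmax m₁ m₂)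
    (ht₁ : |t₁| < 1) (hT0 : 0 < t₁ * t₂) (hT1 : t₁ * t₂ < 1) (hF : Differentiable ℂ F)
    (hz : r₁ ≤ ‖z + c₁‖) (hE : FieldBounds a c₁ κ cmax A B (deriv F) z)
    (hb : b = -Real.log (t₁ * t₂) * ρ / (2 * e)) {q q' : ℂ}
    (hq : ((t₁ * t₂ : ℝ) : ℂ) * deriv F 0 + t₁ * conj (deriv F 0) = q + q')
    (hqA : ‖q‖ ≤ 2 * ‖deriv F 0‖) (hq' : ‖q'‖ ≤ ‖deriv F 0‖ * (1 - t₁ * t₂)) :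
    ‖deriv (imageField a c₁ c₂ t₁ t₂ F) z
      - q * (ρ * lineField a c₁ (2 * a) b (fun s => 1 / (z + s) ^ 2))‖
      ≤ fieldError κ cmax A B lmax m₁ m₂ := by
  have ha := h.a_pos
  have hρ := hcal.ρ_pos
  have he := hcal.e_pos
  have hlog : 0 < -Real.log (t₁ * t₂) := neg_pos.2 (Real.log_neg hT0 hT1)
  have h0 : ‖deriv F 0‖ ≤ A := hE.bound 0 hE.norm_zero_le
  have e1 : 2 * a / (2 * a / ρ) = ρ := by field_simp
  have e2 : (ρ : ℂ) * lineField a c₁ (2 * a) b (fun s => 1 / (z + s) ^ 2)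
      = lineField a c₁ (2 * a / ρ) b (fun s => 1 / (z + s) ^ 2) := by
    simp only [lineField, e1, div_self (by positivity : 2 * a ≠ 0), one_mul]
    rw [← intervalIntegral.integral_const_mul]
    refine intervalIntegral.integral_congr fun s _ => ?_
    push_cast
    ring
  rw [e2]
  refine norm_deriv_imageField_sub_lineField_le h ht₁ hT0 hT1 hF hz hE hcal.length_le
    (by rw [hb]; positivity) (by rw [e1]; exact hρ.le) (by rw [e1]; exact hcal.ρ_le)
    hcal.length_sub (fun y hy0 hy1 => ?_) hq (hqA.trans (by linarith))
    (hq'.trans (mul_le_mul_of_nonneg_right h0 (by linarith)))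
  have := hcal.rpow_sub (-Real.log (t₁ * t₂)) y hlog hy0 hy1
  rwa [neg_div_neg_eq, ← hb] at this

section Charges

variable {r₁ r₂ ε ε₀ κ cmax A B k₁ k₂ lmax m₁ m₂ : ℝ} {F : ℂ → ℂ} {H u : ℂ → ℝ} {z : ℂ}

theorem beta_eq (h₁ : 0 < r₁) (h₂ : 0 < r₂) (hε : 0 < ε) : beta r₁ r₂ ε k₁ k₂
    = -Real.log (tau k₁ k₂) * (rStar r₁ r₂ ^ 2 / 2) / (2 * (rStar r₁ r₂ * √ε)) := by
  have : 0 < rStar r₁ r₂ := Real.sqrt_pos.2 (by positivity)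
  have : 0 < √ε := Real.sqrt_pos.2 hε
  unfold beta
  field_simp
  ring

theorem beta_pos (h₁ : 0 < r₁) (h₂ : 0 < r₂) (hε : 0 < ε) (hτ0 : 0 < tau k₁ k₂)
    (hτ1 : tau k₁ k₂ < 1) : 0 < beta r₁ r₂ ε k₁ k₂ := by
  have : 0 < rStar r₁ r₂ := Real.sqrt_pos.2 (by positivity)
  have : 0 < -Real.log (tau k₁ k₂) := neg_pos.2 (Real.log_neg hτ0 hτ1)
  unfold beta
  positivity

theorem hasFDerivAt_log_norm_add {z c : ℂ} (hz : z + c ≠ 0) :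
    HasFDerivAt (fun z : ℂ => Real.log ‖z + c‖) (reMul (1 / (z + c))) z := by
  have h := (hasFDerivAt_log_norm hz).comp z ((hasFDerivAt_id z).add_const c)
  convert! h using 1

theorem hasFDerivAt_log_norm_neg_add {z c : ℂ} (hz : -z + c ≠ 0) :
    HasFDerivAt (fun z : ℂ => Real.log ‖-z + c‖) (reMul (-(1 / (-z + c)))) z := by
  have h := (hasFDerivAt_log_norm hz).comp z ((hasFDerivAt_id z).neg.add_const c)
  convert! h using 1
  ext v
  simp [reMul_apply]

theorem FieldBounds.hasDerivAt_linePotential {a c : ℝ} {E : ℂ → ℂ}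
    (h : FieldBounds a c κ cmax A B E z) {b : ℝ} (hb : 0 ≤ b) :
    HasDerivAt (linePotential a c b) (-lineField a c (2 * a) b fun s => 1 / (z + s) ^ 2) z := by
  have ha := h.a_pos
  have hκ := h.κ_pos
  refine _root_.hasDerivAt_linePotential ha h.a_lt hb (mul_pos hκ ha) fun s hs => ?_
  refine le_trans ?_ (h.dist s hs.1 hs.2)
  have := norm_nonneg z
  have := hs.1
  gcongr
  linarith

theorem FieldBounds.hasDerivAt_linePotential_neg {a c : ℝ} {E : ℂ → ℂ}
    (h : FieldBounds a c κ cmax A B E (-z)) {b : ℝ} (hb : 0 ≤ b) :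
    HasDerivAt (fun z => linePotential a c b (-z))
      (lineField a c (2 * a) b fun s => 1 / (-z + s) ^ 2) z := by
  have h2 := (h.hasDerivAt_linePotential hb).comp z (hasDerivAt_neg z)
  rw [mul_neg_one, neg_neg] at h2
  exact h2

/-- Two conductors better than the surrounding medium: the gradient is that of line charges. -/
theorem UniformBounds.gradientBoundedOn_logCharge (h : UniformBounds r₁ r₂ ε₀ κ cmax A B F)
    (hε : 0 < ε) (hεε : ε ≤ ε₀) (hk₁ : 1 < k₁) (hk₂ : 1 < k₂)
    (hcal : Calibrated (alpha r₁ r₂ ε) (-center₁ r₁ r₂ ε) (center₂ r₁ r₂ ε)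
      (rStar r₁ r₂ ^ 2 / 2) (rStar r₁ r₂ * √ε) lmax m₁ m₂)
    (hFH : ∀ z, (F z).re = H z) (hu : IsSolution (conductivity r₁ r₂ ε k₁ k₂) H u) :
    GradientBoundedOn (fun x => u x - H x - (deriv F 0).re * rStar r₁ r₂ ^ 2 / 2 *
        (logCharge (center₁ r₁ r₂ ε) (-alpha r₁ r₂ ε) (phi₁ r₁ r₂ ε k₁ k₂) x
          - logCharge (alpha r₁ r₂ ε) (center₂ r₁ r₂ ε) (phi₂ r₁ r₂ ε k₁ k₂) x))
      (closure (disk₁ r₁ r₂ ε) ∪ closure (disk₂ r₁ r₂ ε))ᶜ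
      (2 * fieldError κ cmax A B lmax m₁ m₂
        + |(deriv F 0).re * rStar r₁ r₂ ^ 2 / 2| * (2 / r₁ + 2 / r₂)) := by
  intro x hx
  have h₁ := h.r₁_pos
  have h₂ := h.r₂_pos
  have hd := pencilData_disks h₁ h₂ hε
  have hk₁0 : 0 < k₁ := by linarith
  have hk₂0 : 0 < k₂ := by linarith
  have t₁0 : 0 < contrast k₁ := div_pos (by linarith) (by linarith)
  have t₂0 : 0 < contrast k₂ := div_pos (by linarith) (by linarith)
  have t₁a := abs_contrast_lt_one hk₁0
  have t₂a := abs_contrast_lt_one hk₂0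
  have t₁1 := (abs_lt.1 t₁a).2
  have t₂1 := (abs_lt.1 t₂a).2
  have hT0 : 0 < tau k₁ k₂ := mul_pos t₁0 t₂0
  have hT1 : tau k₁ k₂ < 1 := (abs_lt.1 (abs_contrast_mul_lt_one hk₁0 hk₂0)).2
  have hb := beta_pos h₁ h₂ hε hT0 hT1
  have hbe := beta_eq (k₁ := k₁) (k₂ := k₂) h₁ h₂ hε
  rw [disk₁, disk₂, closure_ball _ h₁.ne', closure_ball _ h₂.ne', mem_compl_iff, mem_union,
    not_or, mem_closedBall_iff_norm, mem_closedBall_iff_norm, not_le, not_le] at hx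
  obtain ⟨hx₁, hx₂⟩ := hx
  have cont : ∀ c : ℂ, Continuous fun z : ℂ => ‖z - c‖ := fun c => by fun_prop
  have ev : ∀ᶠ z : ℂ in 𝓝 x, r₁ < ‖z - center₁ r₁ r₂ ε‖ ∧ r₂ < ‖z - center₂ r₁ r₂ ε‖ :=
    Filter.inter_mem ((isOpen_lt continuous_const (cont _)).mem_nhds hx₁)
      ((isOpen_lt continuous_const (cont _)).mem_nhds hx₂)
  have hE₁ : ∀ z : ℂ, r₁ < ‖z - center₁ r₁ r₂ ε‖ → FieldBounds (alpha r₁ r₂ ε)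
      (-center₁ r₁ r₂ ε) κ cmax A B (deriv F) z := fun z hz =>
    h.fieldBounds_left hε hεε (by rw [norm_sub_center₁]; exact hz.le)
  have hE₂ : ∀ z : ℂ, r₂ < ‖z - center₂ r₁ r₂ ε‖ → FieldBounds (alpha r₁ r₂ ε)
      (center₂ r₁ r₂ ε) κ cmax A B (deriv fun w => F (-w)) (-z) := fun z hz =>
    h.fieldBounds_right hε hεε (by rw [norm_sub_center₂]; exact hz.le)
  set I₁ := lineField (alpha r₁ r₂ ε) (-center₁ r₁ r₂ ε) (2 * alpha r₁ r₂ ε)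
    (beta r₁ r₂ ε k₁ k₂) (fun s => 1 / (x + s) ^ 2) with hI₁
  set I₂ := lineField (alpha r₁ r₂ ε) (center₂ r₁ r₂ ε) (2 * alpha r₁ r₂ ε)
    (beta r₁ r₂ ε k₁ k₂) (fun s => 1 / (-x + s) ^ 2) with hI₂
  set g₁ := deriv (leftField r₁ r₂ ε k₁ k₂ F) x
  set g₂ := deriv (rightField r₁ r₂ ε k₁ k₂ F) (-x)
  set K := (deriv F 0).re * rStar r₁ r₂ ^ 2 / 2 with hK
  have n₁ : r₁ ≤ ‖x + (-center₁ r₁ r₂ ε : ℝ)‖ := by rw [norm_sub_center₁]; exact hx₁.le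
  have n₂ : r₂ ≤ ‖-x + (center₂ r₁ r₂ ε : ℝ)‖ := by rw [norm_sub_center₂]; exact hx₂.le
  have d₁ := (hasDerivAt_leftField h₁ h₂ hε hk₁0 hk₂0 h.diff hx₁.le).hasFDerivAt_reMul
  have d₂ := (hasDerivAt_rightField_neg h₁ h₂ hε hk₁0 hk₂0 h.diff hx₂.le).hasFDerivAt_reMul
  have p₁ := ((hE₁ x hx₁).hasDerivAt_linePotential hb.le).hasFDerivAt_reMul
  have p₂ := ((hE₂ x hx₂).hasDerivAt_linePotential_neg hb.le).hasFDerivAt_reMul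
  have l₁ := hasFDerivAt_log_norm_add (norm_pos_iff.1 (h₁.trans_le n₁))
  have l₂ := hasFDerivAt_log_norm_neg_add (norm_pos_iff.1 (h₂.trans_le n₂))
  have D := (d₁.add d₂).sub ((((l₁.sub p₁).const_mul (tau k₁ k₂ + contrast k₁)).sub
    ((l₂.sub p₂).const_mul (tau k₁ k₂ + contrast k₂))).const_mul K)
  set w₁ := 1 / (x + (-center₁ r₁ r₂ ε : ℝ)) with hw₁
  set w₂ := 1 / (-x + (center₂ r₁ r₂ ε : ℝ)) with hw₂
  have q₁ := charge_split_pos (deriv F 0) t₁0 t₁1 t₂0 t₂1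
  -- In the mirrored coordinate the outer derivative at `0` is `-F'(0)`. Since the logarithm is
  -- even, this sign produces the difference of the two line charges.
  have q₂ := charge_split_pos (deriv (fun w => F (-w)) 0) t₂0 t₂1 t₁0 t₁1
  have b₁ := norm_deriv_imageField_sub_charge_le hd hcal t₁a hT0 hT1 h.diff n₁ (hE₁ x hx₁) hbe
    q₁.1 q₁.2.1 q₁.2.2
  have b₂ := norm_deriv_imageField_sub_charge_le (b := beta r₁ r₂ ε k₁ k₂) hd.symm hcal.symm t₂a
    (by rw [mul_comm]; exact hT0) (by rw [mul_comm]; exact hT1)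
    (show Differentiable ℂ fun w => F (-w) from h.diff.comp differentiable_neg) n₂
    (hE₂ x hx₂) (by rw [hbe, tau, mul_comm (contrast k₁)]) q₂.1 q₂.2.1 q₂.2.2
  rw [deriv_fun_comp_neg] at b₂
  -- The derivative of the remainder is grouped into the two approximation errors and the two point
  -- charges left by the integration by parts. The latter are bounded through `‖w₁‖ ≤ 1/r₁` and
  -- `‖w₂‖ ≤ 1/r₂`.
  refine gradient_bounded_of_hasFDerivAt (d := (g₁ - ((contrast k₁ * contrast k₂ + contrast k₁)
      * (deriv F 0).re : ℝ) * ((rStar r₁ r₂ ^ 2 / 2 : ℝ) * I₁))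
    - (g₂ - ((contrast k₂ * contrast k₁ + contrast k₂) * (-deriv F (-0)).re : ℝ)
      * ((rStar r₁ r₂ ^ 2 / 2 : ℝ) * I₂))
    - K * ((tau k₁ k₂ + contrast k₁) * w₁ + (tau k₁ k₂ + contrast k₂) * w₂)) ?_ ?_
  · convert! D.congr_of_eventuallyEq (ev.mono fun z hz => ?_) using 1
    · simp only [← reMul_add, ← reMul_sub, ← reMul_ofReal_mul]
      congr 1
      simp only [hK, tau, I₁, I₂, g₁, g₂, neg_zero, Complex.neg_re]
      push_cast
      ring
    · have s₁ : ∀ s ∈ Icc (alpha r₁ r₂ ε) (-center₁ r₁ r₂ ε), z + (s : ℝ) ≠ 0 := fun s hs =>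
        (hE₁ z hz.1).add_ne_zero hs.1 hs.2
      have s₂ : ∀ s ∈ Icc (alpha r₁ r₂ ε) (center₂ r₁ r₂ ε), -z + (s : ℝ) ≠ 0 := fun s hs =>
        (hE₂ z hz.2).add_ne_zero hs.1 hs.2
      simp only [logCharge_phi₁ h₁ h₂ hε hb s₁, logCharge_phi₂ h₁ h₂ hε hb s₂,
        hu.eq_fields h₁ h₂ hε hk₁0 hk₂0 h.diff hFH hz.1.le hz.2.le]
      rfl
  · have bw₁ : ‖w₁‖ ≤ 1 / r₁ := by
      rw [hw₁, norm_div, norm_one]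
      gcongr
    have bw₂ : ‖w₂‖ ≤ 1 / r₂ := by
      rw [hw₂, norm_div, norm_one]
      gcongr
    refine (norm_sub_le _ _).trans (add_le_add ((norm_sub_le _ _).trans ?_) ?_)
    · rw [two_mul]
      exact add_le_add b₁ b₂
    · rw [norm_mul, Complex.norm_real, Real.norm_eq_abs]
      refine mul_le_mul_of_nonneg_left ((norm_add_le _ _).trans ?_) (abs_nonneg _)
      have key : ∀ (t : ℝ) (w : ℂ) (r : ℝ), 0 < t → t < 1 → ‖w‖ ≤ 1 / r →
          ‖(tau k₁ k₂ + t) * w‖ ≤ 2 / r := fun t w r ht0 ht1 hw => by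
        rw [norm_mul, ← Complex.ofReal_add, Complex.norm_real, Real.norm_of_nonneg (by linarith)]
        calc _ ≤ 2 * (1 / r) := mul_le_mul (by linarith) hw (norm_nonneg _) (by norm_num)
          _ = _ := by ring
      exact add_le_add (key _ _ _ t₁0 t₁1 bw₁) (key _ _ _ t₂0 t₂1 bw₂)

/-- Two conductors worse than the surrounding medium: the gradient is that of line
distributions of dipoles. -/
theorem UniformBounds.gradientBoundedOn_dipoleCharge (h : UniformBounds r₁ r₂ ε₀ κ cmax A B F)
    (hε : 0 < ε) (hεε : ε ≤ ε₀) (hk₁0 : 0 < k₁) (hk₁ : k₁ < 1) (hk₂0 : 0 < k₂) (hk₂ : k₂ < 1)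
    (hcal : Calibrated (alpha r₁ r₂ ε) (-center₁ r₁ r₂ ε) (center₂ r₁ r₂ ε)
      (rStar r₁ r₂ ^ 2 / 2) (rStar r₁ r₂ * √ε) lmax m₁ m₂)
    (hFH : ∀ z, (F z).re = H z) (hu : IsSolution (conductivity r₁ r₂ ε k₁ k₂) H u) :
    GradientBoundedOn (fun x => u x - H x - -(deriv F 0).im * rStar r₁ r₂ ^ 2 / 2 *
        (dipoleCharge (center₁ r₁ r₂ ε) (-alpha r₁ r₂ ε) (psi₁ r₁ r₂ ε k₁ k₂) x
          + dipoleCharge (alpha r₁ r₂ ε) (center₂ r₁ r₂ ε) (psi₂ r₁ r₂ ε k₁ k₂) x))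
      (closure (disk₁ r₁ r₂ ε) ∪ closure (disk₂ r₁ r₂ ε))ᶜ
      (2 * fieldError κ cmax A B lmax m₁ m₂) := by
  intro x hx
  have h₁ := h.r₁_pos
  have h₂ := h.r₂_pos
  have hd := pencilData_disks h₁ h₂ hε
  have t₁0 : contrast k₁ < 0 := div_neg_of_neg_of_pos (by linarith) (by linarith)
  have t₂0 : contrast k₂ < 0 := div_neg_of_neg_of_pos (by linarith) (by linarith)
  have t₁a := abs_contrast_lt_one hk₁0
  have t₂a := abs_contrast_lt_one hk₂0
  have t₁1 := (abs_lt.1 t₁a).1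
  have t₂1 := (abs_lt.1 t₂a).1
  have hT0 : 0 < tau k₁ k₂ := mul_pos_of_neg_of_neg t₁0 t₂0
  have hT1 : tau k₁ k₂ < 1 := (abs_lt.1 (abs_contrast_mul_lt_one hk₁0 hk₂0)).2
  have hb := beta_pos h₁ h₂ hε hT0 hT1
  have hbe := beta_eq (k₁ := k₁) (k₂ := k₂) h₁ h₂ hε
  rw [disk₁, disk₂, closure_ball _ h₁.ne', closure_ball _ h₂.ne', mem_compl_iff, mem_union,
    not_or, mem_closedBall_iff_norm, mem_closedBall_iff_norm, not_le, not_le] at hx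
  obtain ⟨hx₁, hx₂⟩ := hx
  have cont : ∀ c : ℂ, Continuous fun z : ℂ => ‖z - c‖ := fun c => by fun_prop
  have ev : ∀ᶠ z : ℂ in 𝓝 x, r₁ < ‖z - center₁ r₁ r₂ ε‖ ∧ r₂ < ‖z - center₂ r₁ r₂ ε‖ :=
    Filter.inter_mem ((isOpen_lt continuous_const (cont _)).mem_nhds hx₁)
      ((isOpen_lt continuous_const (cont _)).mem_nhds hx₂)
  have hE₁ : ∀ z : ℂ, r₁ < ‖z - center₁ r₁ r₂ ε‖ → FieldBounds (alpha r₁ r₂ ε)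
      (-center₁ r₁ r₂ ε) κ cmax A B (deriv F) z := fun z hz =>
    h.fieldBounds_left hε hεε (by rw [norm_sub_center₁]; exact hz.le)
  have hE₂ : ∀ z : ℂ, r₂ < ‖z - center₂ r₁ r₂ ε‖ → FieldBounds (alpha r₁ r₂ ε)
      (center₂ r₁ r₂ ε) κ cmax A B (deriv fun w => F (-w)) (-z) := fun z hz =>
    h.fieldBounds_right hε hεε (by rw [norm_sub_center₂]; exact hz.le)
  have n₁ : r₁ ≤ ‖x + (-center₁ r₁ r₂ ε : ℝ)‖ := by rw [norm_sub_center₁]; exact hx₁.le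
  have n₂ : r₂ ≤ ‖-x + (center₂ r₁ r₂ ε : ℝ)‖ := by rw [norm_sub_center₂]; exact hx₂.le
  set K := -(deriv F 0).im * rStar r₁ r₂ ^ 2 / 2 with hK
  have d₁ := hasDerivAt_leftField h₁ h₂ hε hk₁0 hk₂0 h.diff hx₁.le
  have d₂ := hasDerivAt_rightField_neg h₁ h₂ hε hk₁0 hk₂0 h.diff hx₂.le
  -- Multiplication by `±i` turns the imaginary parts in the dipole charges into real parts, so the
  -- remainder is the real part of one holomorphic function. No integration by parts occurs, hence
  -- no point charges.
  have p₁ := ((hE₁ x hx₁).hasDerivAt_linePotential hb.le).const_mul Complex.I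
  have p₂ := ((hE₂ x hx₂).hasDerivAt_linePotential_neg hb.le).const_mul (-Complex.I)
  have D := (d₁.add d₂).sub (((p₁.const_mul ((tau k₁ k₂ - contrast k₁ : ℝ) : ℂ)).add
    (p₂.const_mul ((tau k₁ k₂ - contrast k₂ : ℝ) : ℂ))).const_mul (K : ℂ))
  have q₁ := charge_split_neg (deriv F 0) t₁0 t₁1 t₂0 t₂1
  have q₂ := charge_split_neg (deriv (fun w => F (-w)) 0) t₂0 t₂1 t₁0 t₁1
  have b₁ := norm_deriv_imageField_sub_charge_le hd hcal t₁a hT0 hT1 h.diff n₁ (hE₁ x hx₁) hbe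
    q₁.1 q₁.2.1 q₁.2.2
  have b₂ := norm_deriv_imageField_sub_charge_le (b := beta r₁ r₂ ε k₁ k₂) hd.symm hcal.symm t₂a
    (by rw [mul_comm]; exact hT0) (by rw [mul_comm]; exact hT1)
    (show Differentiable ℂ fun w => F (-w) from h.diff.comp differentiable_neg) n₂
    (hE₂ x hx₂) (by rw [hbe, tau, mul_comm (contrast k₁)]) q₂.1 q₂.2.1 q₂.2.2
  rw [deriv_fun_comp_neg] at b₂
  refine gradient_bounded_of_hasFDerivAt (D.hasFDerivAt_reMul.congr_of_eventuallyEq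
    (ev.mono fun z hz => ?_)) ?_
  · have s₁ : ∀ s ∈ Icc (alpha r₁ r₂ ε) (-center₁ r₁ r₂ ε), z + (s : ℝ) ≠ 0 := fun s hs =>
      (hE₁ z hz.1).add_ne_zero hs.1 hs.2
    have s₂ : ∀ s ∈ Icc (alpha r₁ r₂ ε) (center₂ r₁ r₂ ε), -z + (s : ℝ) ≠ 0 := fun s hs =>
      (hE₂ z hz.2).add_ne_zero hs.1 hs.2
    simp only [dipoleCharge_psi₁ h₁ h₂ hε hb s₁, dipoleCharge_psi₂ h₁ h₂ hε hb s₂,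
      hu.eq_fields h₁ h₂ hε hk₁0 hk₂0 h.diff hFH hz.1.le hz.2.le, Pi.add_apply, Pi.sub_apply,
      Complex.sub_re, Complex.re_ofReal_mul, Complex.add_re, Complex.I_mul_re, neg_mul,
      Complex.neg_re, neg_neg]
  · refine le_trans (le_of_eq ?_) (((norm_sub_le _ _).trans (add_le_add b₁ b₂)).trans_eq
      (two_mul _).symm)
    congr 1
    rw [hK, tau]
    simp only [leftField, rightField, neg_zero, Complex.neg_im]
    push_cast
    ring

end Charges

/-! ### Assembly of the theorem. -/

theorem theorem5p4 (r₁ r₂ : ℝ) (hr₁ : 0 < r₁) (hr₂ : 0 < r₂)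
    (H : ℂ → ℝ) (hH : InnerProductSpace.HarmonicOnNhd H Set.univ)
    (ε₀ : ℝ) (hε₀ : 0 < ε₀) :
    -- the gradient is uniformly bounded unless `τ` is close to `1`
    (∀ δ : ℝ, 0 < δ → ∃ C : ℝ, ∀ ε : ℝ, 0 < ε → ε ≤ ε₀ →
      ∀ k₁ k₂ : ℝ, 0 < k₁ → 0 < k₂ → k₁ ≠ 1 → k₂ ≠ 1 → tau k₁ k₂ ≤ 1 - δ →
      ∀ u : ℂ → ℝ, IsSolution (conductivity r₁ r₂ ε k₁ k₂) H u →
        GradientBoundedOn (fun x => u x - H x)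
          (frontier (disk₁ r₁ r₂ ε) ∪ frontier (disk₂ r₁ r₂ ε))ᶜ C) ∧
    -- `τ` is close to `1` exactly when both conductivities are large or both are small
    (∀ M : ℝ, 0 < M → ∃ δ : ℝ, 0 < δ ∧ ∀ k₁ k₂ : ℝ, 0 < k₁ → 0 < k₂ →
      1 - δ < tau k₁ k₂ → (M < k₁ ∧ M < k₂) ∨ (k₁ < M⁻¹ ∧ k₂ < M⁻¹)) ∧
    (∀ δ : ℝ, 0 < δ → ∃ M : ℝ, 0 < M ∧ ∀ k₁ k₂ : ℝ, 0 < k₁ → 0 < k₂ →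
      (M < k₁ ∧ M < k₂) ∨ (k₁ < M⁻¹ ∧ k₂ < M⁻¹) → 1 - δ < tau k₁ k₂) ∧
    -- (a)
    (∃ C : ℝ, ∀ ε : ℝ, 0 < ε → ε ≤ ε₀ → ∀ k₁ k₂ : ℝ, 1 < k₁ → 1 < k₂ →
      IntegrableOn (phi₁ r₁ r₂ ε k₁ k₂) (Set.Icc (center₁ r₁ r₂ ε) (-alpha r₁ r₂ ε)) ∧
      IntegrableOn (phi₂ r₁ r₂ ε k₁ k₂) (Set.Icc (alpha r₁ r₂ ε) (center₂ r₁ r₂ ε)) ∧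
      ∀ u : ℂ → ℝ, IsSolution (conductivity r₁ r₂ ε k₁ k₂) H u →
        ∃ r : ℂ → ℝ,
          (∀ x ∈ (disk₁ r₁ r₂ ε ∪ disk₂ r₁ r₂ ε)ᶜ,
            u x = H x + fderiv ℝ H 0 1 * rStar r₁ r₂ ^ 2 / 2 *
              (logCharge (center₁ r₁ r₂ ε) (-alpha r₁ r₂ ε) (phi₁ r₁ r₂ ε k₁ k₂) x
                - logCharge (alpha r₁ r₂ ε) (center₂ r₁ r₂ ε) (phi₂ r₁ r₂ ε k₁ k₂) x) + r x) ∧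
          GradientBoundedOn r (closure (disk₁ r₁ r₂ ε) ∪ closure (disk₂ r₁ r₂ ε))ᶜ C) ∧
    -- (b)
    (∃ C : ℝ, ∀ ε : ℝ, 0 < ε → ε ≤ ε₀ → ∀ k₁ k₂ : ℝ, 0 < k₁ → k₁ < 1 → 0 < k₂ → k₂ < 1 →
      IntegrableOn (psi₁ r₁ r₂ ε k₁ k₂) (Set.Icc (center₁ r₁ r₂ ε) (-alpha r₁ r₂ ε)) ∧
      IntegrableOn (psi₂ r₁ r₂ ε k₁ k₂) (Set.Icc (alpha r₁ r₂ ε) (center₂ r₁ r₂ ε)) ∧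
      ∀ u : ℂ → ℝ, IsSolution (conductivity r₁ r₂ ε k₁ k₂) H u →
        ∃ r : ℂ → ℝ,
          (∀ x ∈ (disk₁ r₁ r₂ ε ∪ disk₂ r₁ r₂ ε)ᶜ,
            u x = H x + fderiv ℝ H 0 Complex.I * rStar r₁ r₂ ^ 2 / 2 *
              (dipoleCharge (center₁ r₁ r₂ ε) (-alpha r₁ r₂ ε) (psi₁ r₁ r₂ ε k₁ k₂) x
                + dipoleCharge (alpha r₁ r₂ ε) (center₂ r₁ r₂ ε) (psi₂ r₁ r₂ ε k₁ k₂) x) + r x) ∧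
          GradientBoundedOn r (closure (disk₁ r₁ r₂ ε) ∪ closure (disk₂ r₁ r₂ ε))ᶜ C) := by
  obtain ⟨F, hFa, hFH'⟩ := hH.exists_analyticOnNhd_univ_re_eq
  have hF : Differentiable ℂ F := fun z => (hFa z (mem_univ z)).differentiableAt
  have hFH : ∀ z, (F z).re = H z := fun z => congrFun hFH' z
  obtain ⟨κ, cmax, A, B, hU⟩ := exists_uniformBounds hr₁ hr₂ hε₀ hF
  obtain ⟨lmax, m₁, m₂, hcal⟩ := exists_calibrated hr₁ hr₂ hε₀
  have hdH : fderiv ℝ H 0 = reMul (deriv F 0) := by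
    rw [← hFH']
    exact (hF 0).hasDerivAt.hasFDerivAt_reMul.fderiv
  have hx : fderiv ℝ H 0 1 = (deriv F 0).re := by rw [hdH, reMul_apply, mul_one]
  -- By the Cauchy–Riemann equations `F' = ∂ₓH - i ∂ᵧH`.
  have hy : fderiv ℝ H 0 Complex.I = -(deriv F 0).im := by
    rw [hdH, reMul_apply, Complex.mul_I_re]
  have hT1 : ∀ {k₁ k₂ : ℝ}, 0 < k₁ → 0 < k₂ → tau k₁ k₂ < 1 := fun h₁ h₂ =>
    (abs_lt.1 (abs_contrast_mul_lt_one h₁ h₂)).2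
  refine ⟨fun δ hδ => ⟨_, fun ε hε hεε k₁ k₂ hk₁ hk₂ _ _ hτ u hu =>
      hU.gradientBoundedOn hε hεε hk₁ hk₂ hδ hτ hFH hu⟩,
    fun M hM => exists_large_of_tau hM, fun δ hδ => exists_tau_of_large hδ,
    ⟨2 * fieldError κ cmax A B lmax m₁ m₂
        + |(deriv F 0).re * rStar r₁ r₂ ^ 2 / 2| * (2 / r₁ + 2 / r₂),
      fun ε hε hεε k₁ k₂ hk₁ hk₂ => ?_⟩,
    ⟨2 * fieldError κ cmax A B lmax m₁ m₂, fun ε hε hεε k₁ k₂ hk₁0 hk₁ hk₂0 hk₂ => ?_⟩⟩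
  · have hb := beta_pos hr₁ hr₂ hε (mul_pos (div_pos (sub_pos.2 hk₁) (by linarith))
      (div_pos (sub_pos.2 hk₂) (by linarith))) (hT1 (by linarith) (by linarith))
    obtain ⟨i₁, i₂⟩ := integrableOn_phi hr₁ hr₂ hε hb.le
    -- The remainder is defined as `u - H` minus the charge terms, so the identity is pure algebra;
    -- the content is the gradient bound.
    refine ⟨i₁, i₂, fun u hu => ⟨_, fun x _ => ?_, hU.gradientBoundedOn_logCharge hε hεε hk₁ hk₂
      (hcal ε hε hεε) hFH hu⟩⟩
    rw [hx]
    ring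
  · have hb := beta_pos hr₁ hr₂ hε (mul_pos_of_neg_of_neg (div_neg_of_neg_of_pos
      (sub_neg.2 hk₁) (by linarith)) (div_neg_of_neg_of_pos (sub_neg.2 hk₂) (by linarith)))
      (hT1 hk₁0 hk₂0)
    obtain ⟨i₁, i₂⟩ := integrableOn_psi hr₁ hr₂ hε hb.le
    refine ⟨i₁, i₂, fun u hu => ⟨_, fun x _ => ?_, hU.gradientBoundedOn_dipoleCharge hε hεε hk₁0
      hk₁ hk₂0 hk₂ (hcal ε hε hεε) hFH hu⟩⟩
    rw [hy]
    ring
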